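/- Let $\mathbb H$ be the quaternions, let $\mathrm{Sp}(n)$ be the group of unitary $n\times n$ quaternionic matrices, and let $a,b\ge 1$. Put $G=\mathrm{Sp}(a+1)\times\mathrm{Sp}(b+1)$ and $$H=\left\{\left(\begin{pmatrix}A&0\\0&q\end{pmatrix},\begin{pmatrix}B&0\\0&q\end{pmatrix}\right)\ :\ A\in\mathrm{Sp}(a),\ B\in\mathrm{Sp}(b),\ q\in\mathrm{Sp}(1)\right\}\cong\mathrm{Sp}(a)\times\mathrm{Sp}(b)\times\mathrm{Sp}(1).$$ An isometric action of a Lie group on a Riemannian manifold $M$ is called polar if there is a closed embedded submanifold $\Sigma\subseteq M$ that meets every orbit and such that, at each $p\in\Sigma$, the tangent space of the orbit through $p$ is orthogonal to $T_p\Sigma$. The slice representation at $p$ is the action of the isotropy group of $p$, by differentials, on the normal space at $p$ of the orbit through $p$. Then: 1. For every $G$-invariant Riemannian metric on $G/H$, the isotropy action of $H$ on $G/H$, $h\cdot gH=hgH$, is not polar. 2. There is a point $p\in G/H$ such that, for every $G$-invariant Riemannian metric on $G/H$, the slice representation at $p$ of the $H$-action on $G/H$ is, after its effectivity kernel is factored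 out, equivalent to the action of $\mathrm{SO}(4)$ on $\mathbb R^4\oplus\mathbb R^4$, the direct sum of two copies of the standard representation. That is, there are a continuous surjective homomorphism $\varphi\colon H_p\to\mathrm{SO}(4)$ and a linear isomorphism $L$ from the normal space onto $\mathbb R^4\oplus\mathbb R^4$ with $L(k\cdot v)=\varphi(k)\cdot L(v)$ for all $k\in H_p$ and all normal vectors $v$. 3. The action of $\mathrm{SO}(4)$ on $\mathbb R^4\oplus\mathbb R^4$ is not polar with respect to any $\mathrm{SO}(4)$-invariant inner product. -/

import Mathlib

open scoped Manifold ContDiff Topology Quaternion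

namespace QuatEx

noncomputable section

section General

variable {E : Type} [NormedAddCommGroup E] [NormedSpace ℝ E]
  {M : Type} [TopologicalSpace M] [ChartedSpace E M]

/-- `S` is an embedded smooth submanifold of dimension `k`: around each point of `S` there is a
chart of the smooth structure of `M` in which `S` becomes a `k`-dimensional linear subspace. -/
def IsEmbeddedSubmanifold (E : Type) [NormedAddCommGroup E] [NormedSpace ℝ E]
    [FiniteDimensional ℝ E] {M : Type} [TopologicalSpace M] [ChartedSpace E M]
    (k : ℕ) (S : Set M) : Prop :=
  ∀ p ∈ S, ∃ e ∈ IsManifold.maximalAtlas 𝓘(ℝ, E) ∞ M, p ∈ e.source ∧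
    ∃ F : Submodule ℝ E, Module.finrank ℝ F = k ∧ ∀ q ∈ e.source, q ∈ S ↔ e q ∈ F

/-- The vectors tangent to the subset `S` of `M` at `p`: the velocities at time `0` of smooth
curves of `M` that stay in `S` and are at `p` at time `0`. -/
def tangentVectors (S : Set M) (p : M) : Set (TangentSpace 𝓘(ℝ, E) p) :=
  {v | ∃ γ : ℝ → M, ContMDiff 𝓘(ℝ, ℝ) 𝓘(ℝ, E) ∞ γ ∧ (∀ t, γ t ∈ S) ∧
    tangentMap 𝓘(ℝ, ℝ) 𝓘(ℝ, E) γ ⟨(0 : ℝ), (1 : ℝ)⟩ = ⟨p, v⟩}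

/-- A family of maps `act k : M → M`, `k ∈ K` (a group action) is polar with respect to the
field `μ` of inner products on the tangent spaces of `M` if it has a section: a closed embedded
submanifold `S` which meets every orbit, and which is orthogonal to the orbit of `p` at each of
its points `p`. -/
def IsPolarAction [FiniteDimensional ℝ E] {K : Type} (act : K → M → M)
    (μ : ∀ p : M, TangentSpace 𝓘(ℝ, E) p →L[ℝ] TangentSpace 𝓘(ℝ, E) p →L[ℝ] ℝ) : Prop :=
  ∃ (S : Set M) (k : ℕ), IsClosed S ∧ IsEmbeddedSubmanifold E k S ∧
    (∀ x : M, ∃ h : K, act h x ∈ S) ∧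
    ∀ p ∈ S, ∀ u ∈ tangentVectors (Set.range fun h : K ↦ act h p) p,
      ∀ w ∈ tangentVectors S p, μ p u w = 0

variable {K : Type} [Group K] [MulAction K M]

/-- Every element of `K` acts on `M` by a smooth map. -/
class IsSmoothAction (E : Type) [NormedAddCommGroup E] [NormedSpace ℝ E] (K M : Type) [Group K]
    [TopologicalSpace M] [ChartedSpace E M] [MulAction K M] : Prop where
  contMDiff_smul : ∀ k : K, ContMDiff 𝓘(ℝ, E) 𝓘(ℝ, E) ∞ (fun x : M ↦ k • x)

instance [IsSmoothAction E K M] (L : Subgroup K) : IsSmoothAction E L M :=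
  ⟨fun k ↦ IsSmoothAction.contMDiff_smul (k : K)⟩

/-- Smooth Riemannian metrics on `M` for which every element of `K` acts by isometries. -/
structure InvariantRiemannianMetric (E : Type) [NormedAddCommGroup E] [NormedSpace ℝ E]
    (K M : Type) [Group K] [TopologicalSpace M] [ChartedSpace E M] [MulAction K M]
    [IsManifold 𝓘(ℝ, E) ∞ M] extends
    Bundle.ContMDiffRiemannianMetric 𝓘(ℝ, E) ∞ E (fun p : M ↦ TangentSpace 𝓘(ℝ, E) p) where
  invariant : ∀ (k : K) (p : M) (v w : TangentSpace 𝓘(ℝ, E) p),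
    inner (k • p) (mfderiv 𝓘(ℝ, E) 𝓘(ℝ, E) (fun x : M ↦ k • x) p v)
      (mfderiv 𝓘(ℝ, E) 𝓘(ℝ, E) (fun x : M ↦ k • x) p w) = inner p v w

/-- A `K`-invariant metric is invariant under every subgroup of `K`. -/
def InvariantRiemannianMetric.restrict [IsManifold 𝓘(ℝ, E) ∞ M]
    (μ : InvariantRiemannianMetric E K M) (L : Subgroup K) : InvariantRiemannianMetric E L M :=
  { μ with invariant := fun k p v w ↦ μ.invariant (k : K) p v w }

/-- Equal points have the same tangent space. -/
def tangentCast {p q : M} (h : p = q) :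
    TangentSpace 𝓘(ℝ, E) p →ₗ[ℝ] TangentSpace 𝓘(ℝ, E) q := h ▸ LinearMap.id

theorem mk_tangentCast {p q : M} (h : p = q) (v : TangentSpace 𝓘(ℝ, E) p) :
    (⟨q, tangentCast h v⟩ : TangentBundle 𝓘(ℝ, E) M) = ⟨p, v⟩ := by
  subst h; rfl

/-- The differential at `p` of an element `k` of the isotropy group of `p`, as an endomorphism of
the tangent space at `p`. -/
def isotropyMap (p : M) (k : MulAction.stabilizer K p) :
    TangentSpace 𝓘(ℝ, E) p →ₗ[ℝ] TangentSpace 𝓘(ℝ, E) p :=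
  (tangentCast (E := E) (MulAction.mem_stabilizer_iff.1 k.2)).comp
    (mfderiv 𝓘(ℝ, E) 𝓘(ℝ, E) (fun x : M ↦ (k : K) • x) p).toLinearMap

theorem mk_isotropyMap (p : M) (k : MulAction.stabilizer K p) (v : TangentSpace 𝓘(ℝ, E) p) :
    (⟨p, isotropyMap p k v⟩ : TangentBundle 𝓘(ℝ, E) M) =
      tangentMap 𝓘(ℝ, E) 𝓘(ℝ, E) (fun x : M ↦ (k : K) • x) ⟨p, v⟩ :=
  mk_tangentCast _ _

theorem isotropyMap_one (p : M) :
    isotropyMap p (1 : MulAction.stabilizer K p) = (LinearMap.id (M := TangentSpace 𝓘(ℝ, E) p)) := by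
  ext v
  have h := mk_isotropyMap (E := E) p (1 : MulAction.stabilizer K p) v
  have h1 : (fun x : M ↦ ((1 : MulAction.stabilizer K p) : K) • x) = id := by
    funext x; simp
  rw [h1, tangentMap_id] at h
  simpa using h

theorem isotropyMap_mul [IsSmoothAction E K M] (p : M) (k l : MulAction.stabilizer K p) :
    isotropyMap (E := E) p (k * l) = (isotropyMap p k).comp (isotropyMap p l) := by
  ext v
  have hs (k : K) : MDifferentiable 𝓘(ℝ, E) 𝓘(ℝ, E) (fun x : M ↦ k • x) :=
    (IsSmoothAction.contMDiff_smul k).mdifferentiable (by simp)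
  have h := mk_isotropyMap (E := E) p (k * l) v
  have h1 : (fun x : M ↦ ((k * l : MulAction.stabilizer K p) : K) • x) =
      (fun x : M ↦ (k : K) • x) ∘ (fun x : M ↦ (l : K) • x) := by
    funext x; simp [mul_smul]
  rw [h1, tangentMap_comp (hs k) (hs l), Function.comp_apply, ← mk_isotropyMap, ← mk_isotropyMap]
    at h
  simpa using h

/-- The linear isotropy representation at `p`. -/
def isotropyRepresentation (E : Type) [NormedAddCommGroup E] [NormedSpace ℝ E]
    {M : Type} [TopologicalSpace M] [ChartedSpace E M] (K : Type) [Group K] [MulAction K M]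
    [IsSmoothAction E K M] (p : M) :
    Representation ℝ (MulAction.stabilizer K p) (TangentSpace 𝓘(ℝ, E) p) where
  toFun k := isotropyMap p k
  map_one' := isotropyMap_one p
  map_mul' k l := isotropyMap_mul p k l

/-- The isotropy group of `p` maps vectors tangent to the orbit through `p` to such vectors. -/
theorem isotropyMap_mem_tangentVectors [IsSmoothAction E K M] (p : M)
    (k : MulAction.stabilizer K p) (v : TangentSpace 𝓘(ℝ, E) p)
    (hv : v ∈ tangentVectors (MulAction.orbit K p) p) :
    isotropyMap p k v ∈ tangentVectors (MulAction.orbit K p) p := by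
  obtain ⟨γ, hγ, hS, h⟩ := hv
  have hk := IsSmoothAction.contMDiff_smul (E := E) (M := M) (k : K)
  refine ⟨fun t ↦ (k : K) • γ t, hk.comp hγ, fun t ↦ ?_, ?_⟩
  · exact MulAction.mem_orbit_of_mem_orbit _ (hS t)
  · have := tangentMap_comp (I := 𝓘(ℝ, ℝ)) (hk.mdifferentiable (by simp))
      (hγ.mdifferentiable (by simp))
    change tangentMap 𝓘(ℝ, ℝ) 𝓘(ℝ, E) ((fun x : M ↦ (k : K) • x) ∘ γ) _ = _
    rw [this, Function.comp_apply, h, ← mk_isotropyMap]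

variable [IsManifold 𝓘(ℝ, E) ∞ M]

/-- The normal space at `p` of the orbit through `p`. -/
def normalSpace (μ : InvariantRiemannianMetric E K M) (p : M) :
    Submodule ℝ (TangentSpace 𝓘(ℝ, E) p) where
  carrier := {v | ∀ u ∈ tangentVectors (MulAction.orbit K p) p, μ.inner p u v = 0}
  add_mem' hv hw u hu := by rw [map_add, hv u hu, hw u hu, add_zero]
  zero_mem' u _ := map_zero _
  smul_mem' c v hv u hu := by rw [map_smul, hv u hu, smul_zero]

theorem inner_tangentCast (μ : InvariantRiemannianMetric E K M) {p q : M} (h : p = q)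
    (v w : TangentSpace 𝓘(ℝ, E) p) :
    μ.inner q (tangentCast h v) (tangentCast h w) = μ.inner p v w := by
  subst h; rfl

theorem isotropyMap_mem_normalSpace [IsSmoothAction E K M] (μ : InvariantRiemannianMetric E K M)
    (p : M) (k : MulAction.stabilizer K p) (v : TangentSpace 𝓘(ℝ, E) p)
    (hv : v ∈ normalSpace μ p) : isotropyMap p k v ∈ normalSpace μ p := by
  intro u hu
  have h1 := hv _ (isotropyMap_mem_tangentVectors p k⁻¹ u hu)
  have h2 : isotropyMap p k (isotropyMap p k⁻¹ u) = u := by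
    have := LinearMap.congr_fun (isotropyMap_mul (E := E) p k k⁻¹) u
    rw [mul_inv_cancel, isotropyMap_one] at this
    exact this.symm
  rw [← h2, ← h1]
  exact (inner_tangentCast μ (MulAction.mem_stabilizer_iff.1 k.2) _ _).trans (μ.invariant _ p _ _)

/-- The slice representation at `p` of the isometric action of `K` on `M`: the isotropy group of
`p` acts, by differentials, on the normal space at `p` of the orbit through `p`. -/
def sliceRepresentation [IsSmoothAction E K M] (μ : InvariantRiemannianMetric E K M) (p : M) :
    Representation ℝ (MulAction.stabilizer K p) (normalSpace μ p) where
  toFun k := (isotropyRepresentation E K p k).restrict (isotropyMap_mem_normalSpace μ p k)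
  map_one' := by
    ext v
    simp [LinearMap.restrict_apply]
  map_mul' k l := by
    ext v
    exact LinearMap.congr_fun (isotropyMap_mul (E := E) p k l) (v : TangentSpace 𝓘(ℝ, E) p)

end General

section Space

open scoped Matrix

/-- The compact symplectic group, as the group of unitary quaternionic matrices. -/
abbrev Sp (n : Type) [Fintype n] [DecidableEq n] : Type := unitary (Matrix n n ℍ[ℝ])

/-- The block diagonal embedding of `Sp m × Sp n` into `Sp (m ⊕ n)`. -/
def Sp.diag {m n : Type} [Fintype m] [DecidableEq m] [Fintype n] [DecidableEq n] :
    Sp m × Sp n →* Sp (m ⊕ n) where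
  toFun g := ⟨Matrix.fromBlocks g.1.1 0 0 g.2.1, by
    have h1 := Unitary.mem_iff.1 g.1.2
    have h2 := Unitary.mem_iff.1 g.2.2
    simp only [Matrix.star_eq_conjTranspose] at h1 h2
    rw [Unitary.mem_iff]
    constructor <;> simp only [Matrix.star_eq_conjTranspose, Matrix.fromBlocks_conjTranspose,
      Matrix.fromBlocks_multiply, Matrix.conjTranspose_zero, Matrix.mul_zero, Matrix.zero_mul,
      add_zero, zero_add, h1.1, h1.2, h2.1, h2.2, Matrix.fromBlocks_one]⟩
  map_one' := Subtype.ext Matrix.fromBlocks_one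
  map_mul' g h := Subtype.ext <| by
    change Matrix.fromBlocks (g.1.1 * h.1.1) 0 0 (g.2.1 * h.2.1) =
      Matrix.fromBlocks g.1.1 0 0 g.2.1 * Matrix.fromBlocks h.1.1 0 0 h.2.1
    simp only [Matrix.fromBlocks_multiply, Matrix.mul_zero, Matrix.zero_mul, add_zero, zero_add]

/-- The group `G = Sp(a+1) × Sp(b+1)`; the matrices are written in block form with a last
diagonal block of size one. -/
abbrev SpPair (a b : ℕ) : Type := Sp (Fin a ⊕ Fin 1) × Sp (Fin b ⊕ Fin 1)

/-- The embedding `(A, B, q) ↦ (diag (A, q), diag (B, q))` of `Sp(a) × Sp(b) × Sp(1)`. -/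
def subgroupEmbedding (a b : ℕ) : Sp (Fin a) × Sp (Fin b) × Sp (Fin 1) →* SpPair a b where
  toFun h := (Sp.diag (h.1, h.2.2), Sp.diag (h.2.1, h.2.2))
  map_one' := by
    ext1
    · exact map_one Sp.diag
    · exact map_one Sp.diag
  map_mul' g h := by
    ext1
    · exact map_mul Sp.diag (g.1, g.2.2) (h.1, h.2.2)
    · exact map_mul Sp.diag (g.2.1, g.2.2) (h.2.1, h.2.2)

/-- The subgroup `H = Sp(a) × Sp(b) × Sp(1)` of `G`, with `Sp(1)` diagonally embedded. -/
def SpSub (a b : ℕ) : Subgroup (SpPair a b) := (subgroupEmbedding a b).range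

/-- The homogeneous space `G/H`, with the quotient topology. -/
abbrev SpQuot (a b : ℕ) : Type := SpPair a b ⧸ SpSub a b

attribute [local instance] Matrix.linftyOpNormedRing Matrix.linftyOpNormedAlgebra

/-- The vector space of pairs of matrices, in which `G` is an embedded submanifold. -/
abbrev MatPair (a b : ℕ) : Type :=
  Matrix (Fin a ⊕ Fin 1) (Fin a ⊕ Fin 1) ℍ[ℝ] × Matrix (Fin b ⊕ Fin 1) (Fin b ⊕ Fin 1) ℍ[ℝ]

/-- The inclusion of `G` into the pairs of matrices. -/
def SpPair.val {a b : ℕ} (g : SpPair a b) : MatPair a b := (g.1, g.2)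

/-- The model vector space of `G/H`, of dimension `4 a + 4 b + 3`. -/
abbrev ModelSp (a b : ℕ) : Type := (Fin a → ℍ[ℝ]) × (Fin b → ℍ[ℝ]) × (Fin 3 → ℝ)


/-- A chart `e` of the topological space `G/H` is smooth if the composition of `e` with the
projection `G → G/H` is smooth and if the inverse of `e` lifts locally to smooth maps into `G`.
A function on `G` is smooth at a point if it has a smooth local extension to the space
of pairs of matrices, and a map into `G` is smooth if it is so as a map into that space. -/
structure IsSmoothChart {a b : ℕ} (e : OpenPartialHomeomorph (SpQuot a b) (ModelSp a b)) : Prop where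
  smooth_comp_mk : ∀ g : SpPair a b, (g : SpQuot a b) ∈ e.source → ∃ F : MatPair a b → ModelSp a b,
    ContDiffAt ℝ ∞ F g.val ∧ ∀ᶠ g' : SpPair a b in 𝓝 g, e (g' : SpQuot a b) = F g'.val
  smooth_lift : ∀ x ∈ e.target, ∃ s : ModelSp a b → SpPair a b,
    ContDiffAt ℝ ∞ (fun y ↦ (s y).val) x ∧ ∀ᶠ y in 𝓝 x, e.symm y = (s y : SpQuot a b)

theorem SpPair.continuous_val {a b : ℕ} : Continuous (SpPair.val (a := a) (b := b)) := by
  unfold SpPair.val; fun_prop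

theorem SpPair.continuousAt_of_val {a b : ℕ} {X : Type} [TopologicalSpace X] {s : X → SpPair a b} {x : X}
    (h : ContinuousAt (fun y ↦ (s y).val) x) : ContinuousAt s x := by
  have h1 : ContinuousAt (fun y ↦ (s y).1) x :=
    Topology.IsInducing.subtypeVal.continuousAt_iff.2 (continuousAt_fst.comp h)
  have h2 : ContinuousAt (fun y ↦ (s y).2) x :=
    Topology.IsInducing.subtypeVal.continuousAt_iff.2 (continuousAt_snd.comp h)
  exact h1.prodMk h2

/-- Left translations of `G/H` are smooth in smooth charts. -/
theorem IsSmoothChart.contDiffAt {a b : ℕ} {e e' : OpenPartialHomeomorph (SpQuot a b) (ModelSp a b)}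
    (he : IsSmoothChart e) (he' : IsSmoothChart e') (g : SpPair a b) {x : ModelSp a b}
    (hx : x ∈ e.target) (hx' : g • e.symm x ∈ e'.source) :
    ContDiffAt ℝ ∞ (fun y ↦ e' (g • e.symm y)) x := by
  obtain ⟨s, hs, hse⟩ := he.smooth_lift x hx
  have hsx : e.symm x = (s x : SpQuot a b) := hse.self_of_nhds
  obtain ⟨F, hF, hFe⟩ := he'.smooth_comp_mk (g * s x) (by rw [hsx] at hx'; exact hx')
  have hm : ContDiffAt ℝ ∞ (fun y ↦ (g * s y).val) x := by
    have : (fun y ↦ (g * s y).val) = fun y ↦ g.val * (s y).val := rfl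
    rw [this]
    exact contDiffAt_const.mul hs
  have hc : ContinuousAt (fun y ↦ g * s y) x := SpPair.continuousAt_of_val hm.continuousAt
  refine (hF.comp x hm).congr_of_eventuallyEq ?_
  filter_upwards [hse, hc.eventually hFe] with y hy hy'
  rw [hy]
  exact hy'

instance : StarModule ℝ ℍ[ℝ] := ⟨Quaternion.star_smul⟩

/-- A matrix valued map is smooth if its entries are. -/
theorem contDiffAt_matrix {X : Type} [NormedAddCommGroup X] [NormedSpace ℝ X] {m : Type}
    [Fintype m] [DecidableEq m] {f : X → Matrix m m ℍ[ℝ]} {x : X}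
    (h : ∀ i j, ContDiffAt ℝ ∞ (fun y ↦ f y i j) x) : ContDiffAt ℝ ∞ f x := by
  let L : (m → m → ℍ[ℝ]) →L[ℝ] Matrix m m ℍ[ℝ] :=
    LinearMap.toContinuousLinearMap (Matrix.ofLinearEquiv ℝ).toLinearMap
  have h1 : ContDiffAt ℝ ∞ (fun y ↦ (fun i j ↦ f y i j : m → m → ℍ[ℝ])) x :=
    contDiffAt_pi.2 fun i ↦ contDiffAt_pi.2 fun j ↦ h i j
  exact L.contDiff.contDiffAt.comp x h1

theorem contDiff_entry {m : Type} [Fintype m] [DecidableEq m] (i j : m) :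
    ContDiff ℝ ∞ (fun A : Matrix m m ℍ[ℝ] ↦ A i j) :=
  (LinearMap.toContinuousLinearMap (Matrix.entryLinearMap ℝ ℍ[ℝ] i j)).contDiff

/-- The imaginary coordinates of a quaternion. -/
def imCoord : ℍ[ℝ] →ₗ[ℝ] (Fin 3 → ℝ) where
  toFun q := ![q.imI, q.imJ, q.imK]
  map_add' p q := by ext i; fin_cases i <;> simp
  map_smul' c q := by ext i; fin_cases i <;> simp

/-- The real coordinate of a quaternion. -/
def reCoord : ℍ[ℝ] →ₗ[ℝ] ℝ where
  toFun q := q.re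
  map_add' p q := by simp
  map_smul' c q := by simp

/-- The imaginary quaternion with given coordinates. -/
def ofIm : (Fin 3 → ℝ) →ₗ[ℝ] ℍ[ℝ] where
  toFun c := ⟨0, c 0, c 1, c 2⟩
  map_add' p q := by
    apply Quaternion.ext
    · exact (add_zero _).symm
    · rfl
    · rfl
    · rfl
  map_smul' c q := by
    apply Quaternion.ext
    · exact (mul_zero _).symm
    · rfl
    · rfl
    · rfl

@[simp] theorem re_ofIm (c : Fin 3 → ℝ) : (ofIm c).re = 0 := rfl
@[simp] theorem imI_ofIm (c : Fin 3 → ℝ) : (ofIm c).imI = c 0 := rfl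
@[simp] theorem imJ_ofIm (c : Fin 3 → ℝ) : (ofIm c).imJ = c 1 := rfl
@[simp] theorem imK_ofIm (c : Fin 3 → ℝ) : (ofIm c).imK = c 2 := rfl
@[simp] theorem reCoord_apply (q : ℍ[ℝ]) : reCoord q = q.re := rfl
@[simp] theorem imCoord_apply (q : ℍ[ℝ]) : imCoord q = ![q.imI, q.imJ, q.imK] := rfl

theorem contDiff_imCoord : ContDiff ℝ ∞ imCoord := (LinearMap.toContinuousLinearMap imCoord).contDiff
theorem contDiff_reCoord : ContDiff ℝ ∞ reCoord := (LinearMap.toContinuousLinearMap reCoord).contDiff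
theorem contDiff_ofIm : ContDiff ℝ ∞ ofIm := (LinearMap.toContinuousLinearMap ofIm).contDiff

/-- The last index. -/
abbrev lst {a : ℕ} : Fin a ⊕ Fin 1 := Sum.inr 0

/-- Auxiliary function for the coordinates at the base point of `G/H`. -/
def midCoord {a b : ℕ} (A : MatPair a b) : ℍ[ℝ] := A.1 lst lst * star (A.2 lst lst)

/-- Coordinates of `G/H` near the base point. -/
def baseCoord {a b : ℕ} (A : MatPair a b) : ModelSp a b :=
  (fun i ↦ A.1 (Sum.inl i) lst * (A.1 lst lst)⁻¹, fun j ↦ A.2 (Sum.inl j) lst * (A.2 lst lst)⁻¹,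
    (reCoord (midCoord A))⁻¹ • imCoord (midCoord A))

theorem contDiffAt_quatInv {q : ℍ[ℝ]} (hq : q ≠ 0) : ContDiffAt ℝ ∞ (fun p : ℍ[ℝ] ↦ p⁻¹) q := by
  have := contDiffAt_ringInverse ℝ (n := ∞) (Units.mk0 q hq)
  simpa [Ring.inverse_eq_inv'] using this

theorem contDiff_midCoord {a b : ℕ} : ContDiff ℝ ∞ (midCoord (a := a) (b := b)) := by
  have h1 := (contDiff_entry (lst : Fin a ⊕ Fin 1) lst).comp
    (contDiff_fst (𝕜 := ℝ) (E := Matrix (Fin a ⊕ Fin 1) (Fin a ⊕ Fin 1) ℍ[ℝ])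
      (F := Matrix (Fin b ⊕ Fin 1) (Fin b ⊕ Fin 1) ℍ[ℝ]))
  have h2 := (contDiff_entry (lst : Fin b ⊕ Fin 1) lst).comp
    (contDiff_snd (𝕜 := ℝ) (E := Matrix (Fin a ⊕ Fin 1) (Fin a ⊕ Fin 1) ℍ[ℝ])
      (F := Matrix (Fin b ⊕ Fin 1) (Fin b ⊕ Fin 1) ℍ[ℝ]))
  exact h1.mul ((starL' ℝ (A := ℍ[ℝ])).contDiff.comp h2)

theorem contDiffAt_baseCoord {a b : ℕ} {A : MatPair a b} (h : 0 < reCoord (midCoord A)) :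
    ContDiffAt ℝ ∞ baseCoord A := by
  have h0 : midCoord A ≠ 0 := by rintro h0; simp [h0] at h
  have hs : A.1 lst lst ≠ 0 := by rintro h1; simp [midCoord, h1] at h0
  have ht : A.2 lst lst ≠ 0 := by rintro h1; simp [midCoord, h1] at h0
  have f1 (i) := ((contDiff_entry i (lst : Fin a ⊕ Fin 1)).comp
    (contDiff_fst (𝕜 := ℝ) (E := Matrix (Fin a ⊕ Fin 1) (Fin a ⊕ Fin 1) ℍ[ℝ])
      (F := Matrix (Fin b ⊕ Fin 1) (Fin b ⊕ Fin 1) ℍ[ℝ]))).contDiffAt (x := A)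
  have f2 (i) := ((contDiff_entry i (lst : Fin b ⊕ Fin 1)).comp
    (contDiff_snd (𝕜 := ℝ) (E := Matrix (Fin a ⊕ Fin 1) (Fin a ⊕ Fin 1) ℍ[ℝ])
      (F := Matrix (Fin b ⊕ Fin 1) (Fin b ⊕ Fin 1) ℍ[ℝ]))).contDiffAt (x := A)
  have hm := (contDiff_midCoord (a := a) (b := b)).contDiffAt (x := A)
  refine ContDiffAt.prodMk ?_ (ContDiffAt.prodMk ?_ ?_)
  · exact contDiffAt_pi.2 fun i ↦ (f1 _).mul
      (ContDiffAt.comp A (g := fun p : ℍ[ℝ] ↦ p⁻¹) (contDiffAt_quatInv hs) (f1 lst))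
  · exact contDiffAt_pi.2 fun i ↦ (f2 _).mul
      (ContDiffAt.comp A (g := fun p : ℍ[ℝ] ↦ p⁻¹) (contDiffAt_quatInv ht) (f2 lst))
  · exact ((contDiff_reCoord.contDiffAt.comp A hm).inv h.ne').smul
      (contDiff_imCoord.contDiffAt.comp A hm)

/-- The length of the vector `(x, 1)`. -/
def nu {a : ℕ} (x : Fin a → ℍ[ℝ]) : ℝ := √(1 + ∑ i, ‖x i‖ ^ 2)

theorem nu_pos {a : ℕ} (x : Fin a → ℍ[ℝ]) : 0 < nu x := by unfold nu; positivity

theorem nu_sq {a : ℕ} (x : Fin a → ℍ[ℝ]) : nu x ^ 2 = 1 + ∑ i, ‖x i‖ ^ 2 :=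
  Real.sq_sqrt (by positivity)

theorem contDiff_nu {a : ℕ} : ContDiff ℝ ∞ (nu (a := a)) := by
  refine ContDiff.sqrt ?_ fun x ↦ by positivity
  exact contDiff_const.add (ContDiff.sum fun i _ ↦ (contDiff_apply ℝ ℍ[ℝ] i).norm_sq ℝ)

/-- A unitary matrix with last column proportional to `(x, 1)`. -/
def rotMat {a : ℕ} (x : Fin a → ℍ[ℝ]) : Matrix (Fin a ⊕ Fin 1) (Fin a ⊕ Fin 1) ℍ[ℝ] :=
  Matrix.fromBlocks
    (1 - (nu x * (1 + nu x))⁻¹ • (Matrix.replicateCol (Fin 1) x * (Matrix.replicateCol (Fin 1) x)ᴴ))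
    ((nu x)⁻¹ • Matrix.replicateCol (Fin 1) x) (-(nu x)⁻¹ • (Matrix.replicateCol (Fin 1) x)ᴴ)
    ((nu x)⁻¹ • 1)

theorem nu_neg {a : ℕ} (x : Fin a → ℍ[ℝ]) : nu (-x) = nu x := by simp [nu]

theorem star_rotMat {a : ℕ} (x : Fin a → ℍ[ℝ]) : star (rotMat x) = rotMat (-x) := by
  have h : Matrix.replicateCol (Fin 1) (-x) = -Matrix.replicateCol (Fin 1) x := rfl
  simp only [rotMat, Matrix.star_eq_conjTranspose, Matrix.fromBlocks_conjTranspose, nu_neg, h,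
    Matrix.conjTranspose_smul, Matrix.conjTranspose_sub, Matrix.conjTranspose_one,
    Matrix.conjTranspose_mul, Matrix.conjTranspose_conjTranspose, Matrix.conjTranspose_neg,
    star_trivial, Matrix.neg_mul, Matrix.mul_neg, neg_neg, smul_neg, neg_smul]

theorem rotMat_mul_star {a : ℕ} (x : Fin a → ℍ[ℝ]) : rotMat x * star (rotMat x) = 1 := by
  have h : Matrix.replicateCol (Fin 1) (-x) = -Matrix.replicateCol (Fin 1) x := rfl
  set X := Matrix.replicateCol (Fin 1) x with hX
  have hn := (nu_pos x).ne'
  have hn1 : 1 + nu x ≠ 0 := by have := nu_pos x; positivity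
  have hXX : Xᴴ * X = (nu x ^ 2 - 1) • (1 : Matrix (Fin 1) (Fin 1) ℍ[ℝ]) := by
    ext1 i j
    rw [Subsingleton.elim i 0, Subsingleton.elim j 0, nu_sq]
    simp only [hX, Matrix.mul_apply, Matrix.conjTranspose_apply, Matrix.replicateCol_apply,
      Matrix.smul_apply, Matrix.one_apply_eq, add_sub_cancel_left]
    rw [Finset.sum_smul]
    refine Finset.sum_congr rfl fun i _ ↦ ?_
    rw [Quaternion.star_mul_self, Quaternion.normSq_eq_norm_mul_self, ← sq,
      ← Quaternion.coe_mul_eq_smul, mul_one]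
  have h3 : X * Xᴴ * X = (nu x ^ 2 - 1) • X := by
    rw [Matrix.mul_assoc, hXX, Matrix.mul_smul, Matrix.mul_one]
  have h4 : Xᴴ * (X * Xᴴ) = (nu x ^ 2 - 1) • Xᴴ := by
    rw [← Matrix.mul_assoc, hXX, Matrix.smul_mul, Matrix.one_mul]
  have h5 : X * Xᴴ * (X * Xᴴ) = (nu x ^ 2 - 1) • (X * Xᴴ) := by
    rw [Matrix.mul_assoc, h4, Matrix.mul_smul]
  rw [star_rotMat, rotMat, rotMat, nu_neg, h, ← hX, Matrix.fromBlocks_multiply,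
    ← Matrix.fromBlocks_one]
  simp only [Matrix.conjTranspose_neg, Matrix.neg_mul, Matrix.mul_neg, neg_neg, smul_neg, neg_smul,
    Matrix.smul_mul, Matrix.mul_smul, Matrix.sub_mul, Matrix.mul_sub, Matrix.one_mul,
    Matrix.mul_one, h3, h4, h5, hXX, smul_smul]
  congr 1
  · match_scalars; all_goals (field_simp; try ring)
  · match_scalars; all_goals (field_simp; try ring)
  · match_scalars; all_goals (field_simp; try ring)
  · match_scalars; all_goals (field_simp; try ring)

theorem rotMat_mem {a : ℕ} (x : Fin a → ℍ[ℝ]) : rotMat x ∈ unitary (Matrix (Fin a ⊕ Fin 1)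
    (Fin a ⊕ Fin 1) ℍ[ℝ]) := by
  refine Unitary.mem_iff.2 ⟨?_, rotMat_mul_star x⟩
  have := rotMat_mul_star (-x)
  rwa [star_rotMat, neg_neg, ← star_rotMat] at this

theorem contDiff_rotMat_entry {a : ℕ} (i j : Fin a ⊕ Fin 1) :
    ContDiff ℝ ∞ (fun x : Fin a → ℍ[ℝ] ↦ rotMat x i j) := by
  have hn := contDiff_nu (a := a)
  have hni : ContDiff ℝ ∞ (fun x : Fin a → ℍ[ℝ] ↦ (nu x)⁻¹) := hn.inv fun x ↦ (nu_pos x).ne'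
  have hni2 : ContDiff ℝ ∞ (fun x : Fin a → ℍ[ℝ] ↦ (nu x * (1 + nu x))⁻¹) :=
    (hn.mul (contDiff_const.add hn)).inv fun x ↦ by have := nu_pos x; positivity
  have hx (i : Fin a) : ContDiff ℝ ∞ (fun x : Fin a → ℍ[ℝ] ↦ x i) := contDiff_apply ℝ ℍ[ℝ] i
  have hxs (i : Fin a) : ContDiff ℝ ∞ (fun x : Fin a → ℍ[ℝ] ↦ star (x i)) :=
    (starL' ℝ (A := ℍ[ℝ])).contDiff.comp (hx i)
  rcases i with i | i <;> rcases j with j | j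
  · simp only [rotMat, Matrix.fromBlocks_apply₁₁, Matrix.sub_apply, Matrix.smul_apply,
      Matrix.mul_apply, Matrix.conjTranspose_apply, Matrix.replicateCol_apply,
      Finset.univ_unique, Finset.sum_singleton]
    exact contDiff_const.sub (hni2.smul ((hx i).mul (hxs j)))
  · simp only [rotMat, Matrix.fromBlocks_apply₁₂, Matrix.smul_apply, Matrix.replicateCol_apply]
    exact hni.smul (hx i)
  · simp only [rotMat, Matrix.fromBlocks_apply₂₁, Matrix.smul_apply, Matrix.conjTranspose_apply,
      Matrix.replicateCol_apply]
    exact hni.neg.smul (hxs j)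
  · simp only [rotMat, Matrix.fromBlocks_apply₂₂, Matrix.smul_apply]
    exact hni.smul contDiff_const

/-- The unit quaternion in the direction of `1 + c`. -/
def unitQ (c : Fin 3 → ℝ) : ℍ[ℝ] := ‖1 + ofIm c‖⁻¹ • (1 + ofIm c)

theorem one_add_ofIm_ne (c : Fin 3 → ℝ) : 1 + ofIm c ≠ 0 := by
  intro h
  have : (1 + ofIm c).re = 0 := by rw [h]; rfl
  simp at this

theorem norm_unitQ (c : Fin 3 → ℝ) : ‖unitQ c‖ = 1 := by
  rw [unitQ, norm_smul, norm_inv, norm_norm, inv_mul_cancel₀]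
  exact norm_ne_zero_iff.2 (one_add_ofIm_ne c)

theorem contDiff_unitQ : ContDiff ℝ ∞ unitQ := by
  have h : ContDiff ℝ ∞ (fun c ↦ 1 + ofIm c) := contDiff_const.add contDiff_ofIm
  exact ((h.norm ℝ one_add_ofIm_ne).inv fun c ↦ norm_ne_zero_iff.2 (one_add_ofIm_ne c)).smul h

theorem mem_unitary_of_norm {q : ℍ[ℝ]} (h : ‖q‖ = 1) : star q * q = 1 ∧ q * star q = 1 := by
  rw [Quaternion.star_mul_self, Quaternion.self_mul_star, Quaternion.normSq_eq_norm_mul_self, h]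
  simp

/-- A quaternion of norm one as an element of `Sp(1)`. -/
def toSp1 (q : ℍ[ℝ]) (h : ‖q‖ = 1) : Sp (Fin 1) :=
  ⟨Matrix.of fun _ _ ↦ q, by
    rw [Unitary.mem_iff]
    constructor <;>
    · ext1 i j
      rw [Subsingleton.elim i 0, Subsingleton.elim j 0]
      simp [Matrix.mul_apply, Matrix.star_eq_conjTranspose, mem_unitary_of_norm h]⟩

/-- A local section of the projection of `G` to `G/H`. -/
def baseSection {a b : ℕ} (z : ModelSp a b) : SpPair a b :=
  (⟨rotMat z.1, rotMat_mem z.1⟩ * Sp.diag (1, toSp1 (unitQ z.2.2) (norm_unitQ z.2.2)),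
    ⟨rotMat z.2.1, rotMat_mem z.2.1⟩)

theorem baseSection_fst {a b : ℕ} (z : ModelSp a b) : (baseSection z).val.1 =
    rotMat z.1 * Matrix.fromBlocks 1 0 0 (Matrix.of fun _ _ ↦ unitQ z.2.2) := rfl

theorem baseSection_snd {a b : ℕ} (z : ModelSp a b) : (baseSection z).val.2 = rotMat z.2.1 := rfl

theorem baseSection_fst_inl {a b : ℕ} (z : ModelSp a b) (i : Fin a ⊕ Fin 1) (j : Fin a) :
    (baseSection z).val.1 i (Sum.inl j) = rotMat z.1 i (Sum.inl j) := by
  rw [baseSection_fst, Matrix.mul_apply]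
  simp [Fintype.sum_sum_type, Matrix.one_apply]

theorem baseSection_fst_lst {a b : ℕ} (z : ModelSp a b) (i : Fin a ⊕ Fin 1) :
    (baseSection z).val.1 i lst = rotMat z.1 i lst * unitQ z.2.2 := by
  rw [baseSection_fst, Matrix.mul_apply]
  simp [Fintype.sum_sum_type]

theorem rotMat_inl_lst {a : ℕ} (x : Fin a → ℍ[ℝ]) (i : Fin a) :
    rotMat x (Sum.inl i) lst = (nu x)⁻¹ • x i := by simp [rotMat]

theorem rotMat_lst_lst {a : ℕ} (x : Fin a → ℍ[ℝ]) :
    rotMat x lst lst = (nu x)⁻¹ • 1 := by simp [rotMat]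

theorem contDiff_baseSection {a b : ℕ} : ContDiff ℝ ∞ (fun z : ModelSp a b ↦ (baseSection z).val) := by
  rw [contDiff_iff_contDiffAt]
  intro z
  have h1 : ContDiff ℝ ∞ (fun z : ModelSp a b ↦ z.1) := contDiff_fst
  have h2 : ContDiff ℝ ∞ (fun z : ModelSp a b ↦ z.2.1) := contDiff_fst.comp contDiff_snd
  have h3 : ContDiff ℝ ∞ (fun z : ModelSp a b ↦ z.2.2) := contDiff_snd.comp contDiff_snd
  refine ContDiffAt.prodMk (contDiffAt_matrix fun i j ↦ ContDiff.contDiffAt ?_)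
    (contDiffAt_matrix fun i j ↦ ContDiff.contDiffAt ?_)
  · rcases j with j | j
    · change ContDiff ℝ ∞ (fun z : ModelSp a b ↦ (baseSection z).val.1 i (Sum.inl j))
      simp only [baseSection_fst_inl]
      exact (contDiff_rotMat_entry i (Sum.inl j)).comp h1
    · rw [Subsingleton.elim j 0]
      change ContDiff ℝ ∞ (fun z : ModelSp a b ↦ (baseSection z).val.1 i lst)
      simp only [baseSection_fst_lst]
      exact ((contDiff_rotMat_entry i lst).comp h1).mul (contDiff_unitQ.comp h3)
  · exact (contDiff_rotMat_entry i j).comp h2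

theorem midCoord_baseSection {a b : ℕ} (z : ModelSp a b) :
    midCoord (baseSection z).val =
      ((nu z.1)⁻¹ * (nu z.2.1)⁻¹ * ‖1 + ofIm z.2.2‖⁻¹) • (1 + ofIm z.2.2) := by
  rw [midCoord, baseSection_fst_lst, baseSection_snd, rotMat_lst_lst, rotMat_lst_lst, unitQ]
  rw [star_smul, star_one, star_trivial, mul_smul_comm, mul_one, smul_one_mul, smul_smul, smul_smul]
  congr 1; ring

theorem reCoord_midCoord_baseSection {a b : ℕ} (z : ModelSp a b) :
    reCoord (midCoord (baseSection z).val) =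
      (nu z.1)⁻¹ * (nu z.2.1)⁻¹ * ‖1 + ofIm z.2.2‖⁻¹ := by
  rw [midCoord_baseSection, map_smul]
  simp

theorem reCoord_midCoord_baseSection_pos {a b : ℕ} (z : ModelSp a b) :
    0 < reCoord (midCoord (baseSection z).val) := by
  rw [reCoord_midCoord_baseSection]
  have := nu_pos z.1
  have := nu_pos z.2.1
  have := norm_pos_iff.2 (one_add_ofIm_ne z.2.2)
  positivity

theorem baseCoord_baseSection {a b : ℕ} (z : ModelSp a b) : baseCoord (baseSection z).val = z := by
  have hu : unitQ z.2.2 ≠ 0 := by rw [← norm_ne_zero_iff, norm_unitQ]; exact one_ne_zero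
  have hx := (nu_pos z.1).ne'
  have hy := (nu_pos z.2.1).ne'
  have hr := (reCoord_midCoord_baseSection_pos z).ne'
  refine Prod.ext ?_ (Prod.ext ?_ ?_)
  · funext i
    change (baseSection z).val.1 _ _ * ((baseSection z).val.1 _ _)⁻¹ = _
    rw [baseSection_fst_lst, baseSection_fst_lst, rotMat_lst_lst, rotMat_inl_lst, smul_mul_assoc,
      smul_one_mul, smul_inv₀, smul_mul_smul_comm, mul_assoc, mul_inv_cancel₀ hu,
      inv_inv, inv_mul_cancel₀ hx, one_smul, mul_one]
  · funext i
    change (baseSection z).val.2 _ _ * ((baseSection z).val.2 _ _)⁻¹ = _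
    rw [baseSection_snd, rotMat_lst_lst, rotMat_inl_lst, smul_inv₀, smul_mul_smul_comm, inv_one,
      inv_inv, inv_mul_cancel₀ hy, one_smul, mul_one]
  · change (reCoord (midCoord _))⁻¹ • imCoord (midCoord _) = _
    rw [reCoord_midCoord_baseSection] at hr
    rw [reCoord_midCoord_baseSection, midCoord_baseSection, map_smul, smul_smul,
      inv_mul_cancel₀ hr, one_smul]
    funext i
    fin_cases i <;> simp

/-- Right multiplication by an element of `H` multiplies the last columns by a common unit
quaternion. -/
theorem exists_mul_of_mem {a b : ℕ} {h : SpPair a b} (hh : h ∈ SpSub a b) : ∃ q : ℍ[ℝ], q * star q = 1 ∧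
    (∀ (g : SpPair a b) (i), (g * h).val.1 i lst = g.val.1 i lst * q) ∧
    ∀ (g : SpPair a b) (i), (g * h).val.2 i lst = g.val.2 i lst * q := by
  obtain ⟨⟨A, B, Q⟩, rfl⟩ := hh
  refine ⟨Q.1 0 0, ?_, fun g i ↦ ?_, fun g i ↦ ?_⟩
  · have := congrFun (congrFun (Unitary.mem_iff.1 Q.2).2 0) 0
    simpa [Matrix.mul_apply, Matrix.star_eq_conjTranspose] using this
  · change (g.val.1 * Matrix.fromBlocks A.1 0 0 Q.1) i lst = _
    rw [Matrix.mul_apply]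
    simp [Fintype.sum_sum_type]
  · change (g.val.2 * Matrix.fromBlocks B.1 0 0 Q.1) i lst = _
    rw [Matrix.mul_apply]
    simp [Fintype.sum_sum_type]

/-- A unitary matrix whose last column is a multiple of the last basis vector is block diagonal. -/
theorem Sp.exists_diag {a : ℕ} (g : Sp (Fin a ⊕ Fin 1)) (hg : ∀ i, g.1 (Sum.inl i) lst = 0) :
    ‖g.1 lst lst‖ = 1 ∧ ∃ (A : Sp (Fin a)), ∀ Q : Sp (Fin 1), Q.1 0 0 = g.1 lst lst →
      Sp.diag (A, Q) = g := by
  obtain ⟨h1, h2⟩ := Unitary.mem_iff.1 g.2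
  set A := g.1.toBlocks₁₁ with hA
  set C := g.1.toBlocks₂₁ with hC
  set D := g.1.toBlocks₂₂ with hD
  have hgm : g.1 = Matrix.fromBlocks A 0 C D := by
    rw [← Matrix.fromBlocks_toBlocks g.1]
    congr 1
    ext1 i j
    rw [Subsingleton.elim j 0]
    exact hg i
  rw [hgm, Matrix.star_eq_conjTranspose, Matrix.fromBlocks_conjTranspose,
    Matrix.fromBlocks_multiply, ← Matrix.fromBlocks_one, Matrix.fromBlocks_inj] at h1 h2
  simp only [Matrix.conjTranspose_zero, Matrix.mul_zero, Matrix.zero_mul, add_zero, zero_add]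
    at h1 h2
  have hd : star (D 0 0) * D 0 0 = 1 := by
    have := congrFun (congrFun h1.2.2.2 0) 0
    simpa [Matrix.mul_apply] using this
  have hn : ‖D 0 0‖ = 1 := by
    have := congrArg norm hd
    rw [norm_mul, norm_star, norm_one] at this
    nlinarith [norm_nonneg (D 0 0)]
  have hDD : D * Dᴴ = 1 := by
    ext1 i j
    rw [Subsingleton.elim i 0, Subsingleton.elim j 0]
    simpa [Matrix.mul_apply] using (mem_unitary_of_norm hn).2
  have hC0 : Cᴴ = 0 := by
    rw [← Matrix.mul_one Cᴴ, ← hDD, ← Matrix.mul_assoc, h1.2.1, Matrix.zero_mul]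
  have hC1 : C = 0 := by simpa using hC0
  refine ⟨hn, ⟨A, Unitary.mem_iff.2 ⟨?_, h2.1⟩⟩, fun Q hQ ↦ Subtype.ext ?_⟩
  · have := h1.1
    rwa [hC1, Matrix.mul_zero, add_zero] at this
  · refine Eq.trans ?_ hgm.symm
    have : Q.1 = D := by
      ext1 i j
      rw [Subsingleton.elim i 0, Subsingleton.elim j 0]
      exact hQ
    change Matrix.fromBlocks A 0 0 Q.1 = _
    rw [this]
    congr 1
    exact hC1.symm

theorem mem_SpSub_of_entries {a b : ℕ} {h : SpPair a b} (h1 : ∀ i, h.val.1 (Sum.inl i) lst = 0)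
    (h2 : ∀ i, h.val.2 (Sum.inl i) lst = 0) (h3 : h.val.1 lst lst = h.val.2 lst lst) :
    h ∈ SpSub a b := by
  obtain ⟨hn, A, hA⟩ := Sp.exists_diag h.1 h1
  obtain ⟨-, B, hB⟩ := Sp.exists_diag h.2 h2
  exact ⟨(A, B, toSp1 _ hn), Prod.ext (hA _ rfl) (hB _ h3)⟩

theorem mk_eq_mk_of_entries {a b : ℕ} {g g' : SpPair a b} (q : ℍ[ℝ])
    (h1 : ∀ i, g'.val.1 i lst = g.val.1 i lst * q)
    (h2 : ∀ i, g'.val.2 i lst = g.val.2 i lst * q) : (g : SpQuot a b) = (g' : SpQuot a b) := by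
  rw [QuotientGroup.eq]
  have e1 (i) : (g⁻¹ * g').val.1 i lst = (1 : Matrix (Fin a ⊕ Fin 1) (Fin a ⊕ Fin 1) ℍ[ℝ]) i lst * q := by
    rw [← (Unitary.mem_iff.1 g.1.2).1]
    change (star g.1.1 * g'.1.1) i lst = _
    rw [Matrix.mul_apply, Matrix.mul_apply, Finset.sum_mul]
    exact Finset.sum_congr rfl fun k _ ↦ by rw [mul_assoc]; exact congrArg _ (h1 k)
  have e2 (i) : (g⁻¹ * g').val.2 i lst = (1 : Matrix (Fin b ⊕ Fin 1) (Fin b ⊕ Fin 1) ℍ[ℝ]) i lst * q := by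
    rw [← (Unitary.mem_iff.1 g.2.2).1]
    change (star g.2.1 * g'.2.1) i lst = _
    rw [Matrix.mul_apply, Matrix.mul_apply, Finset.sum_mul]
    exact Finset.sum_congr rfl fun k _ ↦ by rw [mul_assoc]; exact congrArg _ (h2 k)
  refine mem_SpSub_of_entries (fun i ↦ ?_) (fun i ↦ ?_) ?_
  · rw [e1]; simp
  · rw [e2]; simp
  · rw [e1, e2]; simp

theorem midCoord_mul {a b : ℕ} (g : SpPair a b) {h : SpPair a b} (hh : h ∈ SpSub a b) :
    midCoord (g * h).val = midCoord g.val := by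
  obtain ⟨q, hq, h1, h2⟩ := exists_mul_of_mem hh
  rw [midCoord, h1, h2, star_mul, mul_assoc, ← mul_assoc q, hq, one_mul, midCoord]

theorem baseCoord_mul {a b : ℕ} (g : SpPair a b) {h : SpPair a b} (hh : h ∈ SpSub a b) :
    baseCoord (g * h).val = baseCoord g.val := by
  have hm := midCoord_mul g hh
  obtain ⟨q, hq, h1, h2⟩ := exists_mul_of_mem hh
  have hq0 : q ≠ 0 := by rintro rfl; simp at hq
  rw [baseCoord, baseCoord, hm]
  simp only [h1, h2, mul_inv_rev, mul_assoc, mul_inv_cancel_left₀ hq0]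

theorem quat_coe_sum {ι : Type} [Fintype ι] (f : ι → ℝ) :
    ((∑ i, f i : ℝ) : ℍ[ℝ]) = ∑ i, (f i : ℍ[ℝ]) := map_sum (algebraMap ℝ ℍ[ℝ]) f _

theorem norm_last_column {a : ℕ} (g : Sp (Fin a ⊕ Fin 1)) (h : g.1 lst lst ≠ 0) :
    nu (fun i ↦ g.1 (Sum.inl i) lst * (g.1 lst lst)⁻¹) = ‖g.1 lst lst‖⁻¹ := by
  have hn : ‖g.1 lst lst‖ ≠ 0 := norm_ne_zero_iff.2 h
  have h1 := congrFun (congrFun (Unitary.mem_iff.1 g.2).1 lst) lst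
  rw [Matrix.mul_apply, Fintype.sum_sum_type] at h1
  simp only [Matrix.star_eq_conjTranspose, Matrix.conjTranspose_apply, Quaternion.star_mul_self,
    Finset.univ_unique, Finset.sum_singleton, Matrix.one_apply_eq,
    Quaternion.normSq_eq_norm_mul_self, ← sq] at h1
  have h2 : (∑ i, ‖g.1 (Sum.inl i) lst‖ ^ 2) + ‖g.1 lst lst‖ ^ 2 = 1 := by
    rw [← Quaternion.coe_inj (R := ℝ), Quaternion.coe_add, Quaternion.coe_one, quat_coe_sum]
    exact h1
  rw [nu, Real.sqrt_eq_iff_mul_self_eq (by positivity) (by positivity)]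
  simp only [norm_mul, norm_inv, mul_pow, ← Finset.sum_mul]
  rw [eq_sub_of_add_eq h2]
  field_simp
  ring

theorem mk_baseSection_baseCoord {a b : ℕ} (g : SpPair a b) (h : 0 < reCoord (midCoord g.val)) :
    (baseSection (baseCoord g.val) : SpQuot a b) = (g : SpQuot a b) := by
  have h0 : midCoord g.val ≠ 0 := by rintro h0; simp [h0] at h
  have hs : g.val.1 lst lst ≠ 0 := by rintro h1; simp [midCoord, h1] at h0
  have ht : g.val.2 lst lst ≠ 0 := by rintro h1; simp [midCoord, h1] at h0
  have nx : nu (baseCoord g.val).1 = ‖g.val.1 lst lst‖⁻¹ := norm_last_column g.1 hs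
  have ny : nu (baseCoord g.val).2.1 = ‖g.val.2 lst lst‖⁻¹ := norm_last_column g.2 ht
  have hns := norm_ne_zero_iff.2 hs
  have hnt := norm_ne_zero_iff.2 ht
  have hu : unitQ (baseCoord g.val).2.2 = ‖midCoord g.val‖⁻¹ • midCoord g.val := by
    have : 1 + ofIm (baseCoord g.val).2.2 = (reCoord (midCoord g.val))⁻¹ • midCoord g.val := by
      apply Quaternion.ext
      · simp at h
        simp [baseCoord, h.ne']
      · simp [baseCoord]
      · simp [baseCoord]
      · simp [baseCoord]
    rw [unitQ, this, norm_smul, Real.norm_of_nonneg (by positivity), smul_smul]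
    congr 1
    field_simp
  have hst : ‖g.val.1 lst lst‖ • (unitQ (baseCoord g.val).2.2 *
      (‖g.val.2 lst lst‖⁻¹ • g.val.2 lst lst)) = g.val.1 lst lst := by
    rw [hu, midCoord, norm_mul, norm_star, smul_mul_smul_comm, mul_assoc, Quaternion.star_mul_self,
      Quaternion.normSq_eq_norm_mul_self, Quaternion.mul_coe_eq_smul, smul_smul, smul_smul]
    convert one_smul ℝ (g.val.1 lst lst) using 2
    field_simp
  refine mk_eq_mk_of_entries (‖g.val.2 lst lst‖⁻¹ • g.val.2 lst lst) (fun i ↦ ?_) fun i ↦ ?_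
  · rw [baseSection_fst_lst, mul_assoc]
    rcases i with i | i
    · rw [rotMat_inl_lst, nx, inv_inv, smul_mul_assoc, ← mul_smul_comm, hst]
      change _ = g.val.1 _ _ * (g.val.1 _ _)⁻¹ * _
      rw [inv_mul_cancel_right₀ hs]
    · rw [Subsingleton.elim i 0, rotMat_lst_lst, nx, inv_inv, smul_mul_assoc, one_mul, hst]
  · rw [baseSection_snd]
    rcases i with i | i
    · rw [rotMat_inl_lst, ny, inv_inv, smul_mul_smul_comm, mul_inv_cancel₀ hnt, one_smul]
      change _ = g.val.2 _ _ * (g.val.2 _ _)⁻¹ * _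
      rw [inv_mul_cancel_right₀ ht]
    · rw [Subsingleton.elim i 0, rotMat_lst_lst, ny, inv_inv, smul_mul_smul_comm,
        mul_inv_cancel₀ hnt, one_smul, one_mul]

/-- The coordinates near the base point, as a function on `G/H`. -/
def quotCoord {a b : ℕ} (p : SpQuot a b) : ModelSp a b := baseCoord (Quotient.out p).val

theorem quotCoord_mk {a b : ℕ} (g : SpPair a b) : quotCoord (g : SpQuot a b) = baseCoord g.val := by
  obtain ⟨h, hh⟩ := QuotientGroup.mk_out_eq_mul (SpSub a b) g
  exact (congrArg (fun g' ↦ baseCoord (SpPair.val g')) hh).trans (baseCoord_mul g h.2)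

/-- The domain of the coordinates near the base point. -/
def quotDomain (a b : ℕ) : Set (SpQuot a b) := {p | 0 < reCoord (midCoord (Quotient.out p).val)}

theorem mk_mem_quotDomain {a b : ℕ} (g : SpPair a b) :
    (g : SpQuot a b) ∈ quotDomain a b ↔ 0 < reCoord (midCoord g.val) := by
  obtain ⟨h, hh⟩ := QuotientGroup.mk_out_eq_mul (SpSub a b) g
  have : midCoord (SpPair.val (Quotient.out (g : SpQuot a b))) = midCoord g.val :=
    (congrArg (fun g' ↦ midCoord (SpPair.val g')) hh).trans (midCoord_mul g h.2)
  exact iff_of_eq (congrArg (fun m ↦ 0 < reCoord m) this)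

theorem baseCoord_eventually {a b : ℕ} (g : SpPair a b) (h : (g : SpQuot a b) ∈ quotDomain a b) :
    ∃ F : MatPair a b → ModelSp a b,
      ContDiffAt ℝ ∞ F g.val ∧ ∀ᶠ g' : SpPair a b in 𝓝 g, quotCoord (g' : SpQuot a b) = F g'.val :=
  ⟨baseCoord, contDiffAt_baseCoord ((mk_mem_quotDomain g).1 h),
    Filter.Eventually.of_forall quotCoord_mk⟩

/-- The chart of `G/H` at the base point. -/
def baseChart (a b : ℕ) : OpenPartialHomeomorph (SpQuot a b) (ModelSp a b) where
  toFun := quotCoord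
  invFun z := (baseSection z : SpQuot a b)
  source := quotDomain a b
  target := Set.univ
  map_source' _ _ := Set.mem_univ _
  map_target' z _ := (mk_mem_quotDomain _).2 (reCoord_midCoord_baseSection_pos z)
  left_inv' p hp := by
    induction p using QuotientGroup.induction_on with
    | H g => rw [quotCoord_mk]; exact mk_baseSection_baseCoord g ((mk_mem_quotDomain g).1 hp)
  right_inv' z _ := by rw [quotCoord_mk, baseCoord_baseSection]
  open_source := by
    rw [← (QuotientGroup.isQuotientMap_mk (N := SpSub a b)).isOpen_preimage]
    have : ((↑) : SpPair a b → SpQuot a b) ⁻¹' quotDomain a b =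
        {g | 0 < reCoord (midCoord g.val)} := by
      ext g; exact mk_mem_quotDomain g
    rw [this]
    exact isOpen_lt continuous_const
      (contDiff_reCoord.continuous.comp (contDiff_midCoord.continuous.comp SpPair.continuous_val))
  open_target := isOpen_univ
  continuousOn_toFun := by
    intro p hp
    induction p using QuotientGroup.induction_on with
    | H g =>
      refine ContinuousAt.continuousWithinAt ?_
      have ho : IsOpenQuotientMap ((↑) : SpPair a b → SpQuot a b) := QuotientGroup.isOpenQuotientMap_mk
      rw [← ho.continuousAt_comp_iff]
      have : (quotCoord ∘ ((↑) : SpPair a b → SpQuot a b)) = fun g ↦ baseCoord g.val :=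
        funext quotCoord_mk
      rw [this]
      exact ContinuousAt.comp (g := baseCoord)
        (contDiffAt_baseCoord ((mk_mem_quotDomain g).1 hp)).continuousAt SpPair.continuous_val.continuousAt
  continuousOn_invFun := by
    refine Continuous.continuousOn ?_
    refine QuotientGroup.continuous_mk.comp (continuous_iff_continuousAt.2 fun z ↦ ?_)
    exact SpPair.continuousAt_of_val contDiff_baseSection.continuous.continuousAt

theorem isSmoothChart_baseChart (a b : ℕ) : IsSmoothChart (baseChart a b) where
  smooth_comp_mk g hg := baseCoord_eventually g hg
  smooth_lift _ _ := ⟨baseSection, contDiff_baseSection.contDiffAt, Filter.Eventually.of_forall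
    fun _ ↦ rfl⟩

/-- Translates of smooth charts are smooth. -/
theorem IsSmoothChart.translate {a b : ℕ} {e : OpenPartialHomeomorph (SpQuot a b) (ModelSp a b)}
    (he : IsSmoothChart e) (g : SpPair a b) :
    IsSmoothChart ((Homeomorph.smul g).toOpenPartialHomeomorph.trans e) where
  smooth_comp_mk g' hg' := by
    obtain ⟨F, hF, hFe⟩ := he.smooth_comp_mk (g * g') (by simpa using hg')
    refine ⟨fun A ↦ F (g.val * A), ?_, ?_⟩
    · exact ContDiffAt.comp g'.val (g := F) hF (contDiffAt_const.mul contDiffAt_id)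
    · exact (continuous_const_mul g).continuousAt.eventually hFe
  smooth_lift z hz := by
    obtain ⟨s, hs, hse⟩ := he.smooth_lift z (by simpa using hz)
    refine ⟨fun y ↦ g⁻¹ * s y, ?_, ?_⟩
    · exact (contDiffAt_const (c := g⁻¹.val)).mul hs
    · filter_upwards [hse] with y hy
      change g⁻¹ • e.symm y = _
      rw [hy]; rfl

theorem exists_smoothChart {a b : ℕ} (p : SpQuot a b) :
    ∃ e : OpenPartialHomeomorph (SpQuot a b) (ModelSp a b), IsSmoothChart e ∧ p ∈ e.source := by
  induction p using QuotientGroup.induction_on with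
  | H g =>
    refine ⟨_, (isSmoothChart_baseChart a b).translate g⁻¹, ?_⟩
    have : g⁻¹ • (g : SpQuot a b) ∈ quotDomain a b := by
      change ((g⁻¹ * g : SpPair a b) : SpQuot a b) ∈ _
      rw [inv_mul_cancel, mk_mem_quotDomain]
      simp [midCoord, SpPair.val]
    simpa using! this

/-- The smooth structure of the homogeneous space `G/H`: its atlas consists of all smooth
charts. -/
instance (a b : ℕ) : ChartedSpace (ModelSp a b) (SpQuot a b) where
  atlas := {e | IsSmoothChart e}
  chartAt p := (exists_smoothChart p).choose
  mem_chart_source p := (exists_smoothChart p).choose_spec.2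
  chart_mem_atlas p := (exists_smoothChart p).choose_spec.1

instance (a b : ℕ) : IsManifold 𝓘(ℝ, ModelSp a b) ∞ (SpQuot a b) := by
  refine isManifold_of_contDiffOn _ _ _ fun e e' he he' ↦ ?_
  intro x hx
  simp only [modelWithCornersSelf_coe, modelWithCornersSelf_coe_symm, Function.comp_id,
    Set.preimage_id, Set.range_id, Set.inter_univ, Function.id_comp] at hx ⊢
  have h := IsSmoothChart.contDiffAt (e := e) (e' := e') he he' 1 (x := x) hx.1 (by
    rw [one_smul]; exact hx.2)
  simp only [one_smul] at h
  exact h.contDiffWithinAt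

instance (a b : ℕ) : IsSmoothAction (ModelSp a b) (SpPair a b) (SpQuot a b) where
  contMDiff_smul g p := by
    rw [contMDiffAt_iff]
    refine ⟨(continuous_const_smul g).continuousAt, ?_⟩
    have h := IsSmoothChart.contDiffAt (chart_mem_atlas (ModelSp a b) p)
      (chart_mem_atlas (ModelSp a b) (g • p)) g (x := chartAt (ModelSp a b) p p) (mem_chart_target _ p) (by
        rw [(chartAt (ModelSp a b) p).left_inv (mem_chart_source _ p)]
        exact mem_chart_source _ (g • p))
    simpa using! h.contDiffWithinAt (s := Set.univ)

/-- The standard representation of `SO(4)` on `ℝ⁴`. -/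
def stdRep : Representation ℝ (Matrix.specialOrthogonalGroup (Fin 4) ℝ) (Fin 4 → ℝ) where
  toFun A := Matrix.mulVecLin A.1
  map_one' := Matrix.mulVecLin_one
  map_mul' A B := Matrix.mulVecLin_mul A.1 B.1

/-- The direct sum `ℝ⁴ ⊕ ℝ⁴` of two copies of the standard representation of `SO(4)`. -/
def doubleStdRep : Representation ℝ (Matrix.specialOrthogonalGroup (Fin 4) ℝ)
    ((Fin 4 → ℝ) × (Fin 4 → ℝ)) := stdRep.prod stdRep

/-- A finite-dimensional real representation is polar with respect to the inner product `B` if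
it is polar as an action on the manifold `V` with the constant Riemannian metric `B`. -/
def IsPolarRepresentation {K V : Type} [Group K] [NormedAddCommGroup V] [NormedSpace ℝ V]
    [FiniteDimensional ℝ V] (ρ : Representation ℝ K V) (B : V →L[ℝ] V →L[ℝ] ℝ) : Prop :=
  IsPolarAction (E := V) (fun (k : K) (v : V) ↦ ρ k v) (fun _ ↦ B)

end Space

end

end QuatEx

open QuatEx

/-!
The point is that a section of either action, if there were one, would be tangent to a subspace that is
both too small and too large, and that this can be seen without the theory of polar actions: one uses only
that the section is a submanifold, meets all orbits, and is orthogonal to them.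

Write `V` for the tangent space of `G/H` at the base point. The base point is fixed by `H`, which
acts on `V = ℍ^a ⊕ ℍ^b ⊕ Im ℍ` by `(x, y, c) ↦ (A x q⁻¹, B y q⁻¹, q c q⁻¹)`, and the chart
`baseChart` of `G/H` conjugates the action of `H` on an open set with this linear action
(`baseCoord_mul_left`, `param_linAct`).

*A section has dimension at least three.* It contains the base point. Each of the three summands of `V` is
an invariant closed cone; since the section meets all orbits, it has points in each of them arbitrarily
close to `0`. Limits of their directions are tangent to the section, so its tangent space meets all three
summands (`IsSubmanifoldAtZero.exists_tangentSpace`, `three_le_of_meets_orbits`).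

*The slice representation.* Let `g` exchange in each factor a coordinate vector with the last one
(`swapPair`), and let `p = g H`. If `k` fixes `p`, then `k` and `g⁻¹ k g` are both in `H`, with entries
`q` and `r` in `Sp(1)`, and `k` acts on the two exchanged coordinates in `ℍ ⊕ ℍ` by
`(x, y) ↦ (q x r⁻¹, q y r⁻¹)` (`linAct_coordIncl`). In the chart translated to `p`, the tangent space of
the orbit through `p` is given by the vanishing of these two coordinates
(`paramDeriv_mem_tangentVectors_iff`). Changes of sign show that the two coordinates are orthogonal to the
others for every invariant metric (`metricForm_coordIncl`), so that they are the normal space. The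
rotations `z ↦ q z r⁻¹` form all of `SO(4)` (`quatRotation_surjective`).

*A section has dimension at most two.* Its tangent space `F` at a point of the orbit of `p` lies in the
normal space `ℍ ⊕ ℍ`. At nearby points it is orthogonal to the velocities of the one-parameter groups of
left and right multiplications by unit quaternions, which are linear vector fields in the chart. In the
limit `⟨u v, w⟩ = ⟨v u, w⟩ = 0` for `v`, `w` in `F` and imaginary `u` (`eq_zero_of_tendsto_of_orthogonal`).
By a Cholesky decomposition of the invariant inner product one can assume that it is the standard one
(`exists_cholesky`). Left and right multiplications by imaginary units span the skew-symmetric `4 × 4`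
matrices, so `v.1 w.1ᵀ + v.2 w.2ᵀ` is symmetric for all `v`, `w` in `F`, and this forces `dim F ≤ 2`
(`finrank_le_two_of_symmetric`, `finrank_le_two_of_orthogonal`, `le_two_of_orthogonal`).

*The representation of `SO(4)` on `ℝ⁴ ⊕ ℝ⁴` is not polar.* In the same way the tangent space at `0` of a
section has dimension at most two, and it meets the two summands, the diagonal, and the cone of pairs of
orthogonal vectors of equal length. Such a subspace does not exist
(`not_isPolarRepresentation_doubleStdRep`).
-/

/-! ### Tangent spaces of submanifolds through limits of curves -/

section TangentSpaces

variable {E : Type} [NormedAddCommGroup E] [NormedSpace ℝ E]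

/-- The velocities at `z` of the smooth curves in the subset `S` of the vector space `E`. -/
def curveVelocities (S : Set E) (z : E) : Set E :=
  {w | ∃ γ : ℝ → E, ContDiff ℝ ∞ γ ∧ (∀ t, γ t ∈ S) ∧ γ 0 = z ∧ HasDerivAt γ w 0}

/-- `S` is near the point `0 ∈ S` a smooth submanifold of dimension `k` of `E`: some local
diffeomorphism of `E` straightens it out to a linear subspace. -/
def IsSubmanifoldAtZero (k : ℕ) (S : Set E) : Prop :=
  (0 : E) ∈ S ∧ ∃ f : OpenPartialHomeomorph E E, ContDiffOn ℝ ∞ f f.source ∧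
    ContDiffOn ℝ ∞ f.symm f.target ∧ (0 : E) ∈ f.source ∧
    ∃ F : Submodule ℝ E, Module.finrank ℝ F = k ∧ ∀ z ∈ f.source, z ∈ S ↔ f z ∈ F

/-- A local diffeomorphism straightening `S` produces velocities: the curves are images of line
segments, parametrized by a sine to be defined for all times. -/
theorem mem_curveVelocities_of_straightening {S : Set E} {f : OpenPartialHomeomorph E E}
    (hf : ContDiffOn ℝ ∞ f.symm f.target) {F : Submodule ℝ E}
    (hS : ∀ z ∈ f.source, z ∈ S ↔ f z ∈ F) {y : E} (hy : y ∈ f.target) (hyF : y ∈ F) {w : E}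
    (hw : w ∈ F) : fderiv ℝ f.symm y w ∈ curveVelocities S (f.symm y) := by
  obtain ⟨ε, hε, hb⟩ := Metric.isOpen_iff.1 f.open_target y hy
  set δ : ℝ := ε / (‖w‖ + 1) with hδ
  have hw0 : 0 < ‖w‖ + 1 := by positivity
  have hδ0 : 0 < δ := by positivity
  set σ : ℝ → E := fun t ↦ y + (δ * Real.sin (t / δ)) • w with hσ
  have hσc : ContDiff ℝ ∞ σ :=
    contDiff_const.add ((contDiff_const.mul (Real.contDiff_sin.comp
      (contDiff_id.div_const δ))).smul contDiff_const)
  have hσt (t : ℝ) : σ t ∈ f.target := by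
    refine hb ?_
    rw [Metric.mem_ball, dist_eq_norm, hσ]
    simp only [add_sub_cancel_left, norm_smul, norm_mul, Real.norm_eq_abs, abs_of_pos hδ0]
    calc δ * |Real.sin (t / δ)| * ‖w‖ ≤ δ * 1 * ‖w‖ := by gcongr; exact Real.abs_sin_le_one _
      _ < δ * (‖w‖ + 1) := by nlinarith
      _ = ε := by rw [hδ]; field_simp
  have hσF (t : ℝ) : σ t ∈ F := F.add_mem hyF (F.smul_mem _ hw)
  have hσ0 : σ 0 = y := by simp [hσ]
  have hσd : HasDerivAt σ w 0 := by
    have h1 : HasDerivAt (fun t : ℝ ↦ δ * Real.sin (t / δ)) 1 0 := by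
      have := ((Real.hasDerivAt_sin (0 / δ)).comp (0 : ℝ)
        ((hasDerivAt_id (0 : ℝ)).div_const δ)).const_mul δ
      refine this.congr_deriv ?_
      rw [zero_div, Real.cos_zero]
      field_simp
    have := (h1.smul_const w).const_add y
    rwa [one_smul] at this
  refine ⟨fun t ↦ f.symm (σ t), ?_, fun t ↦ ?_, by simp [hσ0], ?_⟩
  · exact hf.comp_contDiff hσc hσt
  · rw [hS _ (f.map_target (hσt t)), f.right_inv (hσt t)]
    exact hσF t
  · have h1 : HasFDerivAt f.symm (fderiv ℝ f.symm y) (σ 0) := by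
      rw [hσ0]
      exact ((hf.contDiffAt (f.open_target.mem_nhds hy)).differentiableAt (by simp)).hasFDerivAt
    exact h1.comp_hasDerivAt 0 hσd

/-- The tangent space `F` at `0` of a submanifold `S` through `0`. It meets every closed cone
which contains points of `S` close to `0`, and pairs of vectors in `F` are limits of pairs consisting
of a rescaled point of `S` and a vector tangent to `S` at that point. -/
theorem IsSubmanifoldAtZero.exists_tangentSpace [FiniteDimensional ℝ E] {k : ℕ} {S : Set E}
    (h : IsSubmanifoldAtZero k S) : ∃ F : Submodule ℝ E, Module.finrank ℝ F = k ∧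
      (∀ w ∈ F, w ∈ curveVelocities S 0) ∧
      (∀ C : Set E, IsClosed C → (∀ c ∈ C, ∀ r : ℝ, 0 < r → r • c ∈ C) →
        (∀ ε > 0, ∃ z ∈ S, z ∈ C ∧ z ≠ 0 ∧ ‖z‖ < ε) → ∃ c ∈ F, c ∈ C ∧ c ≠ 0) ∧
      ∀ v ∈ F, ∀ w ∈ F, ∃ z z' : ℝ → E, (∀ᶠ t in 𝓝[≠] 0, z t ∈ S ∧ z' t ∈ curveVelocities S (z t)) ∧
        Filter.Tendsto z (𝓝[≠] 0) (𝓝 0) ∧ Filter.Tendsto (fun t ↦ t⁻¹ • z t) (𝓝[≠] 0) (𝓝 v) ∧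
        Filter.Tendsto z' (𝓝[≠] 0) (𝓝 w) := by
  obtain ⟨h0S, f, hf, hf', h0, F₀, hF₀, hS⟩ := h
  have hy : f 0 ∈ f.target := f.map_source h0
  have hyF : f 0 ∈ F₀ := (hS 0 h0).1 h0S
  have hsy : f.symm (f 0) = 0 := f.left_inv h0
  have hfd : HasFDerivAt f (fderiv ℝ f 0) 0 :=
    ((hf.contDiffAt (f.open_source.mem_nhds h0)).differentiableAt (by simp)).hasFDerivAt
  have hca : ContDiffAt ℝ ∞ f.symm (f 0) := hf'.contDiffAt (f.open_target.mem_nhds hy)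
  have hgd : HasFDerivAt f.symm (fderiv ℝ f.symm (f 0)) (f 0) :=
    (hca.differentiableAt (by simp)).hasFDerivAt
  set A := fderiv ℝ f 0
  set B := fderiv ℝ f.symm (f 0)
  have hBA : B.comp A = ContinuousLinearMap.id ℝ E := by
    refine HasFDerivAt.unique (HasFDerivAt.comp 0 hgd hfd) ?_
    refine (hasFDerivAt_id 0).congr_of_eventuallyEq ?_
    filter_upwards [f.open_source.mem_nhds h0] with z hz
    exact f.left_inv hz
  have hAB : A.comp B = ContinuousLinearMap.id ℝ E := by
    refine HasFDerivAt.unique (HasFDerivAt.comp (f 0) (by rw [hsy]; exact hfd) hgd) ?_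
    refine (hasFDerivAt_id _).congr_of_eventuallyEq ?_
    filter_upwards [f.open_target.mem_nhds hy] with z hz
    exact f.right_inv hz
  have hBA' (v : E) : B (A v) = v := DFunLike.congr_fun hBA v
  have hAB' (v : E) : A (B v) = v := DFunLike.congr_fun hAB v
  have hBinj : Function.Injective B := Function.LeftInverse.injective hAB'
  refine ⟨F₀.map B.toLinearMap, ?_, ?_, ?_, ?_⟩
  · rw [← hF₀]
    exact (Submodule.equivMapOfInjective _ hBinj F₀).finrank_eq.symm
  · rintro _ ⟨w, hw, rfl⟩
    have := mem_curveVelocities_of_straightening hf' hS hy hyF hw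
    rwa [hsy] at this
  · intro C hC hCs hz
    choose z hzS hzC hz0 hzn using fun n : ℕ ↦ hz (1 / (n + 1)) (by positivity)
    have hzt : Filter.Tendsto z Filter.atTop (𝓝 0) :=
      squeeze_zero_norm (fun n ↦ (hzn n).le) tendsto_one_div_add_atTop_nhds_zero_nat
    have hu (n : ℕ) : ‖z n‖⁻¹ • z n ∈ Metric.sphere (0 : E) 1 := by
      have := norm_ne_zero_iff.2 (hz0 n)
      rw [mem_sphere_zero_iff_norm, norm_smul, norm_inv, norm_norm, inv_mul_cancel₀ this]
    obtain ⟨c, hc, φ, hφ, hlim⟩ := (isCompact_sphere (0 : E) 1).tendsto_subseq hu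
    have hc1 : ‖c‖ = 1 := by simpa using hc
    refine ⟨c, ⟨A c, ?_, hBA' c⟩, ?_, fun h ↦ by simp [h] at hc1⟩
    · -- the difference quotients of `f` along `z` lie in `F₀` and converge to `A c`
      have h1 : Filter.Tendsto (fun n ↦ ‖z (φ n)‖⁻¹ • (f (z (φ n)) - f 0 - A (z (φ n) - 0)))
          Filter.atTop (𝓝 0) := by
        have h2 := (hasFDerivAt_iff_tendsto.1 hfd).comp (hzt.comp hφ.tendsto_atTop)
        refine tendsto_zero_iff_norm_tendsto_zero.2 (h2.congr fun n ↦ ?_)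
        simp [norm_smul]
      have h3 : Filter.Tendsto (fun n ↦ ‖z (φ n)‖⁻¹ • (f (z (φ n)) - f 0)) Filter.atTop
          (𝓝 (A c)) := by
        have h4 := h1.add ((A.continuous.tendsto c).comp hlim)
        rw [zero_add] at h4
        refine h4.congr fun n ↦ ?_
        simp only [Function.comp_apply, map_smul, sub_zero, smul_sub]
        abel
      refine (Submodule.closed_of_finiteDimensional F₀).mem_of_tendsto h3 ?_
      filter_upwards [(hzt.comp hφ.tendsto_atTop).eventually (f.open_source.mem_nhds h0)] with n hn
      exact F₀.smul_mem _ (F₀.sub_mem ((hS _ hn).1 (hzS _)) hyF)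
    · refine hC.mem_of_tendsto hlim (Filter.Eventually.of_forall fun n ↦ ?_)
      exact hCs _ (hzC _) _ (inv_pos.2 (norm_pos_iff.2 (hz0 _)))
  · rintro _ ⟨v, hv, rfl⟩ _ ⟨w, hw, rfl⟩
    have hline : HasDerivAt (fun t : ℝ ↦ f 0 + t • v) v 0 := by
      simpa using ((hasDerivAt_id (0 : ℝ)).smul_const v).const_add (f 0)
    have hl0 : Filter.Tendsto (fun t : ℝ ↦ f 0 + t • v) (𝓝[≠] 0) (𝓝 (f 0)) := by
      have := hline.continuousAt.tendsto
      simp only [zero_smul, add_zero] at this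
      exact this.mono_left nhdsWithin_le_nhds
    have hlF (t : ℝ) : f 0 + t • v ∈ F₀ := F₀.add_mem hyF (F₀.smul_mem _ hv)
    refine ⟨fun t ↦ f.symm (f 0 + t • v), fun t ↦ fderiv ℝ f.symm (f 0 + t • v) w, ?_, ?_, ?_, ?_⟩
    · filter_upwards [hl0.eventually (f.open_target.mem_nhds hy)] with t ht
      refine ⟨?_, mem_curveVelocities_of_straightening hf' hS ht (hlF t) hw⟩
      rw [hS _ (f.map_target ht), f.right_inv ht]
      exact hlF t
    · have := hca.continuousAt.tendsto.comp hl0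
      rwa [hsy] at this
    · have h1 : HasDerivAt (fun t : ℝ ↦ f.symm (f 0 + t • v)) (B v) 0 :=
        HasFDerivAt.comp_hasDerivAt (0 : ℝ) (by simpa using hgd) hline
      have := h1.tendsto_slope_zero
      simpa [hsy] using this
    · have h1 : ContinuousAt (fun y ↦ fderiv ℝ f.symm y w) (f 0) :=
        (hca.continuousAt_fderiv (by simp)).clm_apply continuousAt_const
      exact h1.tendsto.comp hl0

/-- Linearization at a fixed point `0`: if the vector fields `z ↦ U z` are orthogonal to `S`, then
their linear parts map the tangent space of `S` into its orthogonal complement. -/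
theorem eq_zero_of_tendsto_of_orthogonal {S : Set E} {m : E → E → E → ℝ}
    (hm : Continuous fun p : E × E × E ↦ m p.1 p.2.1 p.2.2)
    (hsmul : ∀ z u w (c : ℝ), m z (c • u) w = c * m z u w) (U : E →L[ℝ] E)
    (hU : ∀ z ∈ S, ∀ w ∈ curveVelocities S z, m z (U z) w = 0) {v w : E} {z z' : ℝ → E}
    (hz : ∀ᶠ t in 𝓝[≠] 0, z t ∈ S ∧ z' t ∈ curveVelocities S (z t))
    (h0 : Filter.Tendsto z (𝓝[≠] 0) (𝓝 0))
    (hv : Filter.Tendsto (fun t ↦ t⁻¹ • z t) (𝓝[≠] 0) (𝓝 v))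
    (hw : Filter.Tendsto z' (𝓝[≠] 0) (𝓝 w)) : m 0 (U v) w = 0 := by
  have h1 : Filter.Tendsto (fun t ↦ m (z t) (U (t⁻¹ • z t)) (z' t)) (𝓝[≠] 0) (𝓝 (m 0 (U v) w)) :=
    (hm.tendsto (0, U v, w)).comp (h0.prodMk_nhds (((U.continuous.tendsto v).comp hv).prodMk_nhds hw))
  refine tendsto_nhds_unique h1 (tendsto_const_nhds.congr' ?_)
  filter_upwards [hz] with t ht
  rw [map_smul, hsmul, hU _ ht.1 _ ht.2, mul_zero]

end TangentSpaces

/-! ### Quaternions and rotations -/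

section IsotropicSubspaces

/-- The condition says that `v wᵀ = v.1 w.1ᵀ + v.2 w.2ᵀ` is a symmetric matrix for all `v`, `w` in
`F`. If `dim F ≥ 3`, some nonzero `w` in `F` has vanishing `e`-th coordinates, where `e` is a
coordinate which does not vanish on `F`. Then `w` has rank one, and this splits every `v` in `F` into two
parts which are determined by one real number each. -/
theorem finrank_le_two_of_symmetric {n : Type} [Finite n] (F : Submodule ℝ ((n → ℝ) × (n → ℝ)))
    (hF : ∀ v ∈ F, ∀ w ∈ F, ∀ i j,
      v.1 i * w.1 j + v.2 i * w.2 j = v.1 j * w.1 i + v.2 j * w.2 i) :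
    Module.finrank ℝ F ≤ 2 := by
  by_contra! hlt
  have : Nontrivial F := Module.nontrivial_of_finrank_pos (R := ℝ) (by omega)
  obtain ⟨⟨v₀, hv₀⟩, hv₀'⟩ := exists_ne (0 : F)
  have hne : ∃ e, ¬(v₀.1 e = 0 ∧ v₀.2 e = 0) := by
    by_contra! h
    exact hv₀' (Subtype.ext (Prod.ext (funext fun e ↦ (h e).1) (funext fun e ↦ (h e).2)))
  obtain ⟨e, he⟩ := hne
  set p := v₀.1 e with hp
  set s := v₀.2 e with hs
  have hN : 0 < p ^ 2 + s ^ 2 := by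
    rcases not_and_or.1 he with h | h <;> positivity
  -- an element of `F` with vanishing `e`-th coordinates
  let ev : F →ₗ[ℝ] ℝ × ℝ :=
    (((LinearMap.proj e).comp (LinearMap.fst ℝ (n → ℝ) (n → ℝ))).prod
      ((LinearMap.proj e).comp (LinearMap.snd ℝ (n → ℝ) (n → ℝ)))).comp F.subtype
  have hker : ∃ w : F, ev w = 0 ∧ w ≠ 0 := by
    by_contra! h
    have hi : Function.Injective ev := (injective_iff_map_eq_zero ev).2 h
    have := LinearMap.finrank_le_finrank_of_injective hi
    rw [Module.finrank_prod, Module.finrank_self] at this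
    omega
  obtain ⟨⟨w, hw⟩, hwe, hw0⟩ := hker
  have hwe1 : w.1 e = 0 := congrArg Prod.fst hwe
  have hwe2 : w.2 e = 0 := congrArg Prod.snd hwe
  have hwk (i) : w.1 i * p + w.2 i * s = 0 := by
    have := hF w hw v₀ hv₀ i e
    rw [hwe1, hwe2, zero_mul, zero_mul, add_zero] at this
    exact this
  have hx : ∃ i, w.1 i * s - w.2 i * p ≠ 0 := by
    by_contra! h
    refine hw0 (Subtype.ext (Prod.ext (funext fun i ↦ ?_) (funext fun i ↦ ?_)))
    · have : w.1 i * (p ^ 2 + s ^ 2) = 0 := by linear_combination p * hwk i + s * h i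
      exact (mul_eq_zero.1 this).resolve_right hN.ne'
    · have : w.2 i * (p ^ 2 + s ^ 2) = 0 := by linear_combination s * hwk i - p * h i
      exact (mul_eq_zero.1 this).resolve_right hN.ne'
  obtain ⟨k, hk⟩ := hx
  set x : n → ℝ := fun i ↦ w.1 i * s - w.2 i * p with hxdef
  have hf (v) (hv : v ∈ F) (j) :
      x k * (s * v.1 j - p * v.2 j) = x j * (s * v.1 k - p * v.2 k) := by
    have h1 := hF w hw v hv k j
    simp only [hxdef]
    linear_combination (s ^ 2 + p ^ 2) * h1 - (p * v.1 j + s * v.2 j) * hwk k +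
      (p * v.1 k + s * v.2 k) * hwk j
  have hg (v) (hv : v ∈ F) (j) :
      (p ^ 2 + s ^ 2) * (p * v.1 j + s * v.2 j) =
        (p * v₀.1 j + s * v₀.2 j) * (p * v.1 e + s * v.2 e) := by
    have h1 := hF v₀ hv₀ v hv e j
    have h2 := hf v hv
    have h3 := hf v₀ hv₀
    have h4 : x k * (s * v.1 j - p * v.2 j) = x j * (s * v.1 k - p * v.2 k) := h2 j
    have h5 : x e = 0 := by simp [hxdef, hwe1, hwe2]
    have h6 : s * v.1 e - p * v.2 e = 0 := by
      have := h2 e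
      rw [h5, zero_mul] at this
      exact (mul_eq_zero.1 this).resolve_left hk
    rw [← hp, ← hs] at h1
    linear_combination (p ^ 2 + s ^ 2) * h1 + (s * v₀.1 j - p * v₀.2 j) * h6
  let ev' : F →ₗ[ℝ] ℝ × ℝ :=
    ((s • (LinearMap.proj k).comp (LinearMap.fst ℝ (n → ℝ) (n → ℝ)) -
      p • (LinearMap.proj k).comp (LinearMap.snd ℝ (n → ℝ) (n → ℝ))).prod
      (p • (LinearMap.proj e).comp (LinearMap.fst ℝ (n → ℝ) (n → ℝ)) +
        s • (LinearMap.proj e).comp (LinearMap.snd ℝ (n → ℝ) (n → ℝ)))).comp F.subtype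
  have hinj : Function.Injective ev' := by
    refine (injective_iff_map_eq_zero ev').2 ?_
    rintro ⟨v, hv⟩ h
    have h1 : s * v.1 k - p * v.2 k = 0 := congrArg Prod.fst h
    have h2 : p * v.1 e + s * v.2 e = 0 := congrArg Prod.snd h
    have h3 (j) : s * v.1 j - p * v.2 j = 0 := by
      have := hf v hv j
      rw [h1, mul_zero] at this
      exact (mul_eq_zero.1 this).resolve_left hk
    have h4 (j) : p * v.1 j + s * v.2 j = 0 := by
      have := hg v hv j
      rw [h2, mul_zero] at this
      exact (mul_eq_zero.1 this).resolve_left hN.ne'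
    refine Subtype.ext (Prod.ext (funext fun i ↦ ?_) (funext fun i ↦ ?_))
    · have : v.1 i * (p ^ 2 + s ^ 2) = 0 := by linear_combination p * h4 i + s * h3 i
      exact (mul_eq_zero.1 this).resolve_right hN.ne'
    · have : v.2 i * (p ^ 2 + s ^ 2) = 0 := by linear_combination s * h4 i - p * h3 i
      exact (mul_eq_zero.1 this).resolve_right hN.ne'
  have := LinearMap.finrank_le_finrank_of_injective hinj
  rw [Module.finrank_prod, Module.finrank_self] at this
  omega

end IsotropicSubspaces

section QuaternionRotations

open scoped Matrix

/-- The real coordinates of a quaternion. -/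
noncomputable def quatTuple : ℍ[ℝ] ≃ₗ[ℝ] (Fin 4 → ℝ) := QuaternionAlgebra.linearEquivTuple _ _ _

theorem quatTuple_apply (z : ℍ[ℝ]) : quatTuple z = ![z.re, z.imI, z.imJ, z.imK] := rfl

theorem quatTuple_dotProduct (x y : ℍ[ℝ]) :
    quatTuple x ⬝ᵥ quatTuple y = (star x * y).re := by
  simp [quatTuple_apply, dotProduct, Fin.sum_univ_four]

/-- The matrix of the left multiplication by `q`. -/
def leftMat (q : ℍ[ℝ]) : Matrix (Fin 4) (Fin 4) ℝ :=
  !![q.re, -q.imI, -q.imJ, -q.imK; q.imI, q.re, -q.imK, q.imJ;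
    q.imJ, q.imK, q.re, -q.imI; q.imK, -q.imJ, q.imI, q.re]

/-- The matrix of the right multiplication by the conjugate of `q`. -/
def rightMat (q : ℍ[ℝ]) : Matrix (Fin 4) (Fin 4) ℝ :=
  !![q.re, q.imI, q.imJ, q.imK; -q.imI, q.re, -q.imK, q.imJ;
    -q.imJ, q.imK, q.re, -q.imI; -q.imK, -q.imJ, q.imI, q.re]

theorem leftMat_mulVec (q z : ℍ[ℝ]) : leftMat q *ᵥ quatTuple z = quatTuple (q * z) := by
  ext i
  fin_cases i <;> simp [leftMat, quatTuple_apply, Matrix.mulVec, dotProduct, Fin.sum_univ_four] <;>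
    ring

theorem rightMat_mulVec (q z : ℍ[ℝ]) : rightMat q *ᵥ quatTuple z = quatTuple (z * star q) := by
  ext i
  fin_cases i <;> simp [rightMat, quatTuple_apply, Matrix.mulVec, dotProduct, Fin.sum_univ_four] <;>
    ring

theorem normSq_coords (q : ℍ[ℝ]) :
    Quaternion.normSq q = q.re ^ 2 + q.imI ^ 2 + q.imJ ^ 2 + q.imK ^ 2 := Quaternion.normSq_def' q

theorem det_leftMat (q : ℍ[ℝ]) : (leftMat q).det = Quaternion.normSq q ^ 2 := by
  rw [normSq_coords, leftMat, Matrix.det_succ_row_zero]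
  simp [Fin.sum_univ_four, Matrix.det_fin_three, Fin.succAbove, Matrix.submatrix]
  ring

theorem det_rightMat (q : ℍ[ℝ]) : (rightMat q).det = Quaternion.normSq q ^ 2 := by
  rw [normSq_coords, rightMat, Matrix.det_succ_row_zero]
  simp [Fin.sum_univ_four, Matrix.det_fin_three, Fin.succAbove, Matrix.submatrix]
  ring

theorem leftMat_mul_transpose (q : ℍ[ℝ]) :
    leftMat q * (leftMat q).transpose = Quaternion.normSq q • 1 := by
  rw [normSq_coords]
  ext i j
  fin_cases i <;> fin_cases j <;> simp [leftMat, Matrix.mul_apply, Fin.sum_univ_four] <;> ring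

theorem rightMat_mul_transpose (q : ℍ[ℝ]) :
    rightMat q * (rightMat q).transpose = Quaternion.normSq q • 1 := by
  rw [normSq_coords]
  ext i j
  fin_cases i <;> fin_cases j <;> simp [rightMat, Matrix.mul_apply, Fin.sum_univ_four] <;> ring

theorem normSq_of_mem_unitary (q : unitary ℍ[ℝ]) : Quaternion.normSq (q : ℍ[ℝ]) = 1 := by
  have := (Unitary.mem_iff.1 q.2).1
  rw [Quaternion.star_mul_self] at this
  exact Quaternion.coe_injective (this.trans Quaternion.coe_one.symm)

/-- A matrix is determined by its action on the coordinate vectors of quaternions. -/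
theorem ext_quatTuple {A B : Matrix (Fin 4) (Fin 4) ℝ}
    (h : ∀ z, A *ᵥ quatTuple z = B *ᵥ quatTuple z) : A = B := by
  refine Matrix.mulVec_injective (funext fun x ↦ ?_)
  simpa using h (quatTuple.symm x)

/-- The rotations `z ↦ q z r⁻¹` of the space of quaternions. -/
def quatRotation : unitary ℍ[ℝ] × unitary ℍ[ℝ] →* Matrix.specialOrthogonalGroup (Fin 4) ℝ where
  toFun g := ⟨leftMat g.1 * rightMat g.2, by
    rw [Matrix.mem_specialOrthogonalGroup_iff, Matrix.mem_orthogonalGroup_iff]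
    constructor
    · rw [Matrix.transpose_mul, Matrix.mul_assoc, ← Matrix.mul_assoc (rightMat _),
        rightMat_mul_transpose, normSq_of_mem_unitary, one_smul, Matrix.one_mul,
        leftMat_mul_transpose, normSq_of_mem_unitary, one_smul]
    · rw [Matrix.det_mul, det_leftMat, det_rightMat, normSq_of_mem_unitary, normSq_of_mem_unitary]
      norm_num⟩
  map_one' := Subtype.ext <| ext_quatTuple fun z ↦ by
    simp only [← Matrix.mulVec_mulVec, leftMat_mulVec, rightMat_mulVec]
    simp
  map_mul' g h := Subtype.ext <| ext_quatTuple fun z ↦ by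
    change (leftMat _ * rightMat _) *ᵥ _ =
      ((leftMat _ * rightMat _) * (leftMat _ * rightMat _)) *ᵥ quatTuple z
    simp only [← Matrix.mulVec_mulVec, leftMat_mulVec, rightMat_mulVec]
    simp [mul_assoc]

theorem quatRotation_mulVec (g : unitary ℍ[ℝ] × unitary ℍ[ℝ]) (z : ℍ[ℝ]) :
    (quatRotation g).1 *ᵥ quatTuple z = quatTuple (g.1 * z * star (g.2 : ℍ[ℝ])) := by
  change (leftMat _ * rightMat _) *ᵥ quatTuple z = _
  rw [← Matrix.mulVec_mulVec, rightMat_mulVec, leftMat_mulVec, mul_assoc]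

theorem continuous_quatRotation : Continuous quatRotation := by
  have h : Continuous fun q : ℍ[ℝ] ↦ leftMat q := by
    refine continuous_matrix fun i j ↦ ?_
    fin_cases i <;> fin_cases j <;> simp [leftMat] <;> first
      | exact Quaternion.continuous_re | exact Quaternion.continuous_imI
      | exact Quaternion.continuous_imJ | exact Quaternion.continuous_imK
      | exact Quaternion.continuous_imI.neg | exact Quaternion.continuous_imJ.neg
      | exact Quaternion.continuous_imK.neg
  have h' : Continuous fun q : ℍ[ℝ] ↦ rightMat q := by
    refine continuous_matrix fun i j ↦ ?_
    fin_cases i <;> fin_cases j <;> simp [rightMat] <;> first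
      | exact Quaternion.continuous_re | exact Quaternion.continuous_imI
      | exact Quaternion.continuous_imJ | exact Quaternion.continuous_imK
      | exact Quaternion.continuous_imI.neg | exact Quaternion.continuous_imJ.neg
      | exact Quaternion.continuous_imK.neg
  refine Continuous.subtype_mk ?_ _
  exact (h.comp (continuous_subtype_val.comp continuous_fst)).matrix_mul
    (h'.comp (continuous_subtype_val.comp continuous_snd))

/-- A quaternion of norm one as an element of the unitary group. -/
def toUnitary (q : ℍ[ℝ]) (h : ‖q‖ = 1) : unitary ℍ[ℝ] :=
  ⟨q, Unitary.mem_iff.2 (mem_unitary_of_norm h)⟩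

theorem im_mul_self {u : ℍ[ℝ]} (hu : u.re = 0) (hn : ‖u‖ = 1) : u * u = -1 := by
  have h1 : star u = -u := by
    apply Quaternion.ext <;> simp [hu]
  have h2 := (mem_unitary_of_norm hn).2
  rw [h1, mul_neg] at h2
  rw [← h2, neg_neg]

/-- Two unit imaginary quaternions are conjugate by the normalization of `1 - w u`, unless `w u = 1`. -/
theorem exists_unitary_conj {u w c : ℍ[ℝ]} (hu : u.re = 0) (hun : ‖u‖ = 1) (hw : w.re = 0)
    (hwn : ‖w‖ = 1) (hne : w * u ≠ 1) (hc : Commute c (w * u)) :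
    ∃ r : unitary ℍ[ℝ], (r : ℍ[ℝ]) * u = w * r ∧ Commute c (r : ℍ[ℝ]) := by
  have h0 : ‖1 - w * u‖ ≠ 0 := norm_ne_zero_iff.2 (sub_ne_zero.2 hne.symm)
  refine ⟨toUnitary (‖1 - w * u‖⁻¹ • (1 - w * u)) ?_, ?_, ?_⟩
  · rw [norm_smul, norm_inv, norm_norm, inv_mul_cancel₀ h0]
  · change (‖1 - w * u‖⁻¹ • (1 - w * u)) * u = w * (‖1 - w * u‖⁻¹ • (1 - w * u))
    rw [smul_mul_assoc, mul_smul_comm, sub_mul, mul_sub, one_mul, mul_one, mul_assoc,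
      im_mul_self hu hun, ← mul_assoc, im_mul_self hw hwn]
    congr 1
    simp [add_comm]
  · exact ((Commute.one_right c).sub_right hc).smul_right _

theorem mulVec_dotProduct_mulVec (A : Matrix.specialOrthogonalGroup (Fin 4) ℝ) (x y : Fin 4 → ℝ) :
    (A.1 *ᵥ x) ⬝ᵥ (A.1 *ᵥ y) = x ⬝ᵥ y := by
  have h := (Matrix.mem_orthogonalGroup_iff' _ _).1 (Matrix.mem_specialOrthogonalGroup_iff.1 A.2).1
  rw [Matrix.dotProduct_mulVec, Matrix.vecMul_mulVec, h, Matrix.vecMul_one]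

/-- The imaginary unit `i`. -/
def quatI : ℍ[ℝ] := ⟨0, 1, 0, 0⟩
/-- The imaginary unit `j`. -/
def quatJ : ℍ[ℝ] := ⟨0, 0, 1, 0⟩
/-- The imaginary unit `k`. -/
def quatK : ℍ[ℝ] := ⟨0, 0, 0, 1⟩

@[simp] theorem re_quatI : quatI.re = 0 := rfl
@[simp] theorem imI_quatI : quatI.imI = 1 := rfl
@[simp] theorem imJ_quatI : quatI.imJ = 0 := rfl
@[simp] theorem imK_quatI : quatI.imK = 0 := rfl
@[simp] theorem re_quatJ : quatJ.re = 0 := rfl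
@[simp] theorem imI_quatJ : quatJ.imI = 0 := rfl
@[simp] theorem imJ_quatJ : quatJ.imJ = 1 := rfl
@[simp] theorem imK_quatJ : quatJ.imK = 0 := rfl
@[simp] theorem re_quatK : quatK.re = 0 := rfl
@[simp] theorem imI_quatK : quatK.imI = 0 := rfl
@[simp] theorem imJ_quatK : quatK.imJ = 0 := rfl
@[simp] theorem imK_quatK : quatK.imK = 1 := rfl

theorem norm_of_normSq {q : ℍ[ℝ]} (h : Quaternion.normSq q = 1) : ‖q‖ = 1 := by
  rw [Quaternion.normSq_eq_norm_mul_self] at h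
  nlinarith [norm_nonneg q]

theorem norm_quatI : ‖quatI‖ = 1 := norm_of_normSq (by simp [normSq_coords])

theorem norm_quatJ : ‖quatJ‖ = 1 := norm_of_normSq (by simp [normSq_coords])

theorem norm_quatK : ‖quatK‖ = 1 := norm_of_normSq (by simp [normSq_coords])

/-- Every rotation of the space of quaternions has the form `z ↦ q z r⁻¹`: after composition with
rotations of this form it fixes `1`, then also `i`, then also `j`, and finally it is the identity. -/
theorem quatRotation_surjective : Function.Surjective quatRotation := by
  suffices h : ∀ A, A ∈ quatRotation.range from h
  have inner (A : Matrix.specialOrthogonalGroup (Fin 4) ℝ) {x y x' y' : ℍ[ℝ]}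
      (h : A.1 *ᵥ quatTuple x = quatTuple x') (h' : A.1 *ᵥ quatTuple y = quatTuple y') :
      (star x' * y').re = (star x * y).re := by
    rw [← quatTuple_dotProduct, ← quatTuple_dotProduct, ← h, ← h', mulVec_dotProduct_mulVec]
  have image (A : Matrix.specialOrthogonalGroup (Fin 4) ℝ) (x : ℍ[ℝ]) :
      ∃ y, A.1 *ᵥ quatTuple x = quatTuple y := ⟨quatTuple.symm _, (quatTuple.apply_symm_apply _).symm⟩
  have nrm {x y : ℍ[ℝ]} (h : (star x * x).re = (star y * y).re) : ‖x‖ = ‖y‖ := by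
    rw [Quaternion.star_mul_self, Quaternion.star_mul_self, Quaternion.re_coe, Quaternion.re_coe,
      Quaternion.normSq_eq_norm_mul_self, Quaternion.normSq_eq_norm_mul_self] at h
    nlinarith [norm_nonneg x, norm_nonneg y]
  have red (A : Matrix.specialOrthogonalGroup (Fin 4) ℝ) (g)
      (h : quatRotation g * A ∈ quatRotation.range) : A ∈ quatRotation.range :=
    (Subgroup.mul_mem_cancel_left _ (MonoidHom.mem_range.2 ⟨g, rfl⟩)).1 h
  have mv (A : Matrix.specialOrthogonalGroup (Fin 4) ℝ) (g) (x y : ℍ[ℝ])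
      (h : A.1 *ᵥ quatTuple x = quatTuple y) : (quatRotation g * A).1 *ᵥ quatTuple x =
        quatTuple (g.1 * y * star (g.2 : ℍ[ℝ])) := by
    rw [← quatRotation_mulVec, ← h, Matrix.mulVec_mulVec]; rfl
  have conj {r : unitary ℍ[ℝ]} {u w : ℍ[ℝ]} (h : (r : ℍ[ℝ]) * u = w * r) :
      (r : ℍ[ℝ]) * u * star (r : ℍ[ℝ]) = w := by
    rw [h, mul_assoc, (Unitary.mem_iff.1 r.2).2, mul_one]
  -- a rotation which fixes `1`, `i` and `j`
  have h3 (A : Matrix.specialOrthogonalGroup (Fin 4) ℝ) (h1 : A.1 *ᵥ quatTuple 1 = quatTuple 1)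
      (hi : A.1 *ᵥ quatTuple quatI = quatTuple quatI)
      (hj : A.1 *ᵥ quatTuple quatJ = quatTuple quatJ) : A = 1 := by
    obtain ⟨v, hv⟩ := image A quatK
    have e0 := inner A h1 hv
    have e1 := inner A hi hv
    have e2 := inner A hj hv
    have hv0 : v.re = 0 := by simpa using e0
    have hv1 : v.imI = 0 := by simpa using e1
    have hv2 : v.imJ = 0 := by simpa using e2
    have hA : A.1 = !![1, 0, 0, 0; 0, 1, 0, 0; 0, 0, 1, 0; 0, 0, 0, v.imK] := by
      ext i j
      have f1 := congrFun h1 i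
      have f2 := congrFun hi i
      have f3 := congrFun hj i
      have f4 := congrFun hv i
      simp only [Matrix.mulVec, dotProduct, Fin.sum_univ_four, quatTuple_apply] at f1 f2 f3 f4
      fin_cases i <;> simp [hv0, hv1, hv2] at f1 f2 f3 f4 <;> fin_cases j <;> simp [*]
    have hd := (Matrix.mem_specialOrthogonalGroup_iff.1 A.2).2
    have hk : v.imK = 1 := by
      rw [hA, Matrix.det_succ_row_zero] at hd
      simpa [Fin.sum_univ_four, Matrix.det_fin_three, Fin.succAbove, Matrix.submatrix] using hd
    refine Subtype.ext (hA.trans ?_)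
    rw [hk]
    ext i j
    fin_cases i <;> fin_cases j <;> simp
  -- a rotation which fixes `1` and `i`
  have h2 (A : Matrix.specialOrthogonalGroup (Fin 4) ℝ) (h1 : A.1 *ᵥ quatTuple 1 = quatTuple 1)
      (hi : A.1 *ᵥ quatTuple quatI = quatTuple quatI) : A ∈ quatRotation.range := by
    obtain ⟨v, hv⟩ := image A quatJ
    have hv0 : v.re = 0 := by simpa using inner A h1 hv
    have hv1 : v.imI = 0 := by simpa using inner A hi hv
    have hvn : ‖v‖ = 1 := (nrm (inner A hv hv)).trans norm_quatJ
    obtain ⟨r, hr, hc⟩ : ∃ r : unitary ℍ[ℝ], (r : ℍ[ℝ]) * v = quatJ * r ∧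
        Commute quatI (r : ℍ[ℝ]) := by
      by_cases hne : quatJ * v = 1
      · refine ⟨toUnitary quatI norm_quatI, ?_, Commute.refl _⟩
        have : v = - quatJ := by
          rw [← one_mul v, ← neg_neg (1 : ℍ[ℝ]), ← im_mul_self (u := quatJ) rfl norm_quatJ, neg_mul,
            mul_assoc, hne, mul_one]
        change quatI * v = quatJ * quatI
        rw [this]
        apply Quaternion.ext <;> simp
      · refine exists_unitary_conj hv0 hvn rfl norm_quatJ hne ?_
        change _ * _ = _ * _
        apply Quaternion.ext <;> simp [hv0, hv1]
    refine red A (r, r) ?_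
    rw [h3 (quatRotation (r, r) * A)]
    · exact one_mem _
    · rw [mv A _ _ _ h1]; exact congrArg _ (conj (by simp))
    · rw [mv A _ _ _ hi]; exact congrArg _ (conj hc.symm.eq)
    · rw [mv A _ _ _ hv]; exact congrArg _ (conj hr)
  -- a rotation which fixes `1`
  have h1 (A : Matrix.specialOrthogonalGroup (Fin 4) ℝ) (h1 : A.1 *ᵥ quatTuple 1 = quatTuple 1) :
      A ∈ quatRotation.range := by
    obtain ⟨v, hv⟩ := image A quatI
    have hv0 : v.re = 0 := by simpa using inner A h1 hv
    have hvn : ‖v‖ = 1 := (nrm (inner A hv hv)).trans norm_quatI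
    obtain ⟨r, hr⟩ : ∃ r : unitary ℍ[ℝ], (r : ℍ[ℝ]) * v = quatI * r := by
      by_cases hne : quatI * v = 1
      · refine ⟨toUnitary quatJ norm_quatJ, ?_⟩
        have : v = - quatI := by
          rw [← one_mul v, ← neg_neg (1 : ℍ[ℝ]), ← im_mul_self (u := quatI) rfl norm_quatI, neg_mul,
            mul_assoc, hne, mul_one]
        change quatJ * v = quatI * quatJ
        rw [this]
        apply Quaternion.ext <;> simp
      · obtain ⟨r, hr, -⟩ := exists_unitary_conj hv0 hvn (w := quatI) rfl norm_quatI hne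
          (Commute.one_left _)
        exact ⟨r, hr⟩
    refine red A (r, r) (h2 _ ?_ ?_)
    · rw [mv A _ _ _ h1]; exact congrArg _ (conj (by simp))
    · rw [mv A _ _ _ hv]; exact congrArg _ (conj hr)
  intro A
  obtain ⟨q, hq⟩ := image A 1
  have hqn : ‖q‖ = 1 := (nrm (inner A hq hq)).trans norm_one
  refine red A ((toUnitary q hqn)⁻¹, 1) (h1 _ ?_)
  rw [mv A _ _ _ hq]
  refine congrArg _ ?_
  change star q * q * star 1 = 1
  rw [(mem_unitary_of_norm hqn).1, star_one, mul_one]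

/-- Bilinear forms on the space of quaternions which are invariant under the rotations
`z ↦ q z r⁻¹` are multiples of the standard inner product. -/
theorem exists_eq_mul_re_of_invariant (b : ℍ[ℝ] → ℍ[ℝ] → ℝ)
    (hadd : ∀ x y z, b x (y + z) = b x y + b x z) (hsmul : ∀ x y (c : ℝ), b x (c • y) = c * b x y)
    (hsmul' : ∀ x y (c : ℝ), b (c • x) y = c * b x y)
    (hb : ∀ q r : unitary ℍ[ℝ], ∀ x y : ℍ[ℝ],
      b (q * x * star (r : ℍ[ℝ])) (q * y * star (r : ℍ[ℝ])) = b x y) :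
    ∃ c, ∀ x y, b x y = c * (star x * y).re := by
  have hu (q : ℍ[ℝ]) (hq : ‖q‖ = 1) (w : ℍ[ℝ]) (h : q * w * star q = (-1 : ℝ) • w) : b 1 w = 0 := by
    have h1 := hb (toUnitary q hq) (toUnitary q hq) 1 w
    have h2 : (q : ℍ[ℝ]) * 1 * star q = 1 := by rw [mul_one, (mem_unitary_of_norm hq).2]
    change b (q * 1 * star q) (q * w * star q) = _ at h1
    rw [h, h2, hsmul] at h1
    linarith
  have hI : b 1 quatI = 0 := hu quatJ norm_quatJ _ (by apply Quaternion.ext <;> simp)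
  have hJ : b 1 quatJ = 0 := hu quatI norm_quatI _ (by apply Quaternion.ext <;> simp)
  have hK : b 1 quatK = 0 := hu quatI norm_quatI _ (by apply Quaternion.ext <;> simp)
  have h1 (z : ℍ[ℝ]) : b 1 z = b 1 1 * z.re := by
    have : z = z.re • 1 + z.imI • quatI + z.imJ • quatJ + z.imK • quatK := by
      apply Quaternion.ext <;> simp
    conv_lhs => rw [this]
    rw [hadd, hadd, hadd, hsmul, hsmul, hsmul, hsmul, hI, hJ, hK]
    ring
  refine ⟨b 1 1, fun x y ↦ ?_⟩
  rcases eq_or_ne x 0 with rfl | hx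
  · have := hsmul' 0 y 0
    rw [zero_smul, zero_mul] at this
    simp [this]
  have hn := norm_ne_zero_iff.2 hx
  have hxn : ‖‖x‖⁻¹ • x‖ = 1 := by rw [norm_smul, norm_inv, norm_norm, inv_mul_cancel₀ hn]
  have h2 := hb (toUnitary _ hxn)⁻¹ 1 (‖x‖⁻¹ • x) y
  change b (star (‖x‖⁻¹ • x) * (‖x‖⁻¹ • x) * star 1) (star (‖x‖⁻¹ • x) * _ * star 1) = _ at h2
  rw [star_one, mul_one, mul_one, (mem_unitary_of_norm hxn).1, h1, hsmul', star_smul, smul_mul_assoc,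
    star_trivial, Quaternion.re_smul, smul_eq_mul] at h2
  have hi := inv_ne_zero hn
  apply mul_left_cancel₀ hi
  rw [← h2]
  ring

/-- The action `(x, y) ↦ (q x r⁻¹, q y r⁻¹)` of a pair of unit quaternions on `ℍ ⊕ ℍ`. -/
noncomputable def pairRotation (q r : unitary ℍ[ℝ]) (v : ℍ[ℝ] × ℍ[ℝ]) : ℍ[ℝ] × ℍ[ℝ] :=
  (q * v.1 * star (r : ℍ[ℝ]), q * v.2 * star (r : ℍ[ℝ]))

/-- Invariant inner products on `ℍ ⊕ ℍ` are the pullbacks of the standard one by linear maps which commute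
with the rotations, here by the upper triangular ones of the Cholesky decomposition. -/
theorem exists_cholesky (B : ℍ[ℝ] × ℍ[ℝ] →ₗ[ℝ] ℍ[ℝ] × ℍ[ℝ] →ₗ[ℝ] ℝ) (hsymm : ∀ v w, B v w = B w v)
    (hpos : ∀ v, v ≠ 0 → 0 < B v v)
    (hB : ∀ q r v w, B (pairRotation q r v) (pairRotation q r w) = B v w) :
    ∃ s t d : ℝ, s ≠ 0 ∧ d ≠ 0 ∧ ∀ v w, B v w =
      (star (s • v.1 + t • v.2) * (s • w.1 + t • w.2)).re + (star (d • v.2) * (d • w.2)).re := by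
  have hform (i j : ℍ[ℝ] →ₗ[ℝ] ℍ[ℝ] × ℍ[ℝ]) (hi : ∀ (q r : unitary ℍ[ℝ]) (x : ℍ[ℝ]),
      i (q * x * star (r : ℍ[ℝ])) = pairRotation q r (i x)) (hj : ∀ (q r : unitary ℍ[ℝ]) (x : ℍ[ℝ]),
      j (q * x * star (r : ℍ[ℝ])) = pairRotation q r (j x)) :
      ∃ c, ∀ x y, B (i x) (j y) = c * (star x * y).re :=
    exists_eq_mul_re_of_invariant (fun x y ↦ B (i x) (j y)) (by simp) (by simp) (by simp)
      fun q r x y ↦ by rw [hi, hj, hB]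
  have hl (q r : unitary ℍ[ℝ]) (x : ℍ[ℝ]) : LinearMap.inl ℝ ℍ[ℝ] ℍ[ℝ] (q * x * star (r : ℍ[ℝ])) =
      pairRotation q r (LinearMap.inl ℝ ℍ[ℝ] ℍ[ℝ] x) := by simp [pairRotation]
  have hr (q r : unitary ℍ[ℝ]) (x : ℍ[ℝ]) : LinearMap.inr ℝ ℍ[ℝ] ℍ[ℝ] (q * x * star (r : ℍ[ℝ])) =
      pairRotation q r (LinearMap.inr ℝ ℍ[ℝ] ℍ[ℝ] x) := by simp [pairRotation]
  obtain ⟨α, hα⟩ := hform _ _ hl hl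
  obtain ⟨β, hβ⟩ := hform _ _ hl hr
  obtain ⟨γ, hγ⟩ := hform _ _ hr hr
  simp only [LinearMap.inl_apply, LinearMap.inr_apply] at hα hβ hγ
  have hre (x y : ℍ[ℝ]) : (star x * y).re = (star y * x).re := by
    simp; ring
  have hall (v w : ℍ[ℝ] × ℍ[ℝ]) : B v w = α * (star v.1 * w.1).re + β * (star v.1 * w.2).re +
      β * (star v.2 * w.1).re + γ * (star v.2 * w.2).re := by
    have hv : v = (v.1, 0) + (0, v.2) := by simp
    have hw : w = (w.1, 0) + (0, w.2) := by simp
    conv_lhs => rw [hv, hw]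
    simp only [map_add, LinearMap.add_apply]
    rw [hα, hβ, hsymm (0, v.2), hβ, hγ, hre w.1]
    ring
  have hα0 : 0 < α := by
    have := hpos (1, 0) (by simp)
    rw [hall] at this
    simpa using this
  have hd0 : 0 < γ - β ^ 2 / α := by
    have := hpos ((-(β / α) : ℝ) • 1, 1) (by simp)
    rw [hall] at this
    simp at this
    have h2 : α * (β / α * (β / α)) = β ^ 2 / α := by field_simp
    have h3 : β * (β / α) = β ^ 2 / α := by ring
    linarith
  refine ⟨√α, β / √α, √(γ - β ^ 2 / α), by positivity, by positivity, fun v w ↦ ?_⟩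
  have e1 : √α * √α = α := Real.mul_self_sqrt hα0.le
  have e2 : √α * (β / √α) = β := by field_simp
  have e3 : (β / √α) * (β / √α) = β ^ 2 / α := by rw [div_mul_div_comm, e1, sq]
  have e4 := Real.mul_self_sqrt hd0.le
  rw [hall]
  simp only [star_add, star_smul, star_trivial, add_mul, mul_add, smul_mul_smul_comm, Quaternion.re_add,
    Quaternion.re_smul, smul_eq_mul, e1, e2, e3, e4, mul_comm (β / √α) √α]
  ring

/-- The real matrix `x x'ᵀ + y y'ᵀ` is symmetric if it is orthogonal to the left and right multiplications by
the imaginary units, which form a basis of the skew-symmetric matrices. -/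
theorem symmetric_of_orthogonal {x y x' y' : ℍ[ℝ]} (key : ∀ u : ℍ[ℝ], u.re = 0 → ‖u‖ = 1 →
    (star (u * x) * x').re + (star (u * y) * y').re = 0 ∧
      (star (x * u) * x').re + (star (y * u) * y').re = 0) (i j : Fin 4) :
    quatTuple x i * quatTuple x' j + quatTuple y i * quatTuple y' j =
      quatTuple x j * quatTuple x' i + quatTuple y j * quatTuple y' i := by
  obtain ⟨k1, k1'⟩ := key quatI rfl norm_quatI
  obtain ⟨k2, k2'⟩ := key quatJ rfl norm_quatJ
  obtain ⟨k3, k3'⟩ := key quatK rfl norm_quatK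
  simp at k1 k1' k2 k2' k3 k3'
  fin_cases i <;> fin_cases j <;> simp [quatTuple_apply] <;> linarith

/-- A linear subspace of `ℍ ⊕ ℍ` which is orthogonal to the orbits of its elements, for some
invariant inner product, has dimension at most two. -/
theorem finrank_le_two_of_orthogonal (B : ℍ[ℝ] × ℍ[ℝ] →ₗ[ℝ] ℍ[ℝ] × ℍ[ℝ] →ₗ[ℝ] ℝ)
    (hsymm : ∀ v w, B v w = B w v) (hpos : ∀ v, v ≠ 0 → 0 < B v v)
    (hB : ∀ q r v w, B (pairRotation q r v) (pairRotation q r w) = B v w)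
    (F : Submodule ℝ (ℍ[ℝ] × ℍ[ℝ]))
    (hl : ∀ v ∈ F, ∀ w ∈ F, ∀ u : ℍ[ℝ], u.re = 0 → ‖u‖ = 1 → B (u * v.1, u * v.2) w = 0)
    (hr : ∀ v ∈ F, ∀ w ∈ F, ∀ u : ℍ[ℝ], u.re = 0 → ‖u‖ = 1 → B (v.1 * u, v.2 * u) w = 0) :
    Module.finrank ℝ F ≤ 2 := by
  obtain ⟨s, t, d, hs, hd, h⟩ := exists_cholesky B hsymm hpos hB
  let T : ℍ[ℝ] × ℍ[ℝ] →ₗ[ℝ] (Fin 4 → ℝ) × (Fin 4 → ℝ) :=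
    (quatTuple.toLinearMap.comp (s • LinearMap.fst ℝ ℍ[ℝ] ℍ[ℝ] + t • LinearMap.snd ℝ ℍ[ℝ] ℍ[ℝ])).prod
      (quatTuple.toLinearMap.comp (d • LinearMap.snd ℝ ℍ[ℝ] ℍ[ℝ]))
  have hT : Function.Injective T := by
    refine (injective_iff_map_eq_zero T).2 fun v hv ↦ ?_
    have h1 : s • v.1 + t • v.2 = 0 := quatTuple.map_eq_zero_iff.1 (congrArg Prod.fst hv)
    have h2 : d • v.2 = 0 := quatTuple.map_eq_zero_iff.1 (congrArg Prod.snd hv)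
    have h3 : v.2 = 0 := (smul_eq_zero.1 h2).resolve_left hd
    rw [h3, smul_zero, add_zero] at h1
    exact Prod.ext ((smul_eq_zero.1 h1).resolve_left hs) h3
  rw [(Submodule.equivMapOfInjective T hT F).finrank_eq]
  refine finrank_le_two_of_symmetric _ ?_
  rintro _ ⟨v, hv, rfl⟩ _ ⟨w, hw, rfl⟩
  have key (u : ℍ[ℝ]) (hu : u.re = 0) (hn : ‖u‖ = 1) :
      (star (u * (s • v.1 + t • v.2)) * (s • w.1 + t • w.2)).re +
        (star (u * (d • v.2)) * (d • w.2)).re = 0 ∧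
      (star ((s • v.1 + t • v.2) * u) * (s • w.1 + t • w.2)).re +
        (star ((d • v.2) * u) * (d • w.2)).re = 0 := by
    have e1 : u * (s • v.1 + t • v.2) = s • (u * v.1) + t • (u * v.2) := by
      rw [mul_add, mul_smul_comm, mul_smul_comm]
    have e2 : (s • v.1 + t • v.2) * u = s • (v.1 * u) + t • (v.2 * u) := by
      rw [add_mul, smul_mul_assoc, smul_mul_assoc]
    have e3 : u * (d • v.2) = d • (u * v.2) := mul_smul_comm _ _ _
    have e4 : (d • v.2) * u = d • (v.2 * u) := smul_mul_assoc _ _ _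
    rw [e1, e2, e3, e4]
    have f1 := h (u * v.1, u * v.2) w
    have f2 := h (v.1 * u, v.2 * u) w
    rw [hl v hv w hw u hu hn] at f1
    rw [hr v hv w hw u hu hn] at f2
    dsimp only at f1 f2
    exact ⟨f1.symm, f2.symm⟩
  exact symmetric_of_orthogonal key

end QuaternionRotations

/-! ### Submanifolds and metrics in charts -/

section Charts

variable {E : Type} [NormedAddCommGroup E] [NormedSpace ℝ E]
  {M : Type} [TopologicalSpace M] [ChartedSpace E M]

/-- Smooth parametrizations map velocities of curves to tangent vectors. -/
theorem mfderiv_mem_tangentVectors {ψ : E → M} (hψ : ContMDiff 𝓘(ℝ, E) 𝓘(ℝ, E) ∞ ψ) {S : Set M}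
    {z w : E} (hw : w ∈ curveVelocities (ψ ⁻¹' S) z) :
    (mfderiv 𝓘(ℝ, E) 𝓘(ℝ, E) ψ z w : TangentSpace 𝓘(ℝ, E) (ψ z)) ∈ tangentVectors S (ψ z) := by
  obtain ⟨γ, hγ, hS, rfl, hd⟩ := hw
  refine ⟨ψ ∘ γ, hψ.comp hγ.contMDiff, hS, ?_⟩
  rw [tangentMap_comp (I' := 𝓘(ℝ, E)) (hψ.mdifferentiable (by simp))
    (hγ.contMDiff.mdifferentiable (by simp)), Function.comp_apply]
  have : tangentMap 𝓘(ℝ, ℝ) 𝓘(ℝ, E) γ ⟨(0 : ℝ), (1 : ℝ)⟩ = ⟨γ 0, w⟩ := by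
    simp only [tangentMap, mfderiv_eq_fderiv]
    congr 1
    exact (congrArg (fun L : ℝ →L[ℝ] E ↦ L 1) hd.hasFDerivAt.fderiv).trans (by simp)
  rw [this]
  rfl

/-- In a chart onto the whole model space, an embedded submanifold remains one. -/
theorem IsEmbeddedSubmanifold.isSubmanifoldAtZero [FiniteDimensional ℝ E]
    [IsManifold 𝓘(ℝ, E) ∞ M] {k : ℕ} {S : Set M}
    (hS : IsEmbeddedSubmanifold E k S) {e : OpenPartialHomeomorph M E}
    (he : e ∈ IsManifold.maximalAtlas 𝓘(ℝ, E) ∞ M) (ht : e.target = Set.univ)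
    (h0 : e.symm 0 ∈ S) : IsSubmanifoldAtZero k (e.symm ⁻¹' S) := by
  obtain ⟨e', he', hp, F, hF, hSF⟩ := hS _ h0
  refine ⟨h0, e.symm.trans e', ?_, ?_, ?_, F, hF, fun z hz ↦ ?_⟩
  · rw [← contMDiffOn_iff_contDiffOn]
    exact (contMDiffOn_of_mem_maximalAtlas he').comp
      ((contMDiffOn_symm_of_mem_maximalAtlas he).mono (by simp [ht])) (by
        intro z hz; simpa [ht] using hz)
  · rw [← contMDiffOn_iff_contDiffOn]
    exact (contMDiffOn_of_mem_maximalAtlas he).comp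
      ((contMDiffOn_symm_of_mem_maximalAtlas he').mono (by intro z hz; simp at hz; exact hz.1)) (by
        intro z hz; simp at hz; exact hz.2)
  · simpa [ht] using hp
  · exact hSF _ (by simpa [ht] using hz)

/-- The pullback of a Riemannian metric by a smooth map of a vector space depends continuously
on all its arguments. -/
theorem continuous_inner_mfderiv [FiniteDimensional ℝ E] [IsManifold 𝓘(ℝ, E) ∞ M]
    (μ : Bundle.ContMDiffRiemannianMetric 𝓘(ℝ, E) ∞ E (fun p : M ↦ TangentSpace 𝓘(ℝ, E) p))
    {ψ : E → M} (hψ : ContMDiff 𝓘(ℝ, E) 𝓘(ℝ, E) ∞ ψ) :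
    Continuous fun m : E × E × E ↦ μ.inner (ψ m.1) (mfderiv 𝓘(ℝ, E) 𝓘(ℝ, E) ψ m.1 m.2.1)
      (mfderiv 𝓘(ℝ, E) 𝓘(ℝ, E) ψ m.1 m.2.2) := by
  have hb : Continuous fun m : E × E × E ↦ ψ m.1 := hψ.continuous.comp continuous_fst
  have ht (u : E × E × E → E) (hu : Continuous u) : ContMDiff 𝓘(ℝ, E × E × E) 𝓘(ℝ, E).tangent 0
      (fun m : E × E × E ↦ Bundle.TotalSpace.mk' E (E := fun p : M ↦ TangentSpace 𝓘(ℝ, E) p) (ψ m.1)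
        (mfderiv 𝓘(ℝ, E) 𝓘(ℝ, E) ψ m.1 (u m))) := by
    rw [contMDiff_zero_iff]
    exact (hψ.continuous_tangentMap (by simp)).comp
      ((tangentBundleModelSpaceHomeomorph 𝓘(ℝ, E)).symm.continuous.comp (continuous_fst.prodMk hu))
  have h : ContMDiff 𝓘(ℝ, E × E × E) (𝓘(ℝ, E).prod 𝓘(ℝ)) 0 (fun m : E × E × E ↦
      Bundle.TotalSpace.mk' ℝ (E := Bundle.Trivial M ℝ) (ψ m.1)
        (μ.inner (ψ m.1) (mfderiv 𝓘(ℝ, E) 𝓘(ℝ, E) ψ m.1 m.2.1)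
          (mfderiv 𝓘(ℝ, E) 𝓘(ℝ, E) ψ m.1 m.2.2))) := by
    apply ContMDiff.clm_bundle_apply₂ (F₁ := E) (F₂ := E)
    · exact (μ.contMDiff.of_le (by simp)).comp (contMDiff_zero_iff.2 hb)
    · exact ht _ (by fun_prop)
    · exact ht _ (by fun_prop)
  rw [← contMDiff_zero_iff (I := 𝓘(ℝ, E × E × E)) (I' := 𝓘(ℝ, ℝ))]
  intro x
  have := h x
  simp only [Bundle.contMDiffAt_totalSpace] at this
  exact this.2

end Charts

/-! ### Two copies of the standard representation of `SO(4)` -/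

section DoubleStandardRepresentation

open scoped Matrix

theorem doubleStdRep_apply (A : Matrix.specialOrthogonalGroup (Fin 4) ℝ)
    (v : (Fin 4 → ℝ) × (Fin 4 → ℝ)) : doubleStdRep A v = (A.1 *ᵥ v.1, A.1 *ᵥ v.2) := rfl

/-- The coordinates of pairs of quaternions. -/
noncomputable def pairTuple : (ℍ[ℝ] × ℍ[ℝ]) ≃ₗ[ℝ] (Fin 4 → ℝ) × (Fin 4 → ℝ) :=
  quatTuple.prodCongr quatTuple

theorem pairTuple_apply (v : ℍ[ℝ] × ℍ[ℝ]) : pairTuple v = (quatTuple v.1, quatTuple v.2) := rfl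

theorem doubleStdRep_quatRotation (q r : unitary ℍ[ℝ]) (v : ℍ[ℝ] × ℍ[ℝ]) :
    doubleStdRep (quatRotation (q, r)) (pairTuple v) = pairTuple (pairRotation q r v) := by
  rw [doubleStdRep_apply, pairTuple_apply, quatRotation_mulVec, quatRotation_mulVec]
  rfl

theorem norm_mulVec_le (A : Matrix.specialOrthogonalGroup (Fin 4) ℝ) (x : Fin 4 → ℝ) :
    ‖A.1 *ᵥ x‖ ≤ 2 * ‖x‖ := by
  refine (pi_norm_le_iff_of_nonneg (by positivity)).2 fun i ↦ ?_
  have h := mulVec_dotProduct_mulVec A x x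
  have h1 : (A.1 *ᵥ x) i * (A.1 *ᵥ x) i ≤ (A.1 *ᵥ x) ⬝ᵥ (A.1 *ᵥ x) :=
    Finset.single_le_sum (f := fun j ↦ (A.1 *ᵥ x) j * (A.1 *ᵥ x) j)
      (fun j _ ↦ mul_self_nonneg _) (Finset.mem_univ i)
  have h2 : x ⬝ᵥ x ≤ 4 * ‖x‖ ^ 2 := by
    calc x ⬝ᵥ x ≤ ∑ _ : Fin 4, ‖x‖ ^ 2 := Finset.sum_le_sum fun j _ ↦ by
          have := norm_le_pi_norm x j
          rw [← sq, ← sq_abs, ← Real.norm_eq_abs]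
          gcongr
      _ = 4 * ‖x‖ ^ 2 := by simp
  rw [Real.norm_eq_abs]
  refine abs_le_of_sq_le_sq ?_ (by positivity)
  nlinarith

/-- The unit quaternion `cos t + sin t u`, where `u` is a unit imaginary quaternion. -/
noncomputable def quatExp (u : ℍ[ℝ]) (hu : u.re = 0) (hn : ‖u‖ = 1) (t : ℝ) : unitary ℍ[ℝ] :=
  toUnitary (Real.cos t • 1 + Real.sin t • u) (norm_of_normSq (by
    have h := Quaternion.normSq_eq_norm_mul_self u
    rw [hn, normSq_coords, hu] at h
    rw [normSq_coords]
    simp [hu]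
    nlinarith [Real.sin_sq_add_cos_sq t]))

theorem coe_quatExp (u : ℍ[ℝ]) (hu : u.re = 0) (hn : ‖u‖ = 1) (t : ℝ) :
    (quatExp u hu hn t : ℍ[ℝ]) = Real.cos t • 1 + Real.sin t • u := rfl

theorem cos_smul_add_sin_smul_mem_curveVelocities {E : Type} [NormedAddCommGroup E]
    [NormedSpace ℝ E] {S : Set E} {z w : E} (h : ∀ t : ℝ, Real.cos t • z + Real.sin t • w ∈ S) :
    w ∈ curveVelocities S z := by
  refine ⟨fun t ↦ Real.cos t • z + Real.sin t • w, ?_, h, by simp, ?_⟩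
  · exact (Real.contDiff_cos.smul contDiff_const).add (Real.contDiff_sin.smul contDiff_const)
  · have := ((Real.hasDerivAt_cos 0).smul_const z).add ((Real.hasDerivAt_sin 0).smul_const w)
    rw [Real.sin_zero, Real.cos_zero, neg_zero, zero_smul, zero_add, one_smul] at this
    exact this

theorem curveVelocities_subset_tangentVectors {E : Type} [NormedAddCommGroup E] [NormedSpace ℝ E]
    (S : Set E) (z : E) : curveVelocities S z ⊆ tangentVectors (E := E) S z := by
  intro w hw
  have := mfderiv_mem_tangentVectors (E := E) (M := E) (ψ := id) contMDiff_id hw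
  rwa [mfderiv_id] at this

/-- The tangent space at `0` of a section for a representation of `SO(4)` on `ℝ⁴ ⊕ ℝ⁴` meets every
invariant closed cone. -/
theorem exists_mem_cone {S : Set ((Fin 4 → ℝ) × (Fin 4 → ℝ))}
    (hS : ∀ x, ∃ A : Matrix.specialOrthogonalGroup (Fin 4) ℝ, doubleStdRep A x ∈ S)
    {F : Submodule ℝ ((Fin 4 → ℝ) × (Fin 4 → ℝ))}
    (hF : ∀ C : Set ((Fin 4 → ℝ) × (Fin 4 → ℝ)), IsClosed C →
      (∀ c ∈ C, ∀ r : ℝ, 0 < r → r • c ∈ C) →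
        (∀ ε > 0, ∃ z ∈ S, z ∈ C ∧ z ≠ 0 ∧ ‖z‖ < ε) → ∃ c ∈ F, c ∈ C ∧ c ≠ 0)
    {C : Set ((Fin 4 → ℝ) × (Fin 4 → ℝ))} (hC : IsClosed C)
    (hCs : ∀ c ∈ C, ∀ r : ℝ, 0 < r → r • c ∈ C)
    (hCA : ∀ A : Matrix.specialOrthogonalGroup (Fin 4) ℝ, ∀ c ∈ C, doubleStdRep A c ∈ C)
    {v : (Fin 4 → ℝ) × (Fin 4 → ℝ)} (hv : v ∈ C) (hv0 : v ≠ 0) : ∃ c ∈ F, c ∈ C ∧ c ≠ 0 := by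
  refine hF C hC hCs fun ε hε ↦ ?_
  have hn := norm_pos_iff.2 hv0
  set δ := ε / (4 * ‖v‖) with hδ
  have hδ0 : 0 < δ := by positivity
  obtain ⟨A, hA⟩ := hS (δ • v)
  refine ⟨_, hA, hCA A _ (hCs v hv δ hδ0), fun h0 ↦ ?_, ?_⟩
  · have h1 : doubleStdRep A⁻¹ (doubleStdRep A (δ • v)) = δ • v := by
      rw [← Module.End.mul_apply, ← map_mul, inv_mul_cancel, map_one, Module.End.one_apply]
    rw [h0, map_zero] at h1
    exact smul_ne_zero hδ0.ne' hv0 h1.symm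
  · have h1 : ‖doubleStdRep A (δ • v)‖ ≤ 2 * ‖δ • v‖ := by
      rw [doubleStdRep_apply]
      refine max_le ((norm_mulVec_le _ _).trans ?_) ((norm_mulVec_le _ _).trans ?_)
      · gcongr; exact norm_fst_le (δ • v)
      · gcongr; exact norm_snd_le (δ • v)
    refine h1.trans_lt ?_
    rw [norm_smul, Real.norm_of_nonneg hδ0.le, hδ]
    have : 2 * (ε / (4 * ‖v‖) * ‖v‖) = ε / 2 := by field_simp; norm_num
    linarith

theorem exists_pairRotation_left {u : ℍ[ℝ]} (hu : u.re = 0) (hn : ‖u‖ = 1) (z : ℍ[ℝ] × ℍ[ℝ]) (t : ℝ) :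
    ∃ q r, Real.cos t • z + Real.sin t • (u * z.1, u * z.2) = pairRotation q r z := by
  refine ⟨quatExp u hu hn t, 1, ?_⟩
  simp only [pairRotation, coe_quatExp, OneMemClass.coe_one, star_one, mul_one, add_mul,
    smul_mul_assoc, one_mul]
  rfl

theorem exists_pairRotation_right {u : ℍ[ℝ]} (hu : u.re = 0) (hn : ‖u‖ = 1) (z : ℍ[ℝ] × ℍ[ℝ]) (t : ℝ) :
    ∃ q r, Real.cos t • z + Real.sin t • (z.1 * u, z.2 * u) = pairRotation q r z := by
  refine ⟨1, (quatExp u hu hn t)⁻¹, ?_⟩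
  have : star (((quatExp u hu hn t)⁻¹ : unitary ℍ[ℝ]) : ℍ[ℝ]) = Real.cos t • 1 + Real.sin t • u :=
    star_star _
  simp only [pairRotation, this, OneMemClass.coe_one, one_mul, mul_add, mul_smul_comm, mul_one]
  rfl

/-- A section for `SO(4)` on `ℝ⁴ ⊕ ℝ⁴` has a tangent space at `0` of dimension at most two, which meets
all nontrivial invariant closed cones. -/
theorem exists_subspace_of_isPolarRepresentation
    (B : ((Fin 4 → ℝ) × (Fin 4 → ℝ)) →L[ℝ] ((Fin 4 → ℝ) × (Fin 4 → ℝ)) →L[ℝ] ℝ)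
    (hsymm : ∀ v w, B v w = B w v) (hpos : ∀ v, v ≠ 0 → 0 < B v v)
    (hB : ∀ (A : Matrix.specialOrthogonalGroup (Fin 4) ℝ) (v w),
      B (doubleStdRep A v) (doubleStdRep A w) = B v w) (h : IsPolarRepresentation doubleStdRep B) :
    ∃ F : Submodule ℝ ((Fin 4 → ℝ) × (Fin 4 → ℝ)), Module.finrank ℝ F ≤ 2 ∧
      ∀ C : Set ((Fin 4 → ℝ) × (Fin 4 → ℝ)), IsClosed C → (∀ c ∈ C, ∀ r : ℝ, 0 < r → r • c ∈ C) →
        (∀ A : Matrix.specialOrthogonalGroup (Fin 4) ℝ, ∀ c ∈ C, doubleStdRep A c ∈ C) →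
        ∀ v ∈ C, v ≠ 0 → ∃ c ∈ F, c ∈ C ∧ c ≠ 0 := by
  obtain ⟨S, k, -, hSk, hmeet, horth⟩ := h
  have h0 : (0 : (Fin 4 → ℝ) × (Fin 4 → ℝ)) ∈ S := by
    obtain ⟨A, hA⟩ := hmeet 0
    dsimp only at hA
    rwa [map_zero] at hA
  have hsub : IsSubmanifoldAtZero k S := IsEmbeddedSubmanifold.isSubmanifoldAtZero hSk
    (e := OpenPartialHomeomorph.refl _) (IsManifold.subset_maximalAtlas (by simp)) rfl h0
  obtain ⟨F, -, -, hcone, hlim⟩ := hsub.exists_tangentSpace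
  have horth' (U : (ℍ[ℝ] × ℍ[ℝ]) →ₗ[ℝ] (ℍ[ℝ] × ℍ[ℝ])) (hU : ∀ z (t : ℝ),
      ∃ q r, Real.cos t • z + Real.sin t • U z = pairRotation q r z) (v) (hv : v ∈ F) (w)
      (hw : w ∈ F) : B (pairTuple (U (pairTuple.symm v))) w = 0 := by
    obtain ⟨z, z', hz, h0, hv', hw'⟩ := hlim v hv w hw
    refine eq_zero_of_tendsto_of_orthogonal (m := fun _ u w ↦ B u w) (S := S) (by fun_prop)
      (by simp) (LinearMap.toContinuousLinearMap (pairTuple.toLinearMap.comp (U.comp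
        pairTuple.symm.toLinearMap))) ?_ hz h0 hv' hw'
    intro z hz w hw
    refine horth z hz _ (curveVelocities_subset_tangentVectors
      (E := (Fin 4 → ℝ) × (Fin 4 → ℝ)) _ _ ?_) _
      (curveVelocities_subset_tangentVectors (E := (Fin 4 → ℝ) × (Fin 4 → ℝ)) _ _ hw)
    refine cos_smul_add_sin_smul_mem_curveVelocities fun t ↦ ?_
    obtain ⟨q, r, hqr⟩ := hU (pairTuple.symm z) t
    refine ⟨quatRotation (q, r), ?_⟩
    have := doubleStdRep_quatRotation q r (pairTuple.symm z)
    rw [LinearEquiv.apply_symm_apply, ← hqr, map_add, map_smul, map_smul,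
      LinearEquiv.apply_symm_apply] at this
    exact this
  refine ⟨F, ?_, fun C hC hCs hCA v hv hv0 ↦ exists_mem_cone hmeet hcone hC hCs hCA hv hv0⟩
  rw [← LinearEquiv.finrank_map_eq pairTuple.symm F]
  let L := pairTuple.toLinearMap
  refine finrank_le_two_of_orthogonal
    (((ContinuousLinearMap.coeLM ℝ).comp B.toLinearMap).compl₁₂ L L)
    (fun v w ↦ hsymm _ _) (fun v hv ↦ hpos _ ?_) (fun q r v w ↦ ?_) _ ?_ ?_
  · exact pairTuple.map_ne_zero_iff.2 hv
  · change B (pairTuple _) (pairTuple _) = B (pairTuple _) (pairTuple _)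
    rw [← doubleStdRep_quatRotation, ← doubleStdRep_quatRotation, hB]
  · rintro _ ⟨v, hv, rfl⟩ _ ⟨w, hw, rfl⟩ u hu hn
    have := horth' ((LinearMap.mulLeft ℝ u).prodMap (LinearMap.mulLeft ℝ u))
      (exists_pairRotation_left hu hn) v hv w hw
    rw [← pairTuple.apply_symm_apply w] at this
    exact this
  · rintro _ ⟨v, hv, rfl⟩ _ ⟨w, hw, rfl⟩ u hu hn
    have := horth' ((LinearMap.mulRight ℝ u).prodMap (LinearMap.mulRight ℝ u))
      (exists_pairRotation_right hu hn) v hv w hw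
    rw [← pairTuple.apply_symm_apply w] at this
    exact this

/-- A subspace `F` as in the previous lemma would meet the two summands, the diagonal and the
cone of pairs of orthogonal vectors of equal length. As `dim F ≤ 2`, it would be spanned by vectors
`(x, 0)` and `(0, y)`, with `x` and `y` both parallel and orthogonal. -/
theorem not_isPolarRepresentation_doubleStdRep
    (B : ((Fin 4 → ℝ) × (Fin 4 → ℝ)) →L[ℝ] ((Fin 4 → ℝ) × (Fin 4 → ℝ)) →L[ℝ] ℝ)
    (hsymm : ∀ v w, B v w = B w v) (hpos : ∀ v, v ≠ 0 → 0 < B v v)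
    (hB : ∀ (A : Matrix.specialOrthogonalGroup (Fin 4) ℝ) (v w),
      B (doubleStdRep A v) (doubleStdRep A w) = B v w) :
    ¬ IsPolarRepresentation doubleStdRep B := by
  intro hpol
  obtain ⟨F, hdim, hc⟩ := exists_subspace_of_isPolarRepresentation B hsymm hpos hB hpol
  -- a nonzero vector of the first summand
  obtain ⟨⟨x, x'⟩, hx, (rfl : x' = 0), hx0⟩ := hc {c | c.2 = 0}
    (isClosed_eq continuous_snd continuous_const) (fun c hc r _ ↦ smul_eq_zero_of_right r hc)
    (fun A c hc ↦ (congrArg _ hc).trans (Matrix.mulVec_zero _)) (1, 0) rfl (by simp)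
  obtain ⟨⟨y', y⟩, hy, (rfl : y' = 0), hy0⟩ := hc {c | c.1 = 0}
    (isClosed_eq continuous_fst continuous_const) (fun c hc r _ ↦ smul_eq_zero_of_right r hc)
    (fun A c hc ↦ (congrArg _ hc).trans (Matrix.mulVec_zero _)) (0, 1) rfl (by simp)
  obtain ⟨⟨z, z'⟩, hz, (rfl : z = z'), hz0⟩ := hc {c | c.1 = c.2}
    (isClosed_eq continuous_fst continuous_snd) (fun c hc r _ ↦ congrArg (r • ·) hc)
    (fun A c hc ↦ congrArg (A.1 *ᵥ ·) hc) (1, 1) rfl (by simp)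
  obtain ⟨⟨s, t⟩, hst, ⟨hst1, hst2⟩, hst0⟩ := hc {c | c.1 ⬝ᵥ c.1 = c.2 ⬝ᵥ c.2 ∧ c.1 ⬝ᵥ c.2 = 0}
    (by
      simp only [dotProduct]
      exact (isClosed_eq (by fun_prop) (by fun_prop)).inter (isClosed_eq (by fun_prop) (by fun_prop)))
    (fun c hc r _ ↦ by
      simp only [Set.mem_ofPred_eq, Prod.smul_fst, Prod.smul_snd, smul_dotProduct, dotProduct_smul,
        hc.1, hc.2, smul_zero, and_self])
    (fun A c hc ↦ by
      simp only [doubleStdRep_apply, Set.mem_ofPred_eq, mulVec_dotProduct_mulVec]; exact hc)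
    (Pi.single 0 1, Pi.single 1 1) (by simp) (by simp)
  simp only [ne_eq, Prod.mk_eq_zero, and_true, true_and, and_self] at hx0 hy0 hz0 hst0
  have hspan (w) (hw : w ∈ F) : ∃ c d : ℝ, w = (c • x, d • y) := by
    have hli : LinearIndependent ℝ ![((x, 0) : (Fin 4 → ℝ) × (Fin 4 → ℝ)), (0, y)] := by
      rw [LinearIndependent.pair_iff]
      intro c d h
      simpa [hx0, hy0] using h
    have hle : Submodule.span ℝ (Set.range ![((x, 0) : (Fin 4 → ℝ) × (Fin 4 → ℝ)), (0, y)]) ≤ F := by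
      rw [Submodule.span_le]
      rintro _ ⟨i, rfl⟩
      fin_cases i <;> assumption
    have heq := Submodule.eq_of_le_of_finrank_le hle (by
      rw [finrank_span_eq_card hli]; simpa using hdim)
    rw [← heq, Matrix.range_cons, Matrix.range_cons, Matrix.range_empty, Set.union_empty,
      Set.singleton_union, Submodule.mem_span_pair] at hw
    obtain ⟨c, d, rfl⟩ := hw
    exact ⟨c, d, by simp⟩
  obtain ⟨c, d, hcd⟩ := hspan _ hz
  obtain ⟨rfl, hzd⟩ := Prod.mk.inj hcd
  obtain ⟨c', d', hcd'⟩ := hspan _ hst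
  obtain ⟨rfl, rfl⟩ := Prod.mk.inj hcd'
  have hxx : x ⬝ᵥ x ≠ 0 := fun h ↦ hx0 (dotProduct_self_eq_zero.1 h)
  have hc0 : c ≠ 0 := fun h ↦ hz0 (by rw [h, zero_smul])
  have hd0 : d ≠ 0 := fun h ↦ hz0 (by rw [hzd, h, zero_smul])
  have hyx : y = (d⁻¹ * c) • x := by rw [mul_smul, hzd, smul_smul, inv_mul_cancel₀ hd0, one_smul]
  rw [hyx] at hst0 hst1 hst2
  simp only [smul_dotProduct, dotProduct_smul, smul_eq_mul] at hst1 hst2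
  have hk : d⁻¹ * c ≠ 0 := mul_ne_zero (inv_ne_zero hd0) hc0
  generalize d⁻¹ * c = k at *
  generalize x ⬝ᵥ x = n at *
  have h2 : d' = 0 ∨ c' = 0 := by simpa [hk, hxx] using hst2
  refine hst0 ?_
  rcases h2 with rfl | rfl <;> simp_all

end DoubleStandardRepresentation

/-! ### Charts of `G/H` and the linear isotropy representation -/

section LinearIsotropy

variable {a b : ℕ}

/-- The entries of the last rows and columns of elements of `H`. -/
theorem entries_of_mem {h : SpPair a b} (hh : h ∈ SpSub a b) :
    (∀ i, h.val.1 (Sum.inl i) lst = 0) ∧ (∀ i, h.val.1 lst (Sum.inl i) = 0) ∧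
    (∀ i, h.val.2 (Sum.inl i) lst = 0) ∧ (∀ i, h.val.2 lst (Sum.inl i) = 0) ∧
    h.val.2 lst lst = h.val.1 lst lst ∧ ‖h.val.1 lst lst‖ = 1 := by
  have h1 : ∀ i, h.val.1 (Sum.inl i) lst = 0 := by
    obtain ⟨⟨A, B, Q⟩, rfl⟩ := hh
    exact fun i ↦ rfl
  refine ⟨h1, ?_, ?_, ?_, ?_, (Sp.exists_diag h.1 h1).1⟩ <;> obtain ⟨⟨A, B, Q⟩, rfl⟩ := hh
  · exact fun i ↦ rfl
  · exact fun i ↦ rfl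
  · exact fun i ↦ rfl
  · rfl

/-- The linear isotropy representation of `H` at the base point, in the coordinates of the base
chart: `(A, B, q)` acts by `(x, y, c) ↦ (A x q⁻¹, B y q⁻¹, q c q⁻¹)`. It is extended to a function
on `G` by the same formula. -/
noncomputable def linAct (h : SpPair a b) : ModelSp a b →ₗ[ℝ] ModelSp a b where
  toFun z := (fun i ↦ ∑ j, h.val.1 (Sum.inl i) (Sum.inl j) * z.1 j * star (h.val.1 lst lst),
    fun i ↦ ∑ j, h.val.2 (Sum.inl i) (Sum.inl j) * z.2.1 j * star (h.val.2 lst lst),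
    imCoord (h.val.1 lst lst * ofIm z.2.2 * star (h.val.1 lst lst)))
  map_add' z w := by
    refine Prod.ext (funext fun i ↦ ?_) (Prod.ext (funext fun i ↦ ?_) ?_)
    · simp [mul_add, add_mul, Finset.sum_add_distrib]
    · simp [mul_add, add_mul, Finset.sum_add_distrib]
    · simp only [Prod.snd_add, map_add, mul_add, add_mul]
  map_smul' c z := by
    refine Prod.ext (funext fun i ↦ ?_) (Prod.ext (funext fun i ↦ ?_) ?_)
    · simp [Finset.smul_sum]
    · simp [Finset.smul_sum]
    · simp only [Prod.smul_snd, map_smul, mul_smul_comm, smul_mul_assoc, RingHom.id_apply]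

theorem linAct_apply (h : SpPair a b) (z : ModelSp a b) : linAct h z =
    (fun i ↦ ∑ j, h.val.1 (Sum.inl i) (Sum.inl j) * z.1 j * star (h.val.1 lst lst),
    fun i ↦ ∑ j, h.val.2 (Sum.inl i) (Sum.inl j) * z.2.1 j * star (h.val.2 lst lst),
    imCoord (h.val.1 lst lst * ofIm z.2.2 * star (h.val.1 lst lst))) := rfl

theorem star_eq_inv_of_norm {q : ℍ[ℝ]} (hq : ‖q‖ = 1) : star q = q⁻¹ :=
  eq_inv_of_mul_eq_one_left (mem_unitary_of_norm hq).1

theorem eq_re_add_ofIm (q : ℍ[ℝ]) : q = (q.re : ℍ[ℝ]) + ofIm (imCoord q) := by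
  apply Quaternion.ext <;> simp

theorem re_conj {q : ℍ[ℝ]} (hq : ‖q‖ = 1) (m : ℍ[ℝ]) : (q * m * star q).re = m.re := by
  have h1 : (q * m * star q).re = (star q * (q * m)).re := by simp; ring
  rw [h1, ← mul_assoc, (mem_unitary_of_norm hq).1, one_mul]

theorem imCoord_conj {q : ℍ[ℝ]} (hq : ‖q‖ = 1) (m : ℍ[ℝ]) :
    imCoord (q * m * star q) = imCoord (q * ofIm (imCoord m) * star q) := by
  conv_lhs => rw [eq_re_add_ofIm m, mul_add, add_mul, map_add, ← Quaternion.coe_commutes, mul_assoc,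
    (mem_unitary_of_norm hq).2, mul_one]
  have : imCoord (m.re : ℍ[ℝ]) = 0 := by
    ext i; fin_cases i <;> simp
  rw [this, zero_add]

theorem midCoord_mul_left {h : SpPair a b} (hh : h ∈ SpSub a b) (g : SpPair a b) :
    midCoord (h * g).val = h.val.1 lst lst * midCoord g.val * star (h.val.1 lst lst) := by
  obtain ⟨-, h2, -, h4, h5, -⟩ := entries_of_mem hh
  have e1 : (h * g).val.1 lst lst = h.val.1 lst lst * g.val.1 lst lst := by
    change (h.val.1 * g.val.1) lst lst = _
    simp [Matrix.mul_apply, Fintype.sum_sum_type, h2]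
  have e2 : (h * g).val.2 lst lst = h.val.2 lst lst * g.val.2 lst lst := by
    change (h.val.2 * g.val.2) lst lst = _
    simp [Matrix.mul_apply, Fintype.sum_sum_type, h4]
  rw [midCoord, midCoord, e1, e2, h5, star_mul]
  simp only [mul_assoc]

/-- The base chart conjugates the isotropy action of `H` into its linear isotropy representation. -/
theorem baseCoord_mul_left {h : SpPair a b} (hh : h ∈ SpSub a b) (g : SpPair a b) :
    baseCoord (h * g).val = linAct h (baseCoord g.val) := by
  obtain ⟨h1, h2, h3, h4, h5, h6⟩ := entries_of_mem hh
  have hm := midCoord_mul_left hh g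
  have key {n : ℕ} (A B : Matrix (Fin n ⊕ Fin 1) (Fin n ⊕ Fin 1) ℍ[ℝ])
      (hA : ∀ i, A (Sum.inl i) lst = 0) (hA' : ∀ i, A lst (Sum.inl i) = 0) (hn : ‖A lst lst‖ = 1) (i) :
      (A * B) (Sum.inl i) lst * ((A * B) lst lst)⁻¹ =
        ∑ j, A (Sum.inl i) (Sum.inl j) * (B (Sum.inl j) lst * (B lst lst)⁻¹) * star (A lst lst) := by
    have e1 : (A * B) lst lst = A lst lst * B lst lst := by
      simp [Matrix.mul_apply, Fintype.sum_sum_type, hA']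
    have e2 : (A * B) (Sum.inl i) lst = ∑ j, A (Sum.inl i) (Sum.inl j) * B (Sum.inl j) lst := by
      simp [Matrix.mul_apply, Fintype.sum_sum_type, hA]
    rw [e1, e2, mul_inv_rev, star_eq_inv_of_norm hn, Finset.sum_mul]
    exact Finset.sum_congr rfl fun j _ ↦ by simp only [mul_assoc]
  refine Prod.ext (funext fun i ↦ ?_) (Prod.ext (funext fun i ↦ ?_) ?_)
  · exact key h.val.1 g.val.1 h1 h2 h6 i
  · exact key h.val.2 g.val.2 h3 h4 (by rw [h5, h6]) i
  · change (reCoord (midCoord (h * g).val))⁻¹ • imCoord (midCoord (h * g).val) = imCoord (_ * ofIm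
      ((reCoord (midCoord g.val))⁻¹ • imCoord (midCoord g.val)) * _)
    rw [hm, reCoord_apply, re_conj h6, imCoord_conj h6, reCoord_apply, map_smul, mul_smul_comm,
      smul_mul_assoc, map_smul]

/-- The translate by `g` of the parametrization of a neighborhood of the base point. -/
noncomputable def param (g : SpPair a b) (z : ModelSp a b) : SpQuot a b :=
  g • (baseSection z : SpQuot a b)

theorem param_zero (g : SpPair a b) : param g 0 = (g : SpQuot a b) := by
  have h1 : baseCoord (1 : SpPair a b).val = 0 := by
    refine Prod.ext (funext fun i ↦ ?_) (Prod.ext (funext fun i ↦ ?_) ?_)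
    · simp [baseCoord, SpPair.val]
    · simp [baseCoord, SpPair.val]
    · ext i
      fin_cases i <;> simp [baseCoord, SpPair.val, midCoord]
  have := mk_baseSection_baseCoord (1 : SpPair a b) (by simp [midCoord, SpPair.val])
  rw [h1] at this
  rw [param, this]
  exact congrArg _ (mul_one g)

theorem param_mul (h g : SpPair a b) (z : ModelSp a b) : param (h * g) z = h • param g z :=
  mul_smul _ _ _

theorem param_linAct {h : SpPair a b} (hh : h ∈ SpSub a b) (g : SpPair a b) (z : ModelSp a b) :
    param g (linAct h z) = (g * h * g⁻¹) • param g z := by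
  have h6 := (entries_of_mem hh).2.2.2.2.2
  have h1 : (baseSection (linAct h z) : SpQuot a b) = (h * baseSection z : SpPair a b) := by
    rw [← mk_baseSection_baseCoord (h * baseSection z), baseCoord_mul_left hh, baseCoord_baseSection]
    rw [midCoord_mul_left hh, reCoord_apply, re_conj h6]
    exact reCoord_midCoord_baseSection_pos z
  have h2 : ((h * baseSection z : SpPair a b) : SpQuot a b) = h • (baseSection z : SpQuot a b) := rfl
  rw [param, param, h1, h2, smul_smul, smul_smul, inv_mul_cancel_right]

/-- The chart of `G/H` with inverse `param g`. -/
noncomputable def paramChart (g : SpPair a b) : OpenPartialHomeomorph (SpQuot a b) (ModelSp a b) :=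
  (Homeomorph.smul g⁻¹).toOpenPartialHomeomorph.trans (baseChart a b)

theorem paramChart_symm (g : SpPair a b) : ⇑(paramChart g).symm = param g := by
  funext z
  change (g⁻¹)⁻¹ • (baseSection z : SpQuot a b) = _
  rw [inv_inv]; rfl

theorem paramChart_target (g : SpPair a b) : (paramChart g).target = Set.univ := by
  simp [paramChart, baseChart]

theorem paramChart_mk (g g' : SpPair a b) :
    paramChart g (g' : SpQuot a b) = baseCoord (g⁻¹ * g').val := quotCoord_mk _

theorem paramChart_mem_maximalAtlas (g : SpPair a b) :
    paramChart g ∈ IsManifold.maximalAtlas 𝓘(ℝ, ModelSp a b) ∞ (SpQuot a b) :=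
  IsManifold.subset_maximalAtlas ((isSmoothChart_baseChart a b).translate g⁻¹)

theorem contMDiff_param (g : SpPair a b) :
    ContMDiff 𝓘(ℝ, ModelSp a b) 𝓘(ℝ, ModelSp a b) ∞ (param g) := by
  have := contMDiffOn_symm_of_mem_maximalAtlas (paramChart_mem_maximalAtlas g)
  rwa [paramChart_target, contMDiffOn_univ, paramChart_symm] at this

/-- The differential at `0` of the parametrization `param g`. -/
noncomputable def paramDeriv (g : SpPair a b) :
    ModelSp a b →L[ℝ] TangentSpace 𝓘(ℝ, ModelSp a b) (param g 0) :=
  mfderiv 𝓘(ℝ, ModelSp a b) 𝓘(ℝ, ModelSp a b) (param g) 0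

theorem paramDeriv_bijective (g : SpPair a b) : Function.Bijective (paramDeriv g) := by
  have h1 : (paramChart g).MDifferentiable 𝓘(ℝ, ModelSp a b) 𝓘(ℝ, ModelSp a b) :=
    ⟨(contMDiffOn_of_mem_maximalAtlas (paramChart_mem_maximalAtlas g)).mdifferentiableOn (by simp),
      (contMDiffOn_symm_of_mem_maximalAtlas
        (paramChart_mem_maximalAtlas g)).mdifferentiableOn (by simp)⟩
  have h2 := h1.symm.mfderiv_bijective (x := 0) (by
    change (0 : ModelSp a b) ∈ (paramChart g).target
    rw [paramChart_target]; trivial)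
  have h3 : ((paramChart g).symm : ModelSp a b → SpQuot a b) = param g := paramChart_symm g
  unfold paramDeriv
  rw [← h3]
  exact h2

end LinearIsotropy

/-! ### The special point and rotations of two coordinates -/

section SpecialElements

variable {a b : ℕ}

/-- The permutation matrix which exchanges the index `i` with the last index. -/
noncomputable def swapMat (i : Fin a) : Sp (Fin a ⊕ Fin 1) :=
  ⟨Equiv.Perm.permMatrix ℍ[ℝ] (Equiv.swap (Sum.inl i) lst), by
    rw [Unitary.mem_iff, Matrix.star_eq_conjTranspose, Matrix.conjTranspose_permMatrix,
      Equiv.swap_inv, ← Matrix.permMatrix_mul, Equiv.swap_mul_self, Matrix.permMatrix_one]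
    exact ⟨rfl, rfl⟩⟩

theorem swapMat_inv (i : Fin a) : (swapMat i)⁻¹ = swapMat i := Subtype.ext <| by
  change star (swapMat i).1 = (swapMat i).1
  rw [swapMat, Matrix.star_eq_conjTranspose, Matrix.conjTranspose_permMatrix, Equiv.swap_inv]

theorem swapMat_mul_apply (i : Fin a) (A : Matrix (Fin a ⊕ Fin 1) (Fin a ⊕ Fin 1) ℍ[ℝ]) (x y) :
    ((swapMat i).1 * A * (swapMat i).1) x y =
      A (Equiv.swap (Sum.inl i) lst x) (Equiv.swap (Sum.inl i) lst y) := by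
  have h (A : Matrix (Fin a ⊕ Fin 1) (Fin a ⊕ Fin 1) ℍ[ℝ]) :
      A * (swapMat i).1 = A.submatrix id (Equiv.swap (Sum.inl i) lst) := by
    change A * (Equiv.toPEquiv _).toMatrix = _
    rw [PEquiv.mul_toMatrix_toPEquiv, Equiv.symm_swap]
  have h' : (swapMat i).1 * A = A.submatrix (Equiv.swap (Sum.inl i) lst) id := by
    change (Equiv.toPEquiv _).toMatrix * A = _
    rw [PEquiv.toMatrix_toPEquiv_mul]
  rw [h, h']
  rfl

/-- The element of `G` which exchanges coordinate vectors with the last ones. It moves the base point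
to the point of `G/H` at which the slice representation is that of `SO(4)` on `ℝ⁴ ⊕ ℝ⁴`. -/
noncomputable def swapPair (i : Fin a) (j : Fin b) : SpPair a b := (swapMat i, swapMat j)

theorem swapPair_inv (i : Fin a) (j : Fin b) : (swapPair i j)⁻¹ = swapPair i j :=
  Prod.ext (swapMat_inv i) (swapMat_inv j)

theorem swapPair_conj_fst (i : Fin a) (j : Fin b) (h : SpPair a b) (x y) :
    (swapPair i j * h * (swapPair i j)⁻¹).val.1 x y =
      h.val.1 (Equiv.swap (Sum.inl i) lst x) (Equiv.swap (Sum.inl i) lst y) := by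
  rw [swapPair_inv]
  exact swapMat_mul_apply i h.val.1 x y

theorem swapPair_conj_snd (i : Fin a) (j : Fin b) (h : SpPair a b) (x y) :
    (swapPair i j * h * (swapPair i j)⁻¹).val.2 x y =
      h.val.2 (Equiv.swap (Sum.inl j) lst x) (Equiv.swap (Sum.inl j) lst y) := by
  rw [swapPair_inv]
  exact swapMat_mul_apply j h.val.2 x y

/-- A diagonal matrix with one entry `r` in place `i`, and ones elsewhere. -/
noncomputable def diagElem (i : Fin a) (r : unitary ℍ[ℝ]) : Sp (Fin a) :=
  ⟨Matrix.diagonal fun k ↦ if k = i then (r : ℍ[ℝ]) else 1, by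
    obtain ⟨h1, h2⟩ := Unitary.mem_iff.1 r.2
    rw [Unitary.mem_iff, Matrix.star_eq_conjTranspose, Matrix.diagonal_conjTranspose,
      Matrix.diagonal_mul_diagonal, Matrix.diagonal_mul_diagonal, ← Matrix.diagonal_one]
    constructor <;>
    · congr 1
      funext k
      by_cases hk : k = i <;> simp [hk, h1, h2]⟩

theorem norm_coe_unitary (q : unitary ℍ[ℝ]) : ‖(q : ℍ[ℝ])‖ = 1 :=
  norm_of_normSq (normSq_of_mem_unitary q)

/-- The element of `H` given by diagonal matrices with entries `r`, `r'` in the places `i`, `j`, last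
entries `q`, and ones elsewhere. -/
noncomputable def rotElem (i : Fin a) (j : Fin b) (r r' q : unitary ℍ[ℝ]) : SpPair a b :=
  subgroupEmbedding a b (diagElem i r, diagElem j r', toSp1 q (norm_coe_unitary q))

theorem rotElem_mem (i : Fin a) (j : Fin b) (r r' q : unitary ℍ[ℝ]) : rotElem i j r r' q ∈ SpSub a b :=
  ⟨_, rfl⟩

theorem rotElem_fst (i : Fin a) (j : Fin b) (r r' q : unitary ℍ[ℝ]) : (rotElem i j r r' q).val.1 =
    Matrix.fromBlocks (diagElem i r).1 0 0 (toSp1 q (norm_coe_unitary q)).1 := rfl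

theorem rotElem_snd (i : Fin a) (j : Fin b) (r r' q : unitary ℍ[ℝ]) : (rotElem i j r r' q).val.2 =
    Matrix.fromBlocks (diagElem j r').1 0 0 (toSp1 q (norm_coe_unitary q)).1 := rfl

theorem linAct_rotElem (i : Fin a) (j : Fin b) (r r' q : unitary ℍ[ℝ]) (z : ModelSp a b) :
    linAct (rotElem i j r r' q) z = (fun k ↦ (if k = i then (r : ℍ[ℝ]) else 1) * z.1 k * star (q : ℍ[ℝ]),
      fun k ↦ (if k = j then (r' : ℍ[ℝ]) else 1) * z.2.1 k * star (q : ℍ[ℝ]),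
      imCoord (q * ofIm z.2.2 * star (q : ℍ[ℝ]))) := by
  have key {n : ℕ} (d x : Fin n → ℍ[ℝ]) (k : Fin n) (s : ℍ[ℝ]) :
      ∑ l, Matrix.diagonal d k l * x l * s = d k * x k * s := by
    rw [Finset.sum_eq_single k]
    · rw [Matrix.diagonal_apply_eq]
    · intro l _ hl
      rw [Matrix.diagonal_apply_ne _ hl.symm, zero_mul, zero_mul]
    · simp
  rw [linAct_apply, rotElem_fst, rotElem_snd]
  simp only [Matrix.fromBlocks_apply₁₁, Matrix.fromBlocks_apply₂₂]
  have h1 : (diagElem i r).1 = Matrix.diagonal fun k ↦ if k = i then (r : ℍ[ℝ]) else 1 := rfl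
  have h2 : (diagElem j r').1 = Matrix.diagonal fun k ↦ if k = j then (r' : ℍ[ℝ]) else 1 := rfl
  have h3 : (toSp1 q (norm_coe_unitary q)).1 0 0 = (q : ℍ[ℝ]) := rfl
  simp only [h1, h2, h3, key]

theorem swapPair_conj_rotElem (i : Fin a) (j : Fin b) (r q : unitary ℍ[ℝ]) :
    swapPair i j * rotElem i j r r q * (swapPair i j)⁻¹ = rotElem i j q q r := by
  have key {n : ℕ} (i : Fin n) (x y : Fin n ⊕ Fin 1) :
      (Matrix.fromBlocks (diagElem i r).1 0 0 (toSp1 q (norm_coe_unitary q)).1)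
        (Equiv.swap (Sum.inl i) lst x) (Equiv.swap (Sum.inl i) lst y) =
      (Matrix.fromBlocks (diagElem i q).1 0 0 (toSp1 r (norm_coe_unitary r)).1) x y := by
    have hd (r q : unitary ℍ[ℝ]) :
        Matrix.fromBlocks (diagElem i r).1 0 0 (toSp1 q (norm_coe_unitary q)).1 =
        Matrix.diagonal (Sum.elim (fun k ↦ if k = i then (r : ℍ[ℝ]) else 1) fun _ ↦ (q : ℍ[ℝ])) := by
      rw [← Matrix.fromBlocks_diagonal]
      congr 1
      ext1 k l
      rw [Subsingleton.elim k 0, Subsingleton.elim l 0]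
      simp [toSp1]
    rw [hd, hd, Matrix.diagonal_apply, Matrix.diagonal_apply]
    simp only [(Equiv.swap (Sum.inl i) lst).injective.eq_iff]
    congr 1
    rcases x with x | x
    · rcases eq_or_ne x i with rfl | hx
      · simp
      · rw [Equiv.swap_apply_of_ne_of_ne (by simpa using hx) (by simp)]
        simp [hx]
    · rw [Subsingleton.elim x 0, Equiv.swap_apply_right]
      simp
  refine Prod.ext (Subtype.ext (Matrix.ext fun x y ↦ ?_)) (Subtype.ext (Matrix.ext fun x y ↦ ?_))
  · exact (swapPair_conj_fst i j _ x y).trans (key i x y)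
  · exact (swapPair_conj_snd i j _ x y).trans (key j x y)

/-- The coordinates `i` and `j` in the model space of `G/H`. -/
def coordProj (i : Fin a) (j : Fin b) : ModelSp a b →ₗ[ℝ] ℍ[ℝ] × ℍ[ℝ] where
  toFun z := (z.1 i, z.2.1 j)
  map_add' _ _ := rfl
  map_smul' _ _ := rfl

/-- The inclusion of `ℍ ⊕ ℍ` in the model space of `G/H` as the coordinates `i` and `j`. -/
noncomputable def coordIncl (i : Fin a) (j : Fin b) : ℍ[ℝ] × ℍ[ℝ] →ₗ[ℝ] ModelSp a b where
  toFun y := (LinearMap.single ℝ (fun _ ↦ ℍ[ℝ]) i y.1, LinearMap.single ℝ (fun _ ↦ ℍ[ℝ]) j y.2, 0)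
  map_add' y y' := by
    rw [Prod.fst_add, Prod.snd_add, map_add, map_add, Prod.mk_add_mk, Prod.mk_add_mk, add_zero]
  map_smul' c y := by simp

theorem coordIncl_apply (i : Fin a) (j : Fin b) (y : ℍ[ℝ] × ℍ[ℝ]) : coordIncl i j y =
    ((Pi.single i y.1 : Fin a → ℍ[ℝ]), (Pi.single j y.2 : Fin b → ℍ[ℝ]), (0 : Fin 3 → ℝ)) := rfl

theorem coordProj_coordIncl (i : Fin a) (j : Fin b) (y : ℍ[ℝ] × ℍ[ℝ]) :
    coordProj i j (coordIncl i j y) = y := by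
  rw [coordIncl_apply]
  simp [coordProj]

theorem linAct_rotElem_coordIncl (i : Fin a) (j : Fin b) (r q : unitary ℍ[ℝ]) (y : ℍ[ℝ] × ℍ[ℝ]) :
    linAct (rotElem i j r r q) (coordIncl i j y) = coordIncl i j (pairRotation r q y) := by
  have key {n : ℕ} (i k : Fin n) (x : ℍ[ℝ]) : (if k = i then (r : ℍ[ℝ]) else 1) *
      (Pi.single i x : Fin n → ℍ[ℝ]) k * star (q : ℍ[ℝ]) =
        (Pi.single i (r * x * star (q : ℍ[ℝ])) : Fin n → ℍ[ℝ]) k := by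
    rcases eq_or_ne k i with rfl | hk
    · simp
    · simp [hk]
  rw [linAct_rotElem]
  refine Prod.ext (funext fun k ↦ key _ _ _) (Prod.ext (funext fun k ↦ key _ _ _) ?_)
  change imCoord (q * ofIm 0 * _) = 0
  rw [map_zero, mul_zero, zero_mul, map_zero]

/-- A bilinear form invariant under `H` is block diagonal with respect to the coordinates `i` and `j`
and the others: changes of the sign of one coordinate belong to `H`. -/
theorem eq_zero_of_invariant {m : ModelSp a b → ModelSp a b → ℝ}
    (hadd : ∀ u v w, m (u + v) w = m u w + m v w) (hneg : ∀ u w, m (-u) w = - m u w)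
    (hm : ∀ h ∈ SpSub a b, ∀ u w, m (linAct h u) (linAct h w) = m u w) {i : Fin a} {j : Fin b}
    (y : ℍ[ℝ] × ℍ[ℝ]) {z : ModelSp a b} (hz : coordProj i j z = 0) : m (coordIncl i j y) z = 0 := by
  have hz1 : z.1 i = 0 := congrArg Prod.fst hz
  have hz2 : z.2.1 j = 0 := congrArg Prod.snd hz
  have key {n : ℕ} (i k : Fin n) (r : unitary ℍ[ℝ]) (x : Fin n → ℍ[ℝ]) (hx : x i = 0) :
      (if k = i then (r : ℍ[ℝ]) else 1) * x k * star ((1 : unitary ℍ[ℝ]) : ℍ[ℝ]) = x k := by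
    rcases eq_or_ne k i with rfl | hk
    · simp [hx]
    · simp [hk]
  have key' {n : ℕ} (i k : Fin n) (x : ℍ[ℝ]) : (if k = i then ((-1 : unitary ℍ[ℝ]) : ℍ[ℝ]) else 1) *
      (Pi.single i x : Fin n → ℍ[ℝ]) k * star ((1 : unitary ℍ[ℝ]) : ℍ[ℝ]) =
        (- Pi.single i x : Fin n → ℍ[ℝ]) k := by
    have hneg : ((-1 : unitary ℍ[ℝ]) : ℍ[ℝ]) = -1 := rfl
    rcases eq_or_ne k i with rfl | hk
    · simp [hneg]
    · simp [hk]
  have hIm (c : Fin 3 → ℝ) : imCoord (((1 : unitary ℍ[ℝ]) : ℍ[ℝ]) * ofIm c *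
      star ((1 : unitary ℍ[ℝ]) : ℍ[ℝ])) = c := by
    ext k; fin_cases k <;> simp
  have hfix (r r' : unitary ℍ[ℝ]) : linAct (rotElem i j r r' 1) z = z := by
    rw [linAct_rotElem]
    exact Prod.ext (funext fun k ↦ key i k r z.1 hz1)
      (Prod.ext (funext fun k ↦ key j k r' z.2.1 hz2) (hIm _))
  have h1 : m (coordIncl i j (y.1, 0)) z = 0 := by
    have h := hm _ (rotElem_mem i j (-1) 1 1) (coordIncl i j (y.1, 0)) z
    have e : linAct (rotElem i j (-1) 1 1) (coordIncl i j (y.1, 0)) = - coordIncl i j (y.1, 0) := by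
      rw [linAct_rotElem]
      refine Prod.ext (funext fun k ↦ key' i k y.1) (Prod.ext (funext fun k ↦ ?_) (by
        rw [hIm]; exact neg_zero.symm))
      exact (key j k 1 _ (Pi.single_eq_same j 0)).trans (by simp [coordIncl])
    rw [hfix, e, hneg] at h
    linarith
  have h2 : m (coordIncl i j (0, y.2)) z = 0 := by
    have h := hm _ (rotElem_mem i j 1 (-1) 1) (coordIncl i j (0, y.2)) z
    have e : linAct (rotElem i j 1 (-1) 1) (coordIncl i j (0, y.2)) = - coordIncl i j (0, y.2) := by
      rw [linAct_rotElem]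
      refine Prod.ext (funext fun k ↦ ?_) (Prod.ext (funext fun k ↦ key' j k y.2) (by
        rw [hIm]; exact neg_zero.symm))
      exact (key i k 1 _ (Pi.single_eq_same i 0)).trans (by simp [coordIncl])
    rw [hfix, e, hneg] at h
    linarith
  have h3 : y = (y.1, 0) + (0, y.2) := by simp
  rw [h3, map_add, hadd, h1, h2, add_zero]

end SpecialElements

/-! ### Invariant metrics in charts -/

section IsotropyDifferential

variable {E : Type} [NormedAddCommGroup E] [NormedSpace ℝ E]
  {M : Type} [TopologicalSpace M] [ChartedSpace E M] {K : Type} [Group K] [MulAction K M]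

/-- If an element of the isotropy group acts by a linear map `A` in a parametrization `ψ`, then `A`
represents its differential. -/
theorem isotropyMap_mfderiv [IsSmoothAction E K M] {ψ : E → M} {z₀ : E}
    (hψ : ContMDiff 𝓘(ℝ, E) 𝓘(ℝ, E) ∞ ψ) (k : MulAction.stabilizer K (ψ z₀)) (A : E →L[ℝ] E)
    (hz : A z₀ = z₀)     (h : ∀ z, ψ (A z) = (k : K) • ψ z) (u : E) :
    isotropyMap (ψ z₀) k (mfderiv 𝓘(ℝ, E) 𝓘(ℝ, E) ψ z₀ u) = mfderiv 𝓘(ℝ, E) 𝓘(ℝ, E) ψ z₀ (A u) := by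
  have hd := hψ.mdifferentiable (by simp)
  have hk : MDifferentiable 𝓘(ℝ, E) 𝓘(ℝ, E) (fun x : M ↦ (k : K) • x) :=
    (IsSmoothAction.contMDiff_smul (E := E) (k : K)).mdifferentiable (by simp)
  have h1 := mk_isotropyMap (E := E) (ψ z₀) k (mfderiv 𝓘(ℝ, E) 𝓘(ℝ, E) ψ z₀ u)
  have h2 : (⟨ψ z₀, mfderiv 𝓘(ℝ, E) 𝓘(ℝ, E) ψ z₀ u⟩ : TangentBundle 𝓘(ℝ, E) M) =
      tangentMap 𝓘(ℝ, E) 𝓘(ℝ, E) ψ ⟨z₀, u⟩ := rfl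
  have h3 : (fun x : M ↦ (k : K) • x) ∘ ψ = ψ ∘ A := funext fun z ↦ (h z).symm
  have hA : MDifferentiable 𝓘(ℝ, E) 𝓘(ℝ, E) A := A.differentiable.mdifferentiable
  have h4 : tangentMap 𝓘(ℝ, E) 𝓘(ℝ, E) A ⟨z₀, u⟩ = ⟨z₀, A u⟩ := by
    have e : tangentMap 𝓘(ℝ, E) 𝓘(ℝ, E) A ⟨z₀, u⟩ = ⟨A z₀, A u⟩ := by
      simp only [tangentMap, mfderiv_eq_fderiv, ContinuousLinearMap.fderiv]
      rfl
    rw [e, hz]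
  rw [h2, ← Function.comp_apply (f := tangentMap 𝓘(ℝ, E) 𝓘(ℝ, E) (fun x : M ↦ (k : K) • x)),
    ← tangentMap_comp hk hd, h3, tangentMap_comp hd hA, Function.comp_apply, h4] at h1
  have h5 : tangentMap 𝓘(ℝ, E) 𝓘(ℝ, E) ψ ⟨z₀, A u⟩ =
    (⟨ψ z₀, mfderiv 𝓘(ℝ, E) 𝓘(ℝ, E) ψ z₀ (A u)⟩ : TangentBundle 𝓘(ℝ, E) M) := rfl
  rw [h5] at h1
  simpa using h1

theorem inner_isotropyMap [IsManifold 𝓘(ℝ, E) ∞ M] (μ : InvariantRiemannianMetric E K M) (p : M)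
    (k : MulAction.stabilizer K p) (v w : TangentSpace 𝓘(ℝ, E) p) :
    μ.inner p (isotropyMap p k v) (isotropyMap p k w) = μ.inner p v w :=
  (inner_tangentCast μ (MulAction.mem_stabilizer_iff.1 k.2) _ _).trans (μ.invariant _ p _ _)

/-- The case of the action of a subgroup `L` of `K`. -/
theorem isotropyMap_subgroup_mfderiv [IsSmoothAction E K M] {ψ : E → M} {z₀ : E}
    (hψ : ContMDiff 𝓘(ℝ, E) 𝓘(ℝ, E) ∞ ψ) {L : Subgroup K} (k : MulAction.stabilizer L (ψ z₀))
    (A : E →L[ℝ] E) (hz : A z₀ = z₀) (h : ∀ z, ψ (A z) = ((k : L) : K) • ψ z) (u : E) :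
    isotropyMap (ψ z₀) k (mfderiv 𝓘(ℝ, E) 𝓘(ℝ, E) ψ z₀ u) = mfderiv 𝓘(ℝ, E) 𝓘(ℝ, E) ψ z₀ (A u) :=
  isotropyMap_mfderiv hψ k A hz h u

/-- If an element of the isotropy group acts by a linear map in a parametrization, this linear map
preserves the pullback of every invariant metric at the fixed point. -/
theorem inner_mfderiv_of_linear [IsSmoothAction E K M] [IsManifold 𝓘(ℝ, E) ∞ M]
    (μ : InvariantRiemannianMetric E K M) {ψ : E → M} {z₀ : E} (hψ : ContMDiff 𝓘(ℝ, E) 𝓘(ℝ, E) ∞ ψ) (k : K)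
    (A : E →L[ℝ] E) (hz : A z₀ = z₀) (h : ∀ z, ψ (A z) = k • ψ z) (u w : E) :
    μ.inner (ψ z₀) (mfderiv 𝓘(ℝ, E) 𝓘(ℝ, E) ψ z₀ (A u)) (mfderiv 𝓘(ℝ, E) 𝓘(ℝ, E) ψ z₀ (A w)) =
      μ.inner (ψ z₀) (mfderiv 𝓘(ℝ, E) 𝓘(ℝ, E) ψ z₀ u) (mfderiv 𝓘(ℝ, E) 𝓘(ℝ, E) ψ z₀ w) := by
  have hk : k • ψ z₀ = ψ z₀ := by rw [← h, hz]
  rw [← isotropyMap_mfderiv hψ ⟨k, hk⟩ A hz h, ← isotropyMap_mfderiv hψ ⟨k, hk⟩ A hz h]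
  exact inner_isotropyMap μ (ψ z₀) ⟨k, hk⟩ _ _

theorem coe_sliceRepresentation [IsSmoothAction E K M] [IsManifold 𝓘(ℝ, E) ∞ M]
    (μ : InvariantRiemannianMetric E K M) (p : M) (k : MulAction.stabilizer K p)
    (v : normalSpace μ p) : (sliceRepresentation μ p k v : TangentSpace 𝓘(ℝ, E) p) =
      isotropyMap p k (v : TangentSpace 𝓘(ℝ, E) p) := rfl

theorem pullback_smul {T : Type} [AddCommGroup T] [Module ℝ T] [TopologicalSpace T]
    [IsTopologicalAddGroup T] [ContinuousSMul ℝ T]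
    (B : T →L[ℝ] T →L[ℝ] ℝ) (D : E →L[ℝ] T) (u w : E) (c : ℝ) :
    B (D (c • u)) (D w) = c * B (D u) (D w) := by
  rw [map_smul, map_smul]; rfl

theorem pullback_add {T : Type} [AddCommGroup T] [Module ℝ T] [TopologicalSpace T]
    [IsTopologicalAddGroup T] [ContinuousSMul ℝ T]
    (B : T →L[ℝ] T →L[ℝ] ℝ) (D : E →L[ℝ] T) (u v w : E) :
    B (D (u + v)) (D w) = B (D u) (D w) + B (D v) (D w) := by
  rw [map_add, map_add]; rfl

end IsotropyDifferential

section MetricForm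

-- Subgroups of `G` act on `G/H` by restriction of the action of `G`. This instance is to be found before
-- the one for the action of a subgroup on left cosets.
attribute [local instance 2000] Subgroup.instMulAction

variable {a b : ℕ}

/-- The pullback of an invariant Riemannian metric by `param g`. -/
noncomputable def metricForm (μ : InvariantRiemannianMetric (ModelSp a b) (SpPair a b) (SpQuot a b))
    (g : SpPair a b) (z u w : ModelSp a b) : ℝ :=
  μ.inner (param g z) (mfderiv 𝓘(ℝ, ModelSp a b) 𝓘(ℝ, ModelSp a b) (param g) z u)
    (mfderiv 𝓘(ℝ, ModelSp a b) 𝓘(ℝ, ModelSp a b) (param g) z w)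

variable (μ : InvariantRiemannianMetric (ModelSp a b) (SpPair a b) (SpQuot a b)) (g : SpPair a b)

theorem continuous_metricForm :
    Continuous fun p : ModelSp a b × ModelSp a b × ModelSp a b ↦ metricForm μ g p.1 p.2.1 p.2.2 :=
  continuous_inner_mfderiv μ.toContMDiffRiemannianMetric (contMDiff_param g)

theorem metricForm_smul (z u w : ModelSp a b) (c : ℝ) :
    metricForm μ g z (c • u) w = c * metricForm μ g z u w :=
  pullback_smul (μ.inner (param g z)) (mfderiv 𝓘(ℝ, ModelSp a b) 𝓘(ℝ, ModelSp a b) (param g) z) u w c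

theorem metricForm_add (z u v w : ModelSp a b) :
    metricForm μ g z (u + v) w = metricForm μ g z u w + metricForm μ g z v w :=
  pullback_add (μ.inner (param g z)) (mfderiv 𝓘(ℝ, ModelSp a b) 𝓘(ℝ, ModelSp a b) (param g) z) u v w

theorem metricForm_symm (z u w : ModelSp a b) : metricForm μ g z u w = metricForm μ g z w u :=
  μ.symm _ _ _

theorem metricForm_pos (u : ModelSp a b) (hu : u ≠ 0) : 0 < metricForm μ g 0 u u :=
  μ.pos _ _ fun h ↦ hu ((paramDeriv_bijective g).1 (h.trans (map_zero _).symm))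

theorem smul_param_zero {h : SpPair a b} (hh : h ∈ SpSub a b) :
    (g * h * g⁻¹) • param g 0 = param g 0 := by
  rw [← param_linAct hh, map_zero]

/-- At `g H`, the element `g h g⁻¹` of the isotropy group acts through the linear isotropy
representation of `h`. -/
theorem isotropyMap_paramDeriv {L : Subgroup (SpPair a b)} {h : SpPair a b} (hh : h ∈ SpSub a b)
    (k : MulAction.stabilizer L (param g 0)) (hk : ((k : L) : SpPair a b) = g * h * g⁻¹)
    (u : ModelSp a b) :
    isotropyMap (param g 0) k (paramDeriv g u) = paramDeriv g (linAct h u) := by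
  refine isotropyMap_subgroup_mfderiv (contMDiff_param g) k
    (LinearMap.toContinuousLinearMap (linAct h)) (map_zero (linAct h)) (fun z ↦ ?_) u
  rw [hk]
  exact param_linAct hh g z

theorem metricForm_linAct {h : SpPair a b} (hh : h ∈ SpSub a b) (u w : ModelSp a b) :
    metricForm μ g 0 (linAct h u) (linAct h w) = metricForm μ g 0 u w := by
  exact inner_mfderiv_of_linear μ (contMDiff_param g) (g * h * g⁻¹)
    (LinearMap.toContinuousLinearMap (linAct h)) (map_zero (linAct h)) (fun z ↦ param_linAct hh g z) u w

/-- The coordinates `i` and `j` are orthogonal to the others. -/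
theorem metricForm_coordIncl {i : Fin a} {j : Fin b} (y : ℍ[ℝ] × ℍ[ℝ]) {z : ModelSp a b}
    (hz : coordProj i j z = 0) : metricForm μ g 0 (coordIncl i j y) z = 0 := by
  refine eq_zero_of_invariant (m := metricForm μ g 0) (metricForm_add μ g 0) (fun u w ↦ ?_)
    (fun h hh ↦ metricForm_linAct μ g hh) y hz
  rw [← neg_one_smul ℝ u, metricForm_smul, neg_one_mul]

end MetricForm

/-! ### The orbit of the special point -/

section Orbit

attribute [local instance 2000] Subgroup.instMulAction

variable {a b : ℕ} (i : Fin a) (j : Fin b)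

/-- In the coordinates around the special point, the points whose coordinates `i` and `j` vanish
lie in its orbit: the transposition conjugates their lifts to `G` into `H`. -/
theorem param_swapPair_mem_orbit {z : ModelSp a b} (hz : coordProj i j z = 0) :
    param (swapPair i j) z ∈ MulAction.orbit (SpSub a b) (param (swapPair i j) 0) := by
  have hz1 : z.1 i = 0 := congrArg Prod.fst hz
  have hz2 : z.2.1 j = 0 := congrArg Prod.snd hz
  have key {n : ℕ} (i : Fin n) (x : Fin n → ℍ[ℝ]) (hx : x i = 0) (k : Fin n ⊕ Fin 1) :
      rotMat x k (Sum.inl i) = (1 : Matrix (Fin n ⊕ Fin 1) (Fin n ⊕ Fin 1) ℍ[ℝ]) k (Sum.inl i) := by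
    rcases k with k | k
    · simp [rotMat, Matrix.mul_apply, hx, Matrix.one_apply]
    · simp [rotMat, hx]
  have hk : swapPair i j * baseSection z * (swapPair i j)⁻¹ ∈ SpSub a b := by
    have e1 (x) : (swapPair i j * baseSection z * (swapPair i j)⁻¹).val.1 x lst =
        (1 : Matrix (Fin a ⊕ Fin 1) (Fin a ⊕ Fin 1) ℍ[ℝ]) x lst := by
      rw [swapPair_conj_fst, Equiv.swap_apply_right, baseSection_fst_inl, key i _ hz1,
        Matrix.one_apply, Matrix.one_apply]
      simp only [Equiv.swap_apply_eq_iff, Equiv.swap_apply_left]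
    have e2 (x) : (swapPair i j * baseSection z * (swapPair i j)⁻¹).val.2 x lst =
        (1 : Matrix (Fin b ⊕ Fin 1) (Fin b ⊕ Fin 1) ℍ[ℝ]) x lst := by
      rw [swapPair_conj_snd, Equiv.swap_apply_right, baseSection_snd, key j _ hz2,
        Matrix.one_apply, Matrix.one_apply]
      simp only [Equiv.swap_apply_eq_iff, Equiv.swap_apply_left]
    refine mem_SpSub_of_entries (fun k ↦ ?_) (fun k ↦ ?_) ?_
    · rw [e1]; simp
    · rw [e2]; simp
    · rw [e1, e2]; simp
  refine ⟨⟨_, hk⟩, ?_⟩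
  change (swapPair i j * baseSection z * (swapPair i j)⁻¹) • param (swapPair i j) 0 = _
  rw [param_zero]
  change ((swapPair i j * baseSection z * (swapPair i j)⁻¹ * swapPair i j : SpPair a b) : SpQuot a b) = _
  rw [inv_mul_cancel_right]
  rfl

/-- Conversely, the coordinates `i` and `j` vanish on the orbit. -/
theorem coordProj_paramChart_of_mem_orbit {x : SpQuot a b}
    (hx : x ∈ MulAction.orbit (SpSub a b) (param (swapPair i j) 0)) :
    coordProj i j (paramChart (swapPair i j) x) = 0 := by
  obtain ⟨⟨h, hh⟩, rfl⟩ := hx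
  obtain ⟨-, h2, -, h4, -, -⟩ := entries_of_mem hh
  rw [param_zero]
  change coordProj i j (paramChart (swapPair i j) ((h * swapPair i j : SpPair a b) : SpQuot a b)) = 0
  rw [paramChart_mk]
  have e : (swapPair i j)⁻¹ * (h * swapPair i j) = swapPair i j * h * (swapPair i j)⁻¹ := by
    rw [swapPair_inv, mul_assoc]
  rw [e]
  refine Prod.ext ?_ ?_
  · change (swapPair i j * h * (swapPair i j)⁻¹).val.1 (Sum.inl i) lst * _ = 0
    rw [swapPair_conj_fst, Equiv.swap_apply_left, Equiv.swap_apply_right, h2, zero_mul]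
  · change (swapPair i j * h * (swapPair i j)⁻¹).val.2 (Sum.inl j) lst * _ = 0
    rw [swapPair_conj_snd, Equiv.swap_apply_left, Equiv.swap_apply_right, h4, zero_mul]

theorem smul_mem_curveVelocities {E : Type} [NormedAddCommGroup E] [NormedSpace ℝ E] {S : Set E}
    {u : E} (h : ∀ t : ℝ, t • u ∈ S) : u ∈ curveVelocities S 0 := by
  refine ⟨fun t ↦ t • u, contDiff_id.smul contDiff_const, h, zero_smul _ _, ?_⟩
  simpa using (hasDerivAt_id (0 : ℝ)).smul_const u

/-- The tangent space of the orbit of the special point. -/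
theorem paramDeriv_mem_tangentVectors_iff (z : ModelSp a b) :
    paramDeriv (swapPair i j) z ∈ tangentVectors
      (MulAction.orbit (SpSub a b) (param (swapPair i j) 0)) (param (swapPair i j) 0) ↔
      coordProj i j z = 0 := by
  set g := swapPair i j with hg
  constructor
  · rintro ⟨γ, hγ, hS, hv⟩
    let F : SpQuot a b → ℍ[ℝ] × ℍ[ℝ] := fun x ↦ coordProj i j (paramChart g x)
    let pr : ModelSp a b →L[ℝ] ℍ[ℝ] × ℍ[ℝ] := LinearMap.toContinuousLinearMap (coordProj i j)
    have h0 : γ 0 = param g 0 := congrArg Bundle.TotalSpace.proj hv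
    have hsrc : param g 0 ∈ (paramChart g).source := by
      rw [← paramChart_symm]
      exact (paramChart g).map_target (by rw [paramChart_target]; trivial)
    have hF : MDifferentiableAt 𝓘(ℝ, ModelSp a b) 𝓘(ℝ, ℍ[ℝ] × ℍ[ℝ]) F (param g 0) := by
      refine MDifferentiableAt.comp (I' := 𝓘(ℝ, ModelSp a b)) (param g 0)
        (g := pr) pr.differentiableAt.mdifferentiableAt ?_
      exact ((contMDiffOn_of_mem_maximalAtlas (paramChart_mem_maximalAtlas g)).contMDiffAt
        ((paramChart g).open_source.mem_nhds hsrc)).mdifferentiableAt (by simp)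
    have h1 : tangentMap 𝓘(ℝ, ModelSp a b) 𝓘(ℝ, ℍ[ℝ] × ℍ[ℝ]) F ⟨param g 0, paramDeriv g z⟩ =
        ⟨0, (0 : ℍ[ℝ] × ℍ[ℝ])⟩ := by
      rw [← hv, ← tangentMap_comp_at _ (by rw [h0]; exact hF) (hγ.mdifferentiable (by simp) _)]
      have : F ∘ γ = fun _ ↦ 0 := funext fun t ↦ coordProj_paramChart_of_mem_orbit i j (hS t)
      rw [this]
      simp only [tangentMap, mfderiv_const]
      rfl
    have h2 : F ∘ param g = pr := by
      funext w
      change coordProj i j (paramChart g (param g w)) = coordProj i j w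
      rw [← paramChart_symm, (paramChart g).right_inv (by rw [paramChart_target]; trivial)]
    have h3 : tangentMap 𝓘(ℝ, ModelSp a b) 𝓘(ℝ, ℍ[ℝ] × ℍ[ℝ]) F ⟨param g 0, paramDeriv g z⟩ =
        tangentMap 𝓘(ℝ, ModelSp a b) 𝓘(ℝ, ℍ[ℝ] × ℍ[ℝ]) (F ∘ param g) ⟨0, z⟩ :=
      (tangentMap_comp_at (⟨0, z⟩ : TangentBundle 𝓘(ℝ, ModelSp a b) (ModelSp a b)) hF
        ((contMDiff_param g).mdifferentiable (by simp) _)).symm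
    have h4 : tangentMap 𝓘(ℝ, ModelSp a b) 𝓘(ℝ, ℍ[ℝ] × ℍ[ℝ]) pr ⟨0, z⟩ =
        (⟨pr 0, pr z⟩ : TangentBundle 𝓘(ℝ, ℍ[ℝ] × ℍ[ℝ]) (ℍ[ℝ] × ℍ[ℝ])) := by
      simp only [tangentMap, mfderiv_eq_fderiv, ContinuousLinearMap.fderiv]
      rfl
    rw [h3, h2, h4, map_zero] at h1
    exact eq_of_heq (Bundle.TotalSpace.mk.inj h1).2
  · intro hz
    refine mfderiv_mem_tangentVectors (contMDiff_param g) (smul_mem_curveVelocities fun t ↦ ?_)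
    exact param_swapPair_mem_orbit i j (by rw [map_smul, hz, smul_zero])

end Orbit

/-! ### The slice representation at the special point -/

section SliceRepresentation

attribute [local instance 2000] Subgroup.instMulAction

variable {a b : ℕ}

/-- The projection of `H` to its factor `Sp(1)`. -/
noncomputable def lastEntry : SpSub a b →* unitary ℍ[ℝ] where
  toFun h := toUnitary (h.1.val.1 lst lst) (entries_of_mem h.2).2.2.2.2.2
  map_one' := Subtype.ext (Matrix.one_apply_eq lst)
  map_mul' h k := Subtype.ext <| by
    change (h.1.val.1 * k.1.val.1) lst lst = h.1.val.1 lst lst * k.1.val.1 lst lst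
    simp [Matrix.mul_apply, Fintype.sum_sum_type, (entries_of_mem h.2).2.1]

theorem continuous_lastEntry : Continuous (lastEntry (a := a) (b := b)) := by
  have h : Continuous fun h : SpSub a b ↦ h.1.1.1 :=
    continuous_subtype_val.comp (continuous_fst.comp continuous_subtype_val)
  exact (h.matrix_elem lst lst).subtype_mk _

theorem inv_mul_mul_mem {g k : SpPair a b} (hk : k • param g 0 = param g 0) :
    g⁻¹ * k * g ∈ SpSub a b := by
  rw [param_zero] at hk
  have : g⁻¹ * (k * g) ∈ SpSub a b :=
    QuotientGroup.eq.1 (hk.symm : (g : SpQuot a b) = (k * g : SpPair a b))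
  rwa [← mul_assoc] at this

/-- Conjugation by `g⁻¹` as a homomorphism into `H` of the isotropy group at the point `g H`. -/
noncomputable def stabilizerConj (g : SpPair a b) :
    MulAction.stabilizer (SpSub a b) (param g 0) →* SpSub a b :=
  (((MulAut.conj g⁻¹).toMonoidHom.comp (SpSub a b).subtype).comp
    (MulAction.stabilizer (SpSub a b) (param g 0)).subtype).codRestrict (SpSub a b) fun k ↦ by
      have := inv_mul_mul_mem (g := g) (k := k.1.1) (MulAction.mem_stabilizer_iff.1 k.2)
      simpa using this

theorem coe_stabilizerConj (g : SpPair a b) (k : MulAction.stabilizer (SpSub a b) (param g 0)) :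
    (stabilizerConj g k : SpPair a b) = g⁻¹ * k.1.1 * g := by
  simp [stabilizerConj]

/-- The homomorphism to `SO(4)` of the isotropy group at the special point. The elements of this group
have two blocks of size one in each factor, the same ones in both factors; they act on the quaternions by
left and right multiplications. -/
noncomputable def sliceHom (i : Fin a) (j : Fin b) :
    MulAction.stabilizer (SpSub a b) (param (swapPair i j) 0) →*
      Matrix.specialOrthogonalGroup (Fin 4) ℝ :=
  quatRotation.comp ((lastEntry.comp (Subgroup.subtype _)).prod
    (lastEntry.comp (stabilizerConj (swapPair i j))))

theorem sliceHom_apply (i : Fin a) (j : Fin b)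
    (k : MulAction.stabilizer (SpSub a b) (param (swapPair i j) 0)) :
    sliceHom i j k = quatRotation (lastEntry k.1, lastEntry (stabilizerConj (swapPair i j) k)) := rfl

theorem continuous_sliceHom (i : Fin a) (j : Fin b) : Continuous (sliceHom i j) := by
  have h1 : Continuous (stabilizerConj (swapPair i j)) := by
    refine continuous_induced_rng.2 ?_
    have : (Subtype.val ∘ stabilizerConj (swapPair i j)) =
        fun k ↦ (swapPair i j)⁻¹ * k.1.1 * swapPair i j :=
      funext fun k ↦ coe_stabilizerConj _ k
    rw [this]
    exact (continuous_const.mul (continuous_subtype_val.comp continuous_subtype_val)).mul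
      continuous_const
  exact continuous_quatRotation.comp
    ((continuous_lastEntry.comp continuous_subtype_val).prodMk (continuous_lastEntry.comp h1))

theorem sliceHom_surjective (i : Fin a) (j : Fin b) : Function.Surjective (sliceHom i j) := by
  intro A
  obtain ⟨⟨q, r⟩, rfl⟩ := quatRotation_surjective A
  have hc := swapPair_conj_rotElem i j q r
  have hk : rotElem i j r r q • param (swapPair i j) 0 = param (swapPair i j) 0 := by
    rw [← hc]
    exact smul_param_zero _ (rotElem_mem i j q q r)
  refine ⟨⟨⟨rotElem i j r r q, rotElem_mem i j r r q⟩, hk⟩, ?_⟩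
  rw [sliceHom_apply]
  congr 2
  refine Subtype.ext ?_
  change (stabilizerConj (swapPair i j) _ : SpPair a b).val.1 lst lst = r
  rw [coe_stabilizerConj]
  change ((swapPair i j)⁻¹ * rotElem i j r r q * swapPair i j).val.1 lst lst = r
  rw [← hc, mul_assoc (swapPair i j), inv_mul_cancel_left, inv_mul_cancel_right]
  rfl

/-- An element of `H` which remains in `H` under conjugation by the transposition fixes the coordinates
`i` and `j`, and acts on them by a rotation. -/
theorem linAct_coordIncl (i : Fin a) (j : Fin b) {h k : SpSub a b}
    (hk : (k : SpPair a b) = swapPair i j * h * (swapPair i j)⁻¹) (y : ℍ[ℝ] × ℍ[ℝ]) :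
    linAct (h : SpPair a b) (coordIncl i j y) =
      coordIncl i j (pairRotation (lastEntry k) (lastEntry h) y) := by
  obtain ⟨-, -, -, -, h5, -⟩ := entries_of_mem h.2
  obtain ⟨k1, -, k3, -, k5, -⟩ := entries_of_mem k.2
  have key {n : ℕ} (i : Fin n) (A B : Matrix (Fin n ⊕ Fin 1) (Fin n ⊕ Fin 1) ℍ[ℝ])
      (hAB : ∀ x y, B x y = A (Equiv.swap (Sum.inl i) lst x) (Equiv.swap (Sum.inl i) lst y))
      (hB : ∀ l, B (Sum.inl l) lst = 0) (x s : ℍ[ℝ]) (l : Fin n) :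
      ∑ m, A (Sum.inl l) (Sum.inl m) * (Pi.single i x : Fin n → ℍ[ℝ]) m * s =
        (Pi.single i (B lst lst * x * s) : Fin n → ℍ[ℝ]) l := by
    rw [Finset.sum_eq_single i (fun m _ hm ↦ by rw [Pi.single_eq_of_ne hm, mul_zero, zero_mul])
      (by simp), Pi.single_eq_same]
    rcases eq_or_ne l i with rfl | hl
    · rw [Pi.single_eq_same, hAB, Equiv.swap_apply_right]
    · have := hB l
      rw [hAB, Equiv.swap_apply_right, Equiv.swap_apply_of_ne_of_ne (by simpa using hl) (by simp)]
        at this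
      rw [this, Pi.single_eq_of_ne hl, zero_mul, zero_mul]
  have e1 (x y) : k.1.val.1 x y = h.1.val.1 (Equiv.swap (Sum.inl i) lst x)
      (Equiv.swap (Sum.inl i) lst y) := by rw [hk, swapPair_conj_fst]
  have e2 (x y) : k.1.val.2 x y = h.1.val.2 (Equiv.swap (Sum.inl j) lst x)
      (Equiv.swap (Sum.inl j) lst y) := by rw [hk, swapPair_conj_snd]
  rw [linAct_apply]
  refine Prod.ext (funext fun l ↦ key i _ _ e1 k1 y.1 _ l) (Prod.ext (funext fun l ↦ ?_) ?_)
  · refine (key j _ _ e2 k3 y.2 _ l).trans ?_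
    rw [k5, h5]
    rfl
  · change imCoord (_ * ofIm 0 * _) = 0
    rw [map_zero, mul_zero, zero_mul, map_zero]

variable (μ : InvariantRiemannianMetric (ModelSp a b) (SpPair a b) (SpQuot a b))

theorem paramDeriv_coordIncl_mem_normalSpace (i : Fin a) (j : Fin b) (y : ℍ[ℝ] × ℍ[ℝ]) :
    paramDeriv (swapPair i j) (coordIncl i j y) ∈
      normalSpace (μ.restrict (SpSub a b)) (param (swapPair i j) 0) := by
  intro u hu
  obtain ⟨z, rfl⟩ := (paramDeriv_bijective (swapPair i j)).2 u
  change metricForm μ (swapPair i j) 0 z (coordIncl i j y) = 0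
  rw [metricForm_symm]
  exact metricForm_coordIncl μ _ y ((paramDeriv_mem_tangentVectors_iff i j z).1 hu)

/-- The part of a normal vector outside the coordinates `i` and `j` is tangent to the orbit, and
orthogonal to itself. -/
theorem exists_of_mem_normalSpace (i : Fin a) (j : Fin b)
    {v : TangentSpace 𝓘(ℝ, ModelSp a b) (param (swapPair i j) 0)}
    (hv : v ∈ normalSpace (μ.restrict (SpSub a b)) (param (swapPair i j) 0)) :
    ∃ y, paramDeriv (swapPair i j) (coordIncl i j y) = v := by
  obtain ⟨z, rfl⟩ := (paramDeriv_bijective (swapPair i j)).2 v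
  refine ⟨coordProj i j z, congrArg _ ?_⟩
  set w := coordIncl i j (coordProj i j z) with hw
  have hp : coordProj i j (z - w) = 0 := by
    rw [map_sub, hw, coordProj_coordIncl, sub_self]
  have h1 : metricForm μ (swapPair i j) 0 (z - w) z = 0 :=
    hv _ ((paramDeriv_mem_tangentVectors_iff i j (z - w)).2 hp)
  have h2 : metricForm μ (swapPair i j) 0 w (z - w) = 0 := metricForm_coordIncl μ _ _ hp
  by_contra hne
  refine (metricForm_pos μ (swapPair i j) (z - w) (sub_ne_zero.2 (Ne.symm hne))).ne' ?_
  have h3 : metricForm μ (swapPair i j) 0 z (z - w) =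
      metricForm μ (swapPair i j) 0 (z - w) (z - w) + metricForm μ (swapPair i j) 0 w (z - w) := by
    rw [← metricForm_add, sub_add_cancel]
  rw [metricForm_symm, h2, h1, add_zero] at h3
  exact h3.symm

/-- The coordinates `i` and `j` parametrize the normal space at the special point. -/
noncomputable def normalEquiv (i : Fin a) (j : Fin b) : (ℍ[ℝ] × ℍ[ℝ]) ≃ₗ[ℝ]
    normalSpace (μ.restrict (SpSub a b)) (param (swapPair i j) 0) :=
  LinearEquiv.ofBijective (LinearMap.codRestrict _
    ((paramDeriv (swapPair i j)).toLinearMap.comp (coordIncl i j))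
    (paramDeriv_coordIncl_mem_normalSpace μ i j)) ⟨fun y y' h ↦ by
      have h1 := (paramDeriv_bijective (swapPair i j)).1 (congrArg Subtype.val h)
      rw [← coordProj_coordIncl i j y, h1, coordProj_coordIncl], fun v ↦ by
      obtain ⟨y, hy⟩ := exists_of_mem_normalSpace μ i j v.2
      exact ⟨y, Subtype.ext hy⟩⟩

theorem coe_normalEquiv (i : Fin a) (j : Fin b) (y : ℍ[ℝ] × ℍ[ℝ]) :
    (normalEquiv μ i j y : TangentSpace 𝓘(ℝ, ModelSp a b) (param (swapPair i j) 0)) =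
      paramDeriv (swapPair i j) (coordIncl i j y) := rfl

theorem sliceRepresentation_normalEquiv (i : Fin a) (j : Fin b)
    (k : MulAction.stabilizer (SpSub a b) (param (swapPair i j) 0)) (y : ℍ[ℝ] × ℍ[ℝ]) :
    sliceRepresentation (μ.restrict (SpSub a b)) (param (swapPair i j) 0) k (normalEquiv μ i j y) =
      normalEquiv μ i j (pairRotation (lastEntry k.1)
        (lastEntry (stabilizerConj (swapPair i j) k)) y) := by
  have hk : (k.1 : SpPair a b) =
      swapPair i j * stabilizerConj (swapPair i j) k * (swapPair i j)⁻¹ := by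
    rw [coe_stabilizerConj]
    simp only [mul_assoc, mul_inv_cancel_left, mul_inv_cancel, mul_one]
  refine Subtype.ext ?_
  rw [coe_sliceRepresentation, coe_normalEquiv, coe_normalEquiv, ← linAct_coordIncl i j hk]
  exact isotropyMap_paramDeriv _ (stabilizerConj (swapPair i j) k).2 k hk (coordIncl i j y)

/-- The slice representation at the special point. -/
theorem sliceRepresentation_equiv (i : Fin a) (j : Fin b)
    (k : MulAction.stabilizer (SpSub a b) (param (swapPair i j) 0))
    (v : normalSpace (μ.restrict (SpSub a b)) (param (swapPair i j) 0)) :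
    (normalEquiv μ i j).symm.trans pairTuple
        (sliceRepresentation (μ.restrict (SpSub a b)) (param (swapPair i j) 0) k v) =
      doubleStdRep (sliceHom i j k) ((normalEquiv μ i j).symm.trans pairTuple v) := by
  obtain ⟨y, rfl⟩ := (normalEquiv μ i j).surjective v
  rw [sliceRepresentation_normalEquiv, LinearEquiv.trans_apply, LinearEquiv.trans_apply,
    LinearEquiv.symm_apply_apply, LinearEquiv.symm_apply_apply, sliceHom_apply]
  exact (doubleStdRep_quatRotation _ _ _).symm

end SliceRepresentation

/-! ### A section has dimension at least three -/

section LowerBound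

variable {a b : ℕ}

/-- The rows of a unitary matrix are unit vectors. -/
theorem norm_entry_le_one {n : Type} [Fintype n] [DecidableEq n] (A : Sp n) (i j : n) :
    ‖A.1 i j‖ ≤ 1 := by
  have h := congrFun (congrFun (Unitary.mem_iff.1 A.2).2 i) i
  have h3 : ∑ k, Quaternion.normSq (A.1 i k) = 1 := by
    rw [Matrix.mul_apply, Matrix.one_apply_eq] at h
    have h2 := congrArg reCoord h
    rw [map_sum] at h2
    refine (Finset.sum_congr rfl fun k _ ↦ ?_).trans h2
    change _ = reCoord (A.1 i k * star (A.1 i k))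
    rw [Quaternion.self_mul_star]
    rfl
  have h4 : Quaternion.normSq (A.1 i j) ≤ 1 := by
    rw [← h3]
    exact Finset.single_le_sum (fun k _ ↦ Quaternion.normSq_nonneg) (Finset.mem_univ j)
  rw [Quaternion.normSq_eq_norm_mul_self] at h4
  nlinarith [norm_nonneg (A.1 i j)]

/-- The linear isotropy representation is bounded. -/
theorem exists_norm_linAct_le (a b : ℕ) : ∃ C : ℝ, 0 < C ∧ ∀ h ∈ SpSub a b, ∀ z : ModelSp a b,
    ‖linAct h z‖ ≤ C * ‖z‖ := by
  let f : ℍ[ℝ] →L[ℝ] (Fin 3 → ℝ) := LinearMap.toContinuousLinearMap imCoord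
  let f' : (Fin 3 → ℝ) →L[ℝ] ℍ[ℝ] := LinearMap.toContinuousLinearMap ofIm
  refine ⟨a + b + ‖f‖ * ‖f'‖ + 1, by positivity, fun h hh z ↦ ?_⟩
  obtain ⟨-, -, -, -, h5, h6⟩ := entries_of_mem hh
  have key {n : ℕ} (A : Sp (Fin n ⊕ Fin 1)) (x : Fin n → ℍ[ℝ]) {s : ℍ[ℝ]} (hs : ‖s‖ = 1) (k : Fin n) :
      ‖∑ l, A.1 (Sum.inl k) (Sum.inl l) * x l * star s‖ ≤ n * ‖x‖ := by
    refine (norm_sum_le _ _).trans ?_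
    refine (Finset.sum_le_sum (g := fun _ ↦ ‖x‖) fun l _ ↦ ?_).trans (by simp)
    rw [norm_mul, norm_mul, norm_star, hs, mul_one]
    calc _ ≤ 1 * ‖x‖ := by gcongr; exacts [norm_entry_le_one A _ _, norm_le_pi_norm x l]
      _ = ‖x‖ := one_mul _
  have hz1 : ‖z.1‖ ≤ ‖z‖ := norm_fst_le z
  have hz2 : ‖z.2.1‖ ≤ ‖z‖ := (norm_fst_le z.2).trans (norm_snd_le z)
  have hz3 : ‖z.2.2‖ ≤ ‖z‖ := (norm_snd_le z.2).trans (norm_snd_le z)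
  have hf : 0 ≤ ‖f‖ * ‖f'‖ := by positivity
  have hz := norm_nonneg z
  have ha : (0 : ℝ) ≤ a := by positivity
  have hb : (0 : ℝ) ≤ b := by positivity
  rw [linAct_apply]
  refine norm_prod_le_iff.2 ⟨?_, norm_prod_le_iff.2 ⟨?_, ?_⟩⟩
  · refine (pi_norm_le_iff_of_nonneg (by positivity)).2 fun k ↦ (key h.1 z.1 h6 k).trans ?_
    nlinarith [mul_nonneg hf hz, mul_nonneg hb hz, mul_le_mul_of_nonneg_left hz1 ha]
  · refine (pi_norm_le_iff_of_nonneg (by positivity)).2 fun k ↦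
      (key h.2 z.2.1 (s := h.val.2 lst lst) (by rw [h5, h6]) k).trans ?_
    nlinarith [mul_nonneg hf hz, mul_nonneg ha hz, mul_le_mul_of_nonneg_left hz2 hb]
  · have h1 : ‖imCoord (h.val.1 lst lst * ofIm z.2.2 * star (h.val.1 lst lst))‖ ≤
        ‖f‖ * (‖f'‖ * ‖z.2.2‖) := by
      refine (f.le_opNorm _).trans ?_
      gcongr
      rw [norm_mul, norm_mul, norm_star, h6, one_mul, mul_one]
      exact f'.le_opNorm _
    refine h1.trans ?_
    rw [← mul_assoc]
    nlinarith [mul_nonneg ha hz, mul_nonneg hb hz, mul_le_mul_of_nonneg_left hz3 hf]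

theorem param_injective (g : SpPair a b) : Function.Injective (param g) := by
  intro z w h
  rw [← paramChart_symm] at h
  exact (paramChart g).symm.injOn (by simp [paramChart_target]) (by simp [paramChart_target]) h

theorem linAct_ne_zero {h : SpPair a b} (hh : h ∈ SpSub a b) {z : ModelSp a b} (hz : z ≠ 0) :
    linAct h z ≠ 0 := by
  intro h0
  have h1 := param_linAct hh 1 z
  have h2 := param_linAct hh 1 (0 : ModelSp a b)
  rw [h0] at h1
  rw [map_zero] at h2
  exact hz (param_injective 1 (smul_left_cancel _ (h1.symm.trans h2)))

theorem isSubmanifoldAtZero_param {S : Set (SpQuot a b)} {k : ℕ}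
    (hS : IsEmbeddedSubmanifold (ModelSp a b) k S) (g : SpPair a b) (h0 : param g 0 ∈ S) :
    IsSubmanifoldAtZero k (param g ⁻¹' S) := by
  have := IsEmbeddedSubmanifold.isSubmanifoldAtZero hS (paramChart_mem_maximalAtlas g) (paramChart_target g)
    (by rw [paramChart_symm]; exact h0)
  rwa [paramChart_symm] at this

/-- A submanifold which meets all orbits contains the base point, and its tangent space there meets each
closed cone which is invariant under the linear isotropy representation. The three isotypic components
are such cones. -/
theorem three_le_of_meets_orbits (i : Fin a) (j : Fin b) {S : Set (SpQuot a b)} {k : ℕ}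
    (hS : IsEmbeddedSubmanifold (ModelSp a b) k S)
    (hmeet : ∀ x : SpQuot a b, ∃ h ∈ SpSub a b, h • x ∈ S) : 3 ≤ k := by
  have hmeet' (z : ModelSp a b) : ∃ h ∈ SpSub a b, linAct h z ∈ param 1 ⁻¹' S := by
    obtain ⟨h, hh, hz⟩ := hmeet (param 1 z)
    refine ⟨h, hh, ?_⟩
    rw [Set.mem_preimage, param_linAct hh, one_mul, inv_one, mul_one]
    exact hz
  have h0 : param (1 : SpPair a b) 0 ∈ S := by
    obtain ⟨h, hh, h0⟩ := hmeet' 0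
    rwa [map_zero] at h0
  obtain ⟨F, hF, -, hcone, -⟩ := (isSubmanifoldAtZero_param hS 1 h0).exists_tangentSpace
  obtain ⟨C₀, hC₀, hbound⟩ := exists_norm_linAct_le a b
  have hc (C : Set (ModelSp a b)) (hC : IsClosed C) (hCs : ∀ c ∈ C, ∀ r : ℝ, r • c ∈ C)
      (hCl : ∀ c ∈ C, ∀ h, linAct h c ∈ C) {v : ModelSp a b} (hv : v ∈ C) (hv0 : v ≠ 0) :
      ∃ c ∈ F, c ∈ C ∧ c ≠ 0 := by
    refine hcone C hC (fun c hc r _ ↦ hCs c hc r) fun ε hε ↦ ?_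
    -- a multiple of `v` so small that its orbit stays in the ball of radius `ε`
    have hd : 0 < C₀ * ‖v‖ + 1 := by positivity
    have hr : 0 < ε / (C₀ * ‖v‖ + 1) := by positivity
    obtain ⟨h, hh, hz⟩ := hmeet' ((ε / (C₀ * ‖v‖ + 1)) • v)
    refine ⟨_, hz, hCl _ (hCs _ hv _) h, linAct_ne_zero hh (smul_ne_zero hr.ne' hv0), ?_⟩
    refine (hbound h hh _).trans_lt ?_
    rw [norm_smul, Real.norm_eq_abs, abs_of_pos hr]
    calc C₀ * (ε / (C₀ * ‖v‖ + 1) * ‖v‖) = ε / (C₀ * ‖v‖ + 1) * (C₀ * ‖v‖) := by ring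
      _ < ε / (C₀ * ‖v‖ + 1) * (C₀ * ‖v‖ + 1) := by gcongr; linarith
      _ = ε := div_mul_cancel₀ _ hd.ne'
  obtain ⟨⟨x, y₁, c₁⟩, hx, ⟨(hy₁ : y₁ = 0), (hc₁ : c₁ = 0)⟩, hx0⟩ := hc {z | z.2.1 = 0 ∧ z.2.2 = 0}
    ((isClosed_eq (by fun_prop) continuous_const).inter (isClosed_eq (by fun_prop) continuous_const))
    (fun c hc r ↦ ⟨smul_eq_zero_of_right r hc.1, smul_eq_zero_of_right r hc.2⟩)
    (fun c hc h ↦ by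
      rw [linAct_apply, hc.1, hc.2]
      exact ⟨funext fun k ↦ by simp, by simp⟩) (v := (Pi.single i 1, 0, 0)) ⟨rfl, rfl⟩ (by simp)
  obtain ⟨⟨x₂, y, c₂⟩, hy, ⟨(hx₂ : x₂ = 0), (hc₂ : c₂ = 0)⟩, hy0⟩ := hc {z | z.1 = 0 ∧ z.2.2 = 0}
    ((isClosed_eq (by fun_prop) continuous_const).inter (isClosed_eq (by fun_prop) continuous_const))
    (fun c hc r ↦ ⟨smul_eq_zero_of_right r hc.1, smul_eq_zero_of_right r hc.2⟩)
    (fun c hc h ↦ by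
      rw [linAct_apply, hc.1, hc.2]
      exact ⟨funext fun k ↦ by simp, by simp⟩) (v := (0, Pi.single j 1, 0)) ⟨rfl, rfl⟩ (by simp)
  obtain ⟨⟨x₃, y₃, c⟩, hcF, ⟨(hx₃ : x₃ = 0), (hy₃ : y₃ = 0)⟩, hc0⟩ := hc {z | z.1 = 0 ∧ z.2.1 = 0}
    ((isClosed_eq (by fun_prop) continuous_const).inter (isClosed_eq (by fun_prop) continuous_const))
    (fun c hc r ↦ ⟨smul_eq_zero_of_right r hc.1, smul_eq_zero_of_right r hc.2⟩)
    (fun c hc h ↦ by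
      rw [linAct_apply, hc.1, hc.2]
      exact ⟨funext fun k ↦ by simp, funext fun k ↦ by simp⟩)
    (v := (0, 0, fun _ ↦ 1)) ⟨rfl, rfl⟩ (by
      intro h
      have := congrFun (congrArg (fun z : ModelSp a b ↦ z.2.2) h) 0
      simp at this)
  subst hy₁ hc₁ hx₂ hc₂ hx₃ hy₃
  have hx0' : x ≠ 0 := by rintro rfl; exact hx0 rfl
  have hy0' : y ≠ 0 := by rintro rfl; exact hy0 rfl
  have hc0' : c ≠ 0 := by rintro rfl; exact hc0 rfl
  have hli : LinearIndependent ℝ ![(⟨(x, 0, 0), hx⟩ : F), ⟨(0, y, 0), hy⟩, ⟨(0, 0, c), hcF⟩] := by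
    rw [Fintype.linearIndependent_iff]
    intro r hr
    rw [Fin.sum_univ_three] at hr
    have h := congrArg Subtype.val hr
    have h1 : r 0 • x + r 1 • (0 : Fin a → ℍ[ℝ]) + r 2 • (0 : Fin a → ℍ[ℝ]) = 0 := congrArg Prod.fst h
    have h2 : r 0 • (0 : Fin b → ℍ[ℝ]) + r 1 • y + r 2 • (0 : Fin b → ℍ[ℝ]) = 0 :=
      congrArg (fun z : ModelSp a b ↦ z.2.1) h
    have h3 : r 0 • (0 : Fin 3 → ℝ) + r 1 • (0 : Fin 3 → ℝ) + r 2 • c = 0 :=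
      congrArg (fun z : ModelSp a b ↦ z.2.2) h
    simp only [smul_zero, add_zero, zero_add, smul_eq_zero, hx0', hy0', hc0', or_false] at h1 h2 h3
    intro l
    fin_cases l <;> assumption
  have := hli.fintype_card_le_finrank
  rwa [Fintype.card_fin, hF] at this

end LowerBound

/-! ### A section has dimension at most two -/

section UpperBound

attribute [local instance 2000] Subgroup.instMulAction

variable {a b : ℕ}

/-- The derivative of the action of `rotElem i j r r q` when `r`, `q` and `star q` vary with
velocities `r'`, `q'` and `s'` at the identity. -/
noncomputable def infRotation (i : Fin a) (j : Fin b) (r' q' s' : ℍ[ℝ]) :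
    ModelSp a b →ₗ[ℝ] ModelSp a b where
  toFun z := (fun k ↦ (if k = i then r' else 0) * z.1 k + z.1 k * s',
    fun k ↦ (if k = j then r' else 0) * z.2.1 k + z.2.1 k * s',
    imCoord (q' * ofIm z.2.2 + ofIm z.2.2 * s'))
  map_add' z w := by
    refine Prod.ext (funext fun k ↦ ?_) (Prod.ext (funext fun k ↦ ?_) ?_)
    · simp only [Prod.fst_add, Pi.add_apply, mul_add, add_mul]; abel
    · simp only [Prod.fst_add, Prod.snd_add, Pi.add_apply, mul_add, add_mul]; abel
    · simp only [Prod.snd_add, map_add, mul_add, add_mul]; abel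
  map_smul' c z := by
    refine Prod.ext (funext fun k ↦ ?_) (Prod.ext (funext fun k ↦ ?_) ?_)
    · simp
    · simp
    · simp only [Prod.smul_snd, map_smul, mul_smul_comm, smul_mul_assoc, RingHom.id_apply, ← smul_add]

theorem coordProj_infRotation (i : Fin a) (j : Fin b) (r' q' s' : ℍ[ℝ]) (z : ModelSp a b) :
    coordProj i j (infRotation i j r' q' s' z) =
      (r' * (coordProj i j z).1 + (coordProj i j z).1 * s',
        r' * (coordProj i j z).2 + (coordProj i j z).2 * s') := by
  refine Prod.ext ?_ ?_
  · change (if i = i then r' else 0) * _ + _ = _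
    rw [if_pos rfl]; rfl
  · change (if j = j then r' else 0) * _ + _ = _
    rw [if_pos rfl]; rfl

/-- The vectors `infRotation i j r' q' s' z` are the velocities of the curves of rotations through `z`. -/
theorem infRotation_mem_curveVelocities (i : Fin a) (j : Fin b) {r q : ℝ → unitary ℍ[ℝ]}
    {r' q' : ℍ[ℝ]} (hr : ContDiff ℝ ∞ fun t ↦ (r t : ℍ[ℝ])) (hq : ContDiff ℝ ∞ fun t ↦ (q t : ℍ[ℝ]))
    (hr0 : r 0 = 1) (hq0 : q 0 = 1) (hr' : HasDerivAt (fun t ↦ (r t : ℍ[ℝ])) r' 0)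
    (hq' : HasDerivAt (fun t ↦ (q t : ℍ[ℝ])) q' 0) {S : Set (ModelSp a b)} {z : ModelSp a b}
    (hS : ∀ t, linAct (rotElem i j (r t) (r t) (q t)) z ∈ S) :
    infRotation i j r' q' (star q') z ∈ curveVelocities S z := by
  have hs : ContDiff ℝ ∞ fun t ↦ star (q t : ℍ[ℝ]) := (starL' ℝ : ℍ[ℝ] ≃L[ℝ] ℍ[ℝ]).contDiff.comp hq
  have hs' : HasDerivAt (fun t ↦ star (q t : ℍ[ℝ])) (star q') 0 := hq'.star
  have hr1 : (r 0 : ℍ[ℝ]) = 1 := congrArg Subtype.val hr0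
  have hq1 : (q 0 : ℍ[ℝ]) = 1 := congrArg Subtype.val hq0
  have hs1 : star (q 0 : ℍ[ℝ]) = 1 := by rw [hq1, star_one]
  let f : ℍ[ℝ] →L[ℝ] (Fin 3 → ℝ) := LinearMap.toContinuousLinearMap imCoord
  have hsm {n : ℕ} (i k : Fin n) (x : Fin n → ℍ[ℝ]) : ContDiff ℝ ∞ fun t ↦
      (if k = i then (r t : ℍ[ℝ]) else 1) * x k * star (q t : ℍ[ℝ]) := by
    by_cases hk : k = i
    · simp only [if_pos hk]; exact (hr.mul contDiff_const).mul hs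
    · simp only [if_neg hk]; exact (contDiff_const.mul contDiff_const).mul hs
  have hd {n : ℕ} (i k : Fin n) (x : Fin n → ℍ[ℝ]) : HasDerivAt (fun t ↦
      (if k = i then (r t : ℍ[ℝ]) else 1) * x k * star (q t : ℍ[ℝ]))
      ((if k = i then r' else 0) * x k + x k * star q') 0 := by
    by_cases hk : k = i
    · simp only [if_pos hk]
      have := (hr'.mul_const (x k)).mul hs'
      rwa [hr1, hs1, one_mul, mul_one] at this
    · simp only [if_neg hk, one_mul, zero_mul, zero_add]
      exact hs'.const_mul (x k)
  refine ⟨fun t ↦ linAct (rotElem i j (r t) (r t) (q t)) z, ?_, hS, ?_, ?_⟩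
  · simp only [linAct_rotElem]
    exact (contDiff_pi.2 fun k ↦ hsm i k z.1).prodMk ((contDiff_pi.2 fun k ↦ hsm j k z.2.1).prodMk
      (f.contDiff.comp ((hq.mul contDiff_const).mul hs)))
  · simp only [linAct_rotElem, hr1, hq1, star_one, ite_self, one_mul, mul_one]
    refine Prod.ext rfl (Prod.ext rfl ?_)
    ext k; fin_cases k <;> simp
  · simp only [linAct_rotElem]
    have h3 := (hq'.mul_const (ofIm z.2.2)).mul hs'
    rw [hq1, star_one, one_mul, mul_one] at h3
    exact (hasDerivAt_pi.2 fun k ↦ hd i k z.1).prodMk ((hasDerivAt_pi.2 fun k ↦ hd j k z.2.1).prodMk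
      (f.hasFDerivAt.comp_hasDerivAt 0 h3))

theorem contDiff_quatExp (u : ℍ[ℝ]) (hu : u.re = 0) (hn : ‖u‖ = 1) :
    ContDiff ℝ ∞ fun t ↦ (quatExp u hu hn t : ℍ[ℝ]) :=
  (Real.contDiff_cos.smul contDiff_const).add (Real.contDiff_sin.smul contDiff_const)

theorem hasDerivAt_quatExp (u : ℍ[ℝ]) (hu : u.re = 0) (hn : ‖u‖ = 1) :
    HasDerivAt (fun t ↦ (quatExp u hu hn t : ℍ[ℝ])) u 0 := by
  have := ((Real.hasDerivAt_cos 0).smul_const (1 : ℍ[ℝ])).add ((Real.hasDerivAt_sin 0).smul_const u)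
  rw [Real.sin_zero, Real.cos_zero, neg_zero, zero_smul, zero_add, one_smul] at this
  exact this

theorem quatExp_zero (u : ℍ[ℝ]) (hu : u.re = 0) (hn : ‖u‖ = 1) : quatExp u hu hn 0 = 1 :=
  Subtype.ext (by simp [coe_quatExp])

/-- Rotations of the coordinates `i` and `j` around a point of the orbit of the special point come from
elements of `H`, because the transposition conjugates them into `H`. -/
theorem param_linAct_rotElem_mem_orbit (i : Fin a) (j : Fin b) {h : SpPair a b} (hh : h ∈ SpSub a b)
    (r q : unitary ℍ[ℝ]) (z : ModelSp a b) :
    param (h * swapPair i j) (linAct (rotElem i j r r q) z) ∈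
      Set.range fun l : SpSub a b ↦ l • param (h * swapPair i j) z := by
  have e : h * swapPair i j * rotElem i j r r q * (h * swapPair i j)⁻¹ = h * rotElem i j q q r * h⁻¹ := by
    rw [← swapPair_conj_rotElem i j r q, mul_inv_rev]
    simp only [mul_assoc]
  refine ⟨⟨h * rotElem i j q q r * h⁻¹, mul_mem (mul_mem hh (rotElem_mem _ _ _ _ _)) (inv_mem hh)⟩, ?_⟩
  rw [param_linAct (rotElem_mem _ _ _ _ _), e]
  rfl

/-- The translate by `h` of `param_swapPair_mem_orbit`. -/
theorem param_mem_orbit_of_coordProj (i : Fin a) (j : Fin b) {h : SpPair a b} (hh : h ∈ SpSub a b)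
    {z : ModelSp a b} (hz : coordProj i j z = 0) : param (h * swapPair i j) z ∈
      Set.range fun l : SpSub a b ↦ l • param (h * swapPair i j) 0 := by
  obtain ⟨⟨l, hl⟩, e⟩ := param_swapPair_mem_orbit i j hz
  have e' : l • param (swapPair i j) 0 = param (swapPair i j) z := e
  refine ⟨⟨h * l * h⁻¹, mul_mem (mul_mem hh hl) (inv_mem hh)⟩, ?_⟩
  change (h * l * h⁻¹) • param (h * swapPair i j) 0 = _
  rw [param_mul, param_mul, ← e', smul_smul, smul_smul, inv_mul_cancel_right]

/-- An invariant inner product at the point `param g 0`, restricted to the coordinates `i` and `j`. -/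
noncomputable def coordForm (μ : InvariantRiemannianMetric (ModelSp a b) (SpPair a b) (SpQuot a b))
    (g : SpPair a b) (i : Fin a) (j : Fin b) : ℍ[ℝ] × ℍ[ℝ] →ₗ[ℝ] ℍ[ℝ] × ℍ[ℝ] →ₗ[ℝ] ℝ :=
  LinearMap.mk₂ ℝ (fun y y' ↦ metricForm μ g 0 (coordIncl i j y) (coordIncl i j y'))
    (fun y y' v ↦ by rw [map_add, metricForm_add])
    (fun c y v ↦ by rw [map_smul, metricForm_smul, smul_eq_mul])
    (fun y v v' ↦ by
      rw [map_add, metricForm_symm, metricForm_add, metricForm_symm, metricForm_symm _ _ _ _ (coordIncl i j y)])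
    (fun c y v ↦ by rw [map_smul, metricForm_symm, metricForm_smul, metricForm_symm, smul_eq_mul])

theorem coordForm_apply (μ : InvariantRiemannianMetric (ModelSp a b) (SpPair a b) (SpQuot a b))
    (g : SpPair a b) (i : Fin a) (j : Fin b) (y y' : ℍ[ℝ] × ℍ[ℝ]) :
    coordForm μ g i j y y' = metricForm μ g 0 (coordIncl i j y) (coordIncl i j y') := rfl

/-- The tangent space of a section at a point of the orbit of the special point is a subspace of the
normal space. It is orthogonal to its images under left and right multiplications by imaginary
quaternions, and so its dimension is at most two. -/
theorem le_two_of_orthogonal (μ : InvariantRiemannianMetric (ModelSp a b) (SpPair a b) (SpQuot a b))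
    (i : Fin a) (j : Fin b) {S : Set (SpQuot a b)} {k : ℕ}
    (hS : IsEmbeddedSubmanifold (ModelSp a b) k S)
    (hmeet : ∀ x : SpQuot a b, ∃ h ∈ SpSub a b, h • x ∈ S)
    (horth : ∀ p ∈ S, ∀ u ∈ tangentVectors (E := ModelSp a b) (Set.range fun h : SpSub a b ↦ h • p) p,
      ∀ w ∈ tangentVectors (E := ModelSp a b) S p, μ.inner p u w = 0) : k ≤ 2 := by
  obtain ⟨h, hh, h0⟩ := hmeet (param (swapPair i j) 0)
  rw [← param_mul] at h0
  set g := h * swapPair i j with hg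
  obtain ⟨F, hF, hFv, -, hlim⟩ := (isSubmanifoldAtZero_param hS g h0).exists_tangentSpace
  have horth' (z : ModelSp a b) (hz : z ∈ param g ⁻¹' S) (u : ModelSp a b)
      (hu : u ∈ curveVelocities (param g ⁻¹' Set.range fun l : SpSub a b ↦ l • param g z) z)
      (w : ModelSp a b) (hw : w ∈ curveVelocities (param g ⁻¹' S) z) : metricForm μ g z u w = 0 :=
    horth (param g z) hz _ (mfderiv_mem_tangentVectors (contMDiff_param g) hu) _
      (mfderiv_mem_tangentVectors (contMDiff_param g) hw)
  -- `F` is normal to the orbit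
  have hker (u : ModelSp a b) (hu : coordProj i j u = 0) (w : ModelSp a b) (hw : w ∈ F) :
      metricForm μ g 0 u w = 0 := by
    refine horth' 0 h0 u (smul_mem_curveVelocities fun t ↦ ?_) w (hFv w hw)
    exact param_mem_orbit_of_coordProj i j hh (by rw [map_smul, hu, smul_zero])
  -- hence inner products with vectors in `F` only depend on the coordinates `i` and `j`
  have hform (u w : ModelSp a b) (hw : w ∈ F) : metricForm μ g 0 u w =
      coordForm μ g i j (coordProj i j u) (coordProj i j w) := by
    have h1 : metricForm μ g 0 u w = metricForm μ g 0 (coordIncl i j (coordProj i j u)) w := by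
      have := hker (u - coordIncl i j (coordProj i j u))
        (by rw [map_sub, coordProj_coordIncl, sub_self]) w hw
      rw [← sub_add_cancel u (coordIncl i j (coordProj i j u)), metricForm_add, this, zero_add,
        sub_add_cancel]
    have h2 := metricForm_coordIncl μ g (coordProj i j u)
      (z := w - coordIncl i j (coordProj i j w)) (by rw [map_sub, coordProj_coordIncl, sub_self])
    rw [h1, coordForm_apply, metricForm_symm,
      ← sub_add_cancel w (coordIncl i j (coordProj i j w)), metricForm_add,
      metricForm_symm _ _ _ (w - _), h2, zero_add, sub_add_cancel, metricForm_symm]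
  -- `F` is orthogonal to its images under infinitesimal rotations
  have hrot {r q : ℝ → unitary ℍ[ℝ]} {r' q' : ℍ[ℝ]} (hr : ContDiff ℝ ∞ fun t ↦ (r t : ℍ[ℝ]))
      (hq : ContDiff ℝ ∞ fun t ↦ (q t : ℍ[ℝ])) (hr0 : r 0 = 1) (hq0 : q 0 = 1)
      (hr' : HasDerivAt (fun t ↦ (r t : ℍ[ℝ])) r' 0) (hq' : HasDerivAt (fun t ↦ (q t : ℍ[ℝ])) q' 0)
      (v : ModelSp a b) (hv : v ∈ F) (w : ModelSp a b) (hw : w ∈ F) :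
      metricForm μ g 0 (infRotation i j r' q' (star q') v) w = 0 := by
    obtain ⟨z, z', hz, hz0, hzv, hzw⟩ := hlim v hv w hw
    refine eq_zero_of_tendsto_of_orthogonal (continuous_metricForm μ g) (metricForm_smul μ g)
      (LinearMap.toContinuousLinearMap (infRotation i j r' q' (star q')))
      (fun x hx y hy ↦ horth' x hx _ ?_ y hy) hz hz0 hzv hzw
    exact infRotation_mem_curveVelocities i j hr hq hr0 hq0 hr' hq' fun t ↦
      param_linAct_rotElem_mem_orbit i j hh _ _ x
  have hinj : Function.Injective ((coordProj i j).domRestrict F) := by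
    rw [← LinearMap.ker_eq_bot, LinearMap.ker_eq_bot']
    rintro ⟨w, hw⟩ hw0
    by_contra hne
    refine (metricForm_pos μ g w fun h ↦ hne (Subtype.ext h)).ne' ?_
    have hw0' : coordProj i j w = 0 := hw0
    rw [hform w w hw, hw0', map_zero]
  rw [← hF, ← LinearMap.finrank_range_of_inj hinj, LinearMap.range_domRestrict]
  have hone : ContDiff ℝ ∞ fun _ : ℝ ↦ ((1 : unitary ℍ[ℝ]) : ℍ[ℝ]) := contDiff_const
  have hone' : HasDerivAt (fun _ : ℝ ↦ ((1 : unitary ℍ[ℝ]) : ℍ[ℝ])) 0 0 := hasDerivAt_const _ _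
  refine finrank_le_two_of_orthogonal (coordForm μ g i j) (fun y y' ↦ metricForm_symm _ _ _ _ _)
    (fun y hy ↦ metricForm_pos μ g _ fun h ↦ hy ?_) (fun q r y y' ↦ ?_) _ ?_ ?_
  · rw [← coordProj_coordIncl i j y, h, map_zero]
  · rw [coordForm_apply, coordForm_apply, ← linAct_rotElem_coordIncl, ← linAct_rotElem_coordIncl,
      metricForm_linAct μ g (rotElem_mem _ _ _ _ _)]
  · rintro _ ⟨v, hv, rfl⟩ _ ⟨w, hw, rfl⟩ u hu hn
    have := hrot (contDiff_quatExp u hu hn) hone (quatExp_zero u hu hn) rfl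
      (hasDerivAt_quatExp u hu hn) hone' v hv w hw
    rw [hform _ w hw, coordProj_infRotation, star_zero] at this
    simpa only [mul_zero, add_zero] using this
  · rintro _ ⟨v, hv, rfl⟩ _ ⟨w, hw, rfl⟩ u hu hn
    have := hrot hone (contDiff_quatExp u hu hn) rfl (quatExp_zero u hu hn) hone'
      (hasDerivAt_quatExp u hu hn) v hv w hw
    have hs : star u = -u := by
      apply Quaternion.ext <;> simp [hu]
    rw [hform _ w hw, coordProj_infRotation, hs] at this
    simp only [zero_mul, zero_add, mul_neg, ← Prod.neg_mk, map_neg, LinearMap.neg_apply,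
      neg_eq_zero] at this
    exact this

end UpperBound

theorem mainTheorem8 (a b : ℕ) (ha : 1 ≤ a) (hb : 1 ≤ b) :
    -- the isotropy action is not polar for any invariant metric
    (∀ μ : InvariantRiemannianMetric (ModelSp a b) (SpPair a b) (SpQuot a b),
      ¬ IsPolarAction (fun (h : SpSub a b) (x : SpQuot a b) ↦ h • x) μ.inner) ∧
    -- at some point the slice representation is effectively `SO(4)` on `ℝ⁴ ⊕ ℝ⁴`
    (∃ p : SpQuot a b, ∀ μ : InvariantRiemannianMetric (ModelSp a b) (SpPair a b) (SpQuot a b),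
      ∃ (φ : MulAction.stabilizer (SpSub a b) p →* Matrix.specialOrthogonalGroup (Fin 4) ℝ)
        (L : normalSpace (μ.restrict (SpSub a b)) p ≃ₗ[ℝ] (Fin 4 → ℝ) × (Fin 4 → ℝ)),
        Continuous φ ∧ Function.Surjective φ ∧
          ∀ (k : MulAction.stabilizer (SpSub a b) p) (v : normalSpace (μ.restrict (SpSub a b)) p),
            L (sliceRepresentation (μ.restrict (SpSub a b)) p k v) = doubleStdRep (φ k) (L v)) ∧
    -- that representation is not polar for any invariant inner product
    (∀ B : ((Fin 4 → ℝ) × (Fin 4 → ℝ)) →L[ℝ] ((Fin 4 → ℝ) × (Fin 4 → ℝ)) →L[ℝ] ℝ,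
      (∀ v w, B v w = B w v) → (∀ v, v ≠ 0 → 0 < B v v) →
      (∀ (A : Matrix.specialOrthogonalGroup (Fin 4) ℝ) (v w),
        B (doubleStdRep A v) (doubleStdRep A w) = B v w) →
      ¬ IsPolarRepresentation doubleStdRep B) := by
  refine ⟨?_, ⟨param (swapPair ⟨0, ha⟩ ⟨0, hb⟩) 0, fun μ ↦ ⟨sliceHom ⟨0, ha⟩ ⟨0, hb⟩,
    (normalEquiv μ ⟨0, ha⟩ ⟨0, hb⟩).symm.trans pairTuple, continuous_sliceHom _ _,
    sliceHom_surjective _ _, sliceRepresentation_equiv μ _ _⟩⟩,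
    not_isPolarRepresentation_doubleStdRep⟩
  rintro μ ⟨S, k, -, hS, hmeet, horth⟩
  have hmeet' (x : SpQuot a b) : ∃ h ∈ SpSub a b, h • x ∈ S := by
    obtain ⟨h, hx⟩ := hmeet x
    exact ⟨h.1, h.2, hx⟩
  have h3 := three_le_of_meets_orbits ⟨0, ha⟩ ⟨0, hb⟩ hS hmeet'
  have h2 := le_two_of_orthogonal μ ⟨0, ha⟩ ⟨0, hb⟩ hS hmeet' horth
  omega
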